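/- Let $n<p$ be natural numbers with $3p-4n-4>0$, and put $c_0=6(n+1)/(3p-4n-4)$. Let $X_1,\dots,X_n$ be i.i.d. $N_p(0,\Sigma)$ with $\Sigma$ an unknown positive definite $p\times p$ matrix, and let $S=\sum_{i=1}^n X_iX_i^t\sim W_p(n,\Sigma)$. An estimator $\delta=\delta(S)$ of $\Sigma$ is evaluated by the risk $R_p(\delta,\Sigma)=E[L_p(\delta,\Sigma)]$ under the Stein loss $L_p(\delta,\Sigma)=\operatorname{tr}\Sigma^{-1}\delta-\log\det(\Sigma^{-1}\delta)-p$. With probability one, $S=H\,\mathrm{diag}(\ell_1,\dots,\ell_n)\,H^t$ with $\ell_1>\dots>\ell_n>0$ and $H$ a $p\times n$ matrix with $H^tH=I_n$; let $H_0$ be a $p\times(p-n)$ matrix such that $(H,H_0)$ is orthogonal. Let $b=b(S)$ be a real-valued Borel function such that, on the set of all such $S$, * $\dfrac{c_0n}{1+c_0}\le b(S)\le C$ for a constant $0<C<n$; * for each fixed $H$, $b(H\,\mathrm{diag}(\ell)\,H^t)$ is a differentiable function of $\ell=(\ell_1,\dots,\ell_n)$, and $\sum_{i=1}^n\partial b/\partial\ell_i\ge0$.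 Let $\hat\lambda_b\ge0$ be the unique solution of $\sum_{j=1}^n\dfrac{\hat\lambda_b}{\ell_j+\hat\lambda_b}=b(S)$, and let $$\delta^{EB}(b)=\frac1p\,(S+\hat\lambda_b I_p),\qquad \delta^{SH}(b)=\frac1p\,(S+\hat\lambda_b H_0H_0^t).$$ Then $\delta^{SH}(b)$ dominates $\delta^{EB}(b)$: for every positive definite $\Sigma$ both risks are finite and $R_p(\delta^{SH}(b),\Sigma)\le R_p(\delta^{EB}(b),\Sigma)$, and the inequality is strict for at least one $\Sigma$. -/

import Mathlib

open MeasureTheory ProbabilityTheory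

namespace SteinCov

open Matrix

/-- The sum of squares and products `S = ∑ᵢ Xᵢ Xᵢᵗ` of the sample `X₁, …, Xₙ ∈ ℝᵖ`. -/
noncomputable def gramSum {p n : ℕ} (X : Fin n → EuclideanSpace ℝ (Fin p)) :
    Matrix (Fin p) (Fin p) ℝ :=
  ∑ i, vecMulVec (X i) (X i)

/-- The law of an i.i.d. sample `X₁, …, Xₙ` from `N_p(0, Sig)`. Under this law `gramSum X` has the
Wishart distribution `W_p(n, Sig)`. -/
noncomputable def sampleLaw {p : ℕ} (n : ℕ) (Sig : Matrix (Fin p) (Fin p) ℝ) :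
    Measure (Fin n → EuclideanSpace ℝ (Fin p)) :=
  Measure.pi fun _ => multivariateGaussian 0 Sig

/-- The Stein loss `tr(Sig⁻¹ δ) - log det(Sig⁻¹ δ) - p`. -/
noncomputable def steinLoss {p : ℕ} (δ Sig : Matrix (Fin p) (Fin p) ℝ) : ℝ :=
  (Sig⁻¹ * δ).trace - Real.log (Sig⁻¹ * δ).det - p

/-- The estimator `δ = δ(S)` has finite risk at `Sig` when `S ∼ W_p(n, Sig)`. -/
def HasFiniteRisk {p : ℕ} (n : ℕ) (δ : Matrix (Fin p) (Fin p) ℝ → Matrix (Fin p) (Fin p) ℝ)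
    (Sig : Matrix (Fin p) (Fin p) ℝ) : Prop :=
  Integrable (fun X => steinLoss (δ (gramSum X)) Sig) (sampleLaw n Sig)

/-- The risk `E[L(δ(S), Sig)]` of the estimator `δ = δ(S)`, where `S ∼ W_p(n, Sig)`. -/
noncomputable def risk {p : ℕ} (n : ℕ)
    (δ : Matrix (Fin p) (Fin p) ℝ → Matrix (Fin p) (Fin p) ℝ)
    (Sig : Matrix (Fin p) (Fin p) ℝ) : ℝ :=
  ∫ X, steinLoss (δ (gramSum X)) Sig ∂(sampleLaw n Sig)

/-- `δ₁` dominates `δ₂`: both have finite risk, the risk of `δ₁` is nowhere larger than that of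
`δ₂`, and somewhere it is strictly smaller. The parameter ranges over all positive definite
matrices. -/
def Dominates {p : ℕ} (n : ℕ)
    (δ₁ δ₂ : Matrix (Fin p) (Fin p) ℝ → Matrix (Fin p) (Fin p) ℝ) : Prop :=
  (∀ Sig : Matrix (Fin p) (Fin p) ℝ, Sig.PosDef →
    HasFiniteRisk n δ₁ Sig ∧ HasFiniteRisk n δ₂ Sig ∧ risk n δ₁ Sig ≤ risk n δ₂ Sig) ∧
  ∃ Sig : Matrix (Fin p) (Fin p) ℝ, Sig.PosDef ∧ risk n δ₁ Sig < risk n δ₂ Sig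

/-- `S = H diag(ℓ) Hᵗ` with `ℓ₁ > ⋯ > ℓₙ > 0` and `(H, H₀)` an orthogonal `p × p` matrix. -/
structure IsSpectralDecomp {p n : ℕ} (S : Matrix (Fin p) (Fin p) ℝ)
    (H : Matrix (Fin p) (Fin n) ℝ) (H₀ : Matrix (Fin p) (Fin (p - n)) ℝ) (ℓ : Fin n → ℝ) :
    Prop where
  transpose_mul : (fromCols H H₀)ᵀ * fromCols H H₀ = 1
  mul_transpose : fromCols H H₀ * (fromCols H H₀)ᵀ = 1
  anti : StrictAnti ℓ
  pos : ∀ i, 0 < ℓ i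
  eq : S = H * diagonal ℓ * Hᵀ

/-- The root `lam ≥ 0` of `∑ⱼ lam / (ℓⱼ + lam) = β`; see `existsUnique_lam`. -/
noncomputable def lamHat {n : ℕ} (ℓ : Fin n → ℝ) (β : ℝ) : ℝ :=
  sInf {lam : ℝ | 0 ≤ lam ∧ ∑ j, lam / (ℓ j + lam) = β}

open Classical in
/-- The estimator `δ^EB(b) = p⁻¹ (S + lam I)`, with `lam` the root belonging to the nonzero
eigenvalues of `S` and to `b(S)`. It is given the value `0` on the null set where `S` does not have
exactly `n` nonzero eigenvalues, distinct and positive. -/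
noncomputable def deltaEB {p : ℕ} (n : ℕ) (b : Matrix (Fin p) (Fin p) ℝ → ℝ)
    (S : Matrix (Fin p) (Fin p) ℝ) : Matrix (Fin p) (Fin p) ℝ :=
  if h : ∃ D : Matrix (Fin p) (Fin n) ℝ × Matrix (Fin p) (Fin (p - n)) ℝ × (Fin n → ℝ),
      IsSpectralDecomp S D.1 D.2.1 D.2.2 then
    (p : ℝ)⁻¹ • (S + lamHat h.choose.2.2 (b S) • (1 : Matrix (Fin p) (Fin p) ℝ))
  else 0

open Classical in
/-- The shrinkage estimator `δ^SH(b) = p⁻¹ (S + lam H₀ H₀ᵗ)`, with the same `lam` and the same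
convention as for `deltaEB`. -/
noncomputable def deltaSH {p : ℕ} (n : ℕ) (b : Matrix (Fin p) (Fin p) ℝ → ℝ)
    (S : Matrix (Fin p) (Fin p) ℝ) : Matrix (Fin p) (Fin p) ℝ :=
  if h : ∃ D : Matrix (Fin p) (Fin n) ℝ × Matrix (Fin p) (Fin (p - n)) ℝ × (Fin n → ℝ),
      IsSpectralDecomp S D.1 D.2.1 D.2.2 then
    (p : ℝ)⁻¹ • (S + lamHat h.choose.2.2 (b S) • (h.choose.2.1 * h.choose.2.1ᵀ))
  else 0

/-- The function `ℓ ↦ b(H diag(ℓ) Hᵗ)`: `b` as a function of the nonzero eigenvalues, the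
eigenvectors being fixed. -/
noncomputable def eigFun {p n : ℕ} (b : Matrix (Fin p) (Fin p) ℝ → ℝ)
    (H : Matrix (Fin p) (Fin n) ℝ) (ℓ : Fin n → ℝ) : ℝ :=
  b (H * diagonal ℓ * Hᵀ)

/-- The partial derivative `∂b/∂ℓᵢ` at `H diag(ℓ) Hᵗ`. -/
noncomputable def eigPartial {p n : ℕ} (b : Matrix (Fin p) (Fin p) ℝ → ℝ)
    (H : Matrix (Fin p) (Fin n) ℝ) (ℓ : Fin n → ℝ) (i : Fin n) : ℝ :=
  deriv (fun t => eigFun b H (Function.update ℓ i t)) (ℓ i)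

/-! The objects above are well defined. -/

theorem existsUnique_lam {n : ℕ} {ℓ : Fin n → ℝ} (hℓ : ∀ i, 0 < ℓ i) {β : ℝ}
    (h0 : 0 ≤ β) (hn : β < n) :
    ∃! lam : ℝ, 0 ≤ lam ∧ ∑ j, lam / (ℓ j + lam) = β := by
  have hnpos : (0 : ℝ) < n := h0.trans_lt hn
  have : Nonempty (Fin n) := ⟨⟨0, by exact_mod_cast hnpos⟩⟩
  set L := ∑ j, ℓ j with hL
  have hLj : ∀ j, ℓ j ≤ L := fun j =>
    Finset.single_le_sum (fun i _ => (hℓ i).le) (Finset.mem_univ j)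
  have hLpos : 0 < L := Finset.sum_pos (fun i _ => hℓ i) Finset.univ_nonempty
  set M := β * L / (n - β) with hM
  have hd : 0 < (n : ℝ) - β := sub_pos.2 hn
  have hM0 : 0 ≤ M := by positivity
  have hcont : ContinuousOn (fun x : ℝ => ∑ j, x / (ℓ j + x)) (Set.Icc 0 M) := by
    refine continuousOn_finsetSum _ fun j _ => ?_
    refine continuousOn_id.div (by fun_prop) fun x hx => ?_
    have := hℓ j; have := hx.1; positivity
  have hfM : β ≤ ∑ j, M / (ℓ j + M) := by
    have h1 : ∀ j ∈ Finset.univ, β / n ≤ M / (ℓ j + M) := by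
      intro j _
      have hj := hℓ j
      rw [div_le_div_iff₀ hnpos (by positivity)]
      have h2 : M * (n - β) = β * L := by rw [hM]; field_simp
      nlinarith [mul_le_mul_of_nonneg_left (hLj j) h0]
    calc β = ∑ _j : Fin n, β / n := by simp; field_simp
      _ ≤ _ := Finset.sum_le_sum h1
  obtain ⟨x, hx, hfx⟩ := intermediate_value_Icc hM0 hcont (show β ∈ Set.Icc _ _ from
    ⟨by simpa using h0, hfM⟩)
  have hstrict : ∀ a c : ℝ, 0 ≤ a → a < c →
      ∑ j, a / (ℓ j + a) < ∑ j, c / (ℓ j + c) := by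
    intro a c ha hac
    refine Finset.sum_lt_sum_of_nonempty Finset.univ_nonempty fun j _ => ?_
    have hj := hℓ j
    rw [div_lt_div_iff₀ (by positivity) (by linarith)]
    nlinarith [mul_pos hj (sub_pos.2 hac)]
  refine ⟨x, ⟨hx.1, hfx⟩, fun y hy => ?_⟩
  rcases lt_trichotomy y x with h | h | h
  · have := hstrict y x hy.1 h
    simp only at hfx; linarith [hy.2]
  · exact h
  · have := hstrict x y hx.1 h
    simp only at hfx; linarith [hy.2]

theorem lamHat_spec {n : ℕ} {ℓ : Fin n → ℝ} (hℓ : ∀ i, 0 < ℓ i) {β : ℝ}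
    (h0 : 0 ≤ β) (hn : β < n) :
    0 ≤ lamHat ℓ β ∧ ∑ j, lamHat ℓ β / (ℓ j + lamHat ℓ β) = β := by
  obtain ⟨x, hx, hu⟩ := existsUnique_lam hℓ h0 hn
  have : {lam : ℝ | 0 ≤ lam ∧ ∑ j, lam / (ℓ j + lam) = β} = {x} :=
    Set.eq_singleton_iff_unique_mem.2 ⟨hx, hu⟩
  rw [lamHat, this, csInf_singleton]
  exact hx

namespace IsSpectralDecomp

variable {p n : ℕ} {S : Matrix (Fin p) (Fin p) ℝ} {H K : Matrix (Fin p) (Fin n) ℝ}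
  {H₀ K₀ : Matrix (Fin p) (Fin (p - n)) ℝ} {ℓ m : Fin n → ℝ}

theorem blocks (h : IsSpectralDecomp S H H₀ ℓ) :
    Hᵀ * H = 1 ∧ Hᵀ * H₀ = 0 ∧ H₀ᵀ * H = 0 ∧ H₀ᵀ * H₀ = 1 := by
  have := h.transpose_mul
  rw [transpose_fromCols, fromRows_mul_fromCols, ← fromBlocks_one, fromBlocks_inj] at this
  exact this

theorem sum_proj (h : IsSpectralDecomp S H H₀ ℓ) : H * Hᵀ + H₀ * H₀ᵀ = 1 := by
  have := h.mul_transpose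
  rwa [transpose_fromCols, fromCols_mul_fromRows] at this

theorem le (h : IsSpectralDecomp S H H₀ ℓ) : n ≤ p := by
  have h1 := h.blocks.1
  have h2 := Matrix.rank_mul_le_left Hᵀ H
  rw [h1, rank_one] at h2
  simpa using h2.trans (Matrix.rank_le_width Hᵀ)

theorem eigenvalues_unique (h : IsSpectralDecomp S H H₀ ℓ) (k : IsSpectralDecomp S K K₀ m) :
    ℓ = m := by
  have key : ∀ {H : Matrix (Fin p) (Fin n) ℝ} {H₀ : Matrix (Fin p) (Fin (p - n)) ℝ}
      {ℓ : Fin n → ℝ}, IsSpectralDecomp S H H₀ ℓ →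
      S.charpoly = Polynomial.X ^ (p - n) * (diagonal ℓ).charpoly := by
    intro H H₀ ℓ h
    have := charpoly_mul_comm_of_le H (diagonal ℓ * Hᵀ) (by simpa using h.le)
    rw [Matrix.mul_assoc, h.blocks.1, Matrix.mul_one, ← Matrix.mul_assoc, ← h.eq] at this
    simpa using this
  have e := (key h).symm.trans (key k)
  have e := mul_left_cancel₀ (pow_ne_zero _ Polynomial.X_ne_zero) e
  rw [charpoly_diagonal, charpoly_diagonal] at e
  have r : Set.range ℓ = Set.range m := by
    ext x
    have e' := congrArg (Polynomial.eval x) e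
    simp only [Polynomial.eval_prod, Polynomial.eval_sub, Polynomial.eval_X,
      Polynomial.eval_C] at e'
    have e'' : (∏ j, (x - ℓ j)) = 0 ↔ (∏ j, (x - m j)) = 0 := by rw [e']
    rw [Finset.prod_eq_zero_iff, Finset.prod_eq_zero_iff] at e''
    simpa [sub_eq_zero, eq_comm] using e''
  exact (StrictAnti.range_inj h.anti k.anti).1 r

theorem kernel_proj_unique (h : IsSpectralDecomp S H H₀ ℓ) (k : IsSpectralDecomp S K K₀ m) :
    H₀ * H₀ᵀ = K₀ * K₀ᵀ := by
  have key : ∀ {H K : Matrix (Fin p) (Fin n) ℝ} {H₀ K₀ : Matrix (Fin p) (Fin (p - n)) ℝ}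
      {ℓ m : Fin n → ℝ}, IsSpectralDecomp S H H₀ ℓ → IsSpectralDecomp S K K₀ m →
      (K₀ * K₀ᵀ) * (H₀ * H₀ᵀ) = H₀ * H₀ᵀ := by
    intro H K H₀ K₀ ℓ m h k
    have h1 : S * H₀ = 0 := by
      rw [h.eq, Matrix.mul_assoc, h.blocks.2.1, Matrix.mul_zero]
    have h2 : diagonal m * (Kᵀ * H₀) = 0 := by
      have := congrArg (Kᵀ * ·) h1
      simp only [Matrix.mul_zero] at this
      rwa [k.eq, ← Matrix.mul_assoc, ← Matrix.mul_assoc, ← Matrix.mul_assoc, k.blocks.1,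
        Matrix.one_mul, Matrix.mul_assoc] at this
    have h3 : Kᵀ * H₀ = 0 := by
      ext i j
      have := congrFun (congrFun h2 i) j
      rw [diagonal_mul] at this
      simpa [(k.pos i).ne'] using this
    have h4 := congrArg (· * (H₀ * H₀ᵀ)) k.sum_proj
    simp only [Matrix.add_mul, Matrix.one_mul] at h4
    rwa [Matrix.mul_assoc K, ← Matrix.mul_assoc Kᵀ, h3, Matrix.zero_mul, Matrix.mul_zero,
      zero_add] at h4
  have a := congrArg transpose (key h k)
  simp only [Matrix.transpose_mul, Matrix.transpose_transpose] at a
  rw [← a, key k h]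

theorem deltaEB_eq (h : IsSpectralDecomp S H H₀ ℓ) (b : Matrix (Fin p) (Fin p) ℝ → ℝ) :
    deltaEB n b S =
      (p : ℝ)⁻¹ • (S + lamHat ℓ (b S) • (1 : Matrix (Fin p) (Fin p) ℝ)) := by
  have hex : ∃ D : Matrix (Fin p) (Fin n) ℝ × Matrix (Fin p) (Fin (p - n)) ℝ × (Fin n → ℝ),
      IsSpectralDecomp S D.1 D.2.1 D.2.2 := ⟨(H, H₀, ℓ), h⟩
  rw [deltaEB, dif_pos hex, hex.choose_spec.eigenvalues_unique h]

theorem deltaSH_eq (h : IsSpectralDecomp S H H₀ ℓ) (b : Matrix (Fin p) (Fin p) ℝ → ℝ) :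
    deltaSH n b S = (p : ℝ)⁻¹ • (S + lamHat ℓ (b S) • (H₀ * H₀ᵀ)) := by
  have hex : ∃ D : Matrix (Fin p) (Fin n) ℝ × Matrix (Fin p) (Fin (p - n)) ℝ × (Fin n → ℝ),
      IsSpectralDecomp S D.1 D.2.1 D.2.2 := ⟨(H, H₀, ℓ), h⟩
  rw [deltaSH, dif_pos hex, hex.choose_spec.eigenvalues_unique h,
    hex.choose_spec.kernel_proj_unique h]

end IsSpectralDecomp

end SteinCov

namespace SteinCov

open Matrix

/-! ### Spectral and singular value decompositions -/

/-! Let `X` be the `p × n` data matrix, `W = XᵗX`, `P = HHᵗ` the projection onto its column space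
and `λ` the root. Since `H₀H₀ᵗ = 1 - P`, the two losses share all terms except a trace and a
log-determinant, and the risk of EB minus the risk of SH is `E[p⁻¹ λ tr(Σ⁻¹P) - ∑ log(1 + λ/ℓᵢ)]`.
Two facts show that this is positive at every `Σ`.

The first is a divergence inequality, `(p-n-1) E[λ tr W⁻¹] ≤ E[λ tr(Σ⁻¹P)]`
(`lintegral_trace_inv_le`). Shift all nonzero eigenvalues by `s` and keep the eigenvectors. On `W`
this is the translation `W ↦ W + s`, of Jacobian one, and `W` has a density proportional to `det ^
((p-n-1)/2)` under Lebesgue measure on the data. The shift increases `λ`: by the condition on the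
partial derivatives `b` grows along it, while the terms `λ/(ℓⱼ+λ)` shrink. Comparing the integral of
`λ` with its shifted form and letting `s → 0` gives the inequality. Nothing is differentiated under
the integral, so `λ` need only be monotone along the shift. The density of `W` is identified by its
Laplace transform (`exists_lintegral_innerMat`), and the passage from `S` to `W` averages over the
orthogonal group (`lintegral_shift_le`), with no coordinates on frames.

The second is pointwise: `p ∑ log(1 + xᵢ) < (p-n-1) ∑ xᵢ` for `xᵢ = λ/ℓᵢ` (`sum_log_lt`). The lower
bound on `b` says that the mean of `xᵢ/(1+xᵢ)` is at least `c₀/(1+c₀)`, hence by convexity the mean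
of the `xᵢ` is at least `c₀`. Concavity of the logarithm reduces the claim to the single point `c₀`,
where a Padé bound for `log(1+c)` applies; `c₀` is exactly the value at which this bound suffices.

Finiteness of the risks follows from `|log x| ≤ x + 1/x` and the moments of `tr W` and `tr W⁻¹`; the
second comes from the divergence inequality with constant weight. -/

theorem exists_antitone_spectral {n : ℕ} {W : Matrix (Fin n) (Fin n) ℝ} (hW : W.IsHermitian) :
    ∃ (V : Matrix (Fin n) (Fin n) ℝ) (ℓ : Fin n → ℝ),
      Vᵀ * V = 1 ∧ V * Vᵀ = 1 ∧ Antitone ℓ ∧ W = V * diagonal ℓ * Vᵀ := by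
  set U : Matrix (Fin n) (Fin n) ℝ := hW.eigenvectorUnitary.1 with hU
  have hUU : Uᵀ * U = 1 := by
    have := Unitary.coe_star_mul_self hW.eigenvectorUnitary
    rwa [star_eq_conjTranspose, conjTranspose_eq_transpose_of_trivial] at this
  have hspec : W = U * diagonal hW.eigenvalues * Uᵀ := by
    have := hW.spectral_theorem
    rw [Unitary.conjStarAlgAut_apply, star_eq_conjTranspose,
      conjTranspose_eq_transpose_of_trivial] at this
    simpa using this
  let σ : Equiv.Perm (Fin n) := Tuple.sort fun i => -hW.eigenvalues i
  have hσ := Tuple.monotone_sort fun i => -hW.eigenvalues i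
  have h1 : (U.submatrix id σ)ᵀ * U.submatrix id σ = 1 := by
    have := submatrix_mul_equiv Uᵀ U σ (Equiv.refl _) σ
    rw [hUU, submatrix_one_equiv] at this
    exact this
  refine ⟨U.submatrix id σ, hW.eigenvalues ∘ σ, h1, mul_eq_one_comm.1 h1, ?_, ?_⟩
  · intro i j hij
    have := hσ hij
    simpa using this
  · have : diagonal (hW.eigenvalues ∘ σ) = (diagonal hW.eigenvalues).submatrix σ σ := by
      simp
    rw [this, transpose_submatrix, submatrix_mul_equiv, submatrix_mul_equiv]
    simpa using hspec

theorem exists_orthogonal_completion {p n : ℕ} (H : Matrix (Fin p) (Fin n) ℝ) (hH : Hᵀ * H = 1) :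
    ∃ H₀ : Matrix (Fin p) (Fin (p - n)) ℝ,
      (fromCols H H₀)ᵀ * fromCols H H₀ = 1 ∧ fromCols H H₀ * (fromCols H H₀)ᵀ = 1 := by
  have hle : n ≤ p := by
    have h2 := Matrix.rank_mul_le_left Hᵀ H
    rw [hH, rank_one] at h2
    simpa using h2.trans (Matrix.rank_le_width Hᵀ)
  -- The zeros are placeholders: the extension theorem needs orthonormality only on the left summand
  -- and overwrites the right one.
  let v : Fin n ⊕ Fin (p - n) → EuclideanSpace ℝ (Fin p) :=
    Sum.elim (fun j => WithLp.toLp 2 fun i => H i j) fun _ => 0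
  have hv : Orthonormal ℝ ((Set.range Sum.inl).domRestrict v) := by
    rw [orthonormal_iff_ite]
    rintro ⟨_, i, rfl⟩ ⟨_, j, rfl⟩
    have := congrFun (congrFun hH j) i
    simp only [mul_apply, transpose_apply, one_apply] at this
    have hij : (⟨Sum.inl i, Set.mem_range_self i⟩ :
        Set.range (Sum.inl : Fin n → Fin n ⊕ Fin (p - n))) =
        ⟨Sum.inl j, Set.mem_range_self j⟩ ↔ j = i := by
      rw [Subtype.ext_iff, Sum.inl.injEq, eq_comm]
    rw [if_congr hij rfl rfl, ← this]
    simp [v, PiLp.inner_apply]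
  obtain ⟨e, he⟩ := hv.exists_orthonormalBasis_extension_of_card_eq (by simp; omega)
  have hent : ∀ j i, fromCols H (of fun i j => e (Sum.inr j) i) i j = e j i := by
    rintro (j | j) i
    · rw [he (Sum.inl j) ⟨j, rfl⟩]; simp [v]
    · simp
  have h1 : (fromCols H (of fun i j => e (Sum.inr j) i))ᵀ *
      fromCols H (of fun i j => e (Sum.inr j) i) = 1 := by
    ext i j
    have := orthonormal_iff_ite.1 e.orthonormal j i
    simp only [mul_apply, transpose_apply, hent, one_apply]
    simp only [PiLp.inner_apply, RCLike.inner_apply, conj_trivial] at this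
    rw [this]
    exact if_congr eq_comm rfl rfl
  refine ⟨_, h1, ?_⟩
  have hcard : Fintype.card (Fin n ⊕ Fin (p - n)) = Fintype.card (Fin p) := by simp; omega
  exact (mul_eq_one_comm_of_card_eq _ _ _ hcard).1 h1

theorem posDef_of_spectral {n : ℕ} {V : Matrix (Fin n) (Fin n) ℝ} {ℓ : Fin n → ℝ}
    (hV' : V * Vᵀ = 1) :
    (V * diagonal ℓ * Vᵀ).PosDef ↔ ∀ i, 0 < ℓ i := by
  have hu : IsUnit V := IsUnit.of_mul_eq_one _ hV'
  have := hu.posDef_star_right_conjugate_iff (x := diagonal ℓ)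
  rw [star_eq_conjTranspose, conjTranspose_eq_transpose_of_trivial] at this
  rw [this, posDef_diagonal_iff]

theorem det_spectral {n : ℕ} {V : Matrix (Fin n) (Fin n) ℝ} {ℓ : Fin n → ℝ}
    (hV : Vᵀ * V = 1) : (V * diagonal ℓ * Vᵀ).det = ∏ i, ℓ i := by
  rw [det_mul, det_mul, mul_right_comm, ← det_mul, mul_eq_one_comm.1 hV, det_one, one_mul,
    det_diagonal]

theorem trace_spectral {n : ℕ} {V : Matrix (Fin n) (Fin n) ℝ} {ℓ : Fin n → ℝ}
    (hV : Vᵀ * V = 1) : (V * diagonal ℓ * Vᵀ).trace = ∑ i, ℓ i := by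
  rw [Matrix.mul_assoc, trace_mul_comm, Matrix.mul_assoc, hV, Matrix.mul_one, trace_diagonal]

theorem spectral_add_smul_one {n : ℕ} {V : Matrix (Fin n) (Fin n) ℝ} {ℓ : Fin n → ℝ}
    (hV : V * Vᵀ = 1) (s : ℝ) :
    V * diagonal ℓ * Vᵀ + s • (1 : Matrix (Fin n) (Fin n) ℝ) =
      V * diagonal (fun i => ℓ i + s) * Vᵀ := by
  have : diagonal (fun i => ℓ i + s) = diagonal ℓ + s • (1 : Matrix (Fin n) (Fin n) ℝ) := by
    rw [smul_one_eq_diagonal, diagonal_add]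
  rw [this, Matrix.mul_add, Matrix.add_mul, Matrix.mul_smul, Matrix.smul_mul, Matrix.mul_one, hV]

theorem spectral_inv {n : ℕ} {V : Matrix (Fin n) (Fin n) ℝ} {ℓ : Fin n → ℝ}
    (hV : Vᵀ * V = 1) (hℓ : ∀ i, ℓ i ≠ 0) :
    (V * diagonal ℓ * Vᵀ)⁻¹ = V * diagonal (fun i => (ℓ i)⁻¹) * Vᵀ := by
  apply inv_eq_right_inv
  calc V * diagonal ℓ * Vᵀ * (V * diagonal (fun i => (ℓ i)⁻¹) * Vᵀ)
      = V * diagonal ℓ * (Vᵀ * V) * diagonal (fun i => (ℓ i)⁻¹) * Vᵀ := by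
        simp only [Matrix.mul_assoc]
    _ = 1 := by
        rw [hV, Matrix.mul_one, Matrix.mul_assoc V, diagonal_mul_diagonal]
        simp [hℓ, mul_eq_one_comm.1 hV]

/-- The data of a singular value decomposition `A = H diag(√ℓ) Vᵀ` of a matrix of full column
rank, expressed through `AᵀA`, `AAᵀ` and the projection onto the column space. -/
structure SingularData {p n : ℕ} (A : Matrix (Fin p) (Fin n) ℝ)
    (V : Matrix (Fin n) (Fin n) ℝ) (H : Matrix (Fin p) (Fin n) ℝ) (ℓ : Fin n → ℝ) : Prop where
  V_left : Vᵀ * V = 1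
  V_right : V * Vᵀ = 1
  H_left : Hᵀ * H = 1
  anti : Antitone ℓ
  pos : ∀ i, 0 < ℓ i
  gram : Aᵀ * A = V * diagonal ℓ * Vᵀ
  outer : A * Aᵀ = H * diagonal ℓ * Hᵀ
  proj : A * (Aᵀ * A)⁻¹ * Aᵀ = H * Hᵀ

theorem exists_singularData {p n : ℕ} {A : Matrix (Fin p) (Fin n) ℝ} (hA : (Aᵀ * A).PosDef) :
    ∃ V H ℓ, SingularData A V H ℓ := by
  obtain ⟨V, ℓ, hV, hV', hanti, hW⟩ := exists_antitone_spectral hA.isHermitian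
  have hpos : ∀ i, 0 < ℓ i := by rw [hW] at hA; exact (posDef_of_spectral hV').1 hA
  have hs : ∀ i, √(ℓ i) ≠ 0 := fun i => (Real.sqrt_pos.2 (hpos i)).ne'
  have hss : ∀ i, √(ℓ i) * √(ℓ i) = ℓ i := fun i => Real.mul_self_sqrt (hpos i).le
  set D := diagonal fun i => (√(ℓ i))⁻¹ with hD
  have hDt : Dᵀ = D := by simp [hD]
  have hDD : D * D = diagonal fun i => (ℓ i)⁻¹ := by
    rw [hD, diagonal_mul_diagonal]; congr 1; ext i; rw [← mul_inv, hss]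
  have hDlD : D * diagonal ℓ * D = 1 := by
    rw [hD, diagonal_mul_diagonal, diagonal_mul_diagonal, ← diagonal_one]; congr 1; ext i
    nth_rw 2 [← hss i]; field_simp [hs i]
  -- The left singular vectors are the columns of `A V`, which are orthogonal of squared length
  -- `ℓᵢ`, after normalisation by `D = diag(ℓᵢ^(-1/2))`.
  refine ⟨V, A * V * D, ℓ, hV, hV', ?_, hanti, hpos, hW, ?_, ?_⟩
  · calc (A * V * D)ᵀ * (A * V * D) = D * (Vᵀ * (Aᵀ * A) * V) * D := by
          simp only [transpose_mul, hDt, Matrix.mul_assoc]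
      _ = D * ((Vᵀ * V) * diagonal ℓ * (Vᵀ * V)) * D := by
          rw [hW]; simp only [Matrix.mul_assoc]
      _ = 1 := by rw [hV, Matrix.one_mul, Matrix.mul_one, hDlD]
  · have h2 : D * diagonal ℓ * D = 1 := hDlD
    calc A * Aᵀ = A * (V * Vᵀ) * Aᵀ := by rw [hV', Matrix.mul_one]
      _ = A * V * (D * diagonal ℓ * D) * (A * V)ᵀ := by
          rw [h2]; simp only [transpose_mul, Matrix.mul_assoc, Matrix.one_mul]
      _ = _ := by
          rw [transpose_mul (A * V) D, hDt]; simp only [Matrix.mul_assoc]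
  · rw [hW, spectral_inv hV fun i => (hpos i).ne', ← hDD]
    simp only [transpose_mul, hDt, Matrix.mul_assoc]

namespace SingularData

variable {p n : ℕ} {A : Matrix (Fin p) (Fin n) ℝ} {V : Matrix (Fin n) (Fin n) ℝ}
  {H : Matrix (Fin p) (Fin n) ℝ} {ℓ : Fin n → ℝ}

theorem det_gram_add (h : SingularData A V H ℓ) (s : ℝ) :
    (Aᵀ * A + s • (1 : Matrix (Fin n) (Fin n) ℝ)).det = ∏ i, (ℓ i + s) := by
  rw [h.gram, spectral_add_smul_one h.V_right, det_spectral h.V_left]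

theorem det_gram (h : SingularData A V H ℓ) : (Aᵀ * A).det = ∏ i, ℓ i := by
  rw [h.gram, det_spectral h.V_left]

theorem trace_gram (h : SingularData A V H ℓ) : (Aᵀ * A).trace = ∑ i, ℓ i := by
  rw [h.gram, trace_spectral h.V_left]

theorem trace_gram_inv (h : SingularData A V H ℓ) : (Aᵀ * A)⁻¹.trace = ∑ i, (ℓ i)⁻¹ := by
  rw [h.gram, spectral_inv h.V_left fun i => (h.pos i).ne', trace_spectral h.V_left]

theorem outer_add_proj (h : SingularData A V H ℓ) (s : ℝ) :
    A * Aᵀ + s • (A * (Aᵀ * A)⁻¹ * Aᵀ) = H * diagonal (fun i => ℓ i + s) * Hᵀ := by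
  have : diagonal (fun i => ℓ i + s) = diagonal ℓ + s • (1 : Matrix (Fin n) (Fin n) ℝ) := by
    rw [smul_one_eq_diagonal, diagonal_add]
  rw [h.proj, h.outer, this, Matrix.mul_add, Matrix.add_mul, Matrix.mul_smul, Matrix.smul_mul, Matrix.mul_one]

end SingularData

/-! ### Moment generating functions near the origin determine a finite measure -/

/-- The complex moment generating functions are analytic on the strip `|Re z| < ε` and agree on a
real interval, hence on the whole strip. On its imaginary axis they are the characteristic
functions. -/
theorem map_eq_of_mgf_eq_near_zero {Ω Ω' : Type*} [MeasurableSpace Ω] [MeasurableSpace Ω']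
    {μ : Measure Ω} {μ' : Measure Ω'} [IsFiniteMeasure μ] [IsFiniteMeasure μ']
    {X : Ω → ℝ} {Y : Ω' → ℝ} (hXm : AEMeasurable X μ) (hYm : AEMeasurable Y μ')
    {ε : ℝ} (hε : 0 < ε)
    (hX : ∀ t, |t| < ε → Integrable (fun ω => Real.exp (t * X ω)) μ)
    (hY : ∀ t, |t| < ε → Integrable (fun ω => Real.exp (t * Y ω)) μ')
    (h : ∀ t, |t| < ε → mgf X μ t = mgf Y μ' t) : μ.map X = μ'.map Y := by
  let I : Set ℝ := Set.Ioo (-ε) ε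
  have hI : IsOpen I := isOpen_Ioo
  have hXs : I ⊆ interior (integrableExpSet X μ) :=
    interior_maximal (fun t ht => hX t (abs_lt.2 ht)) hI
  have hYs : I ⊆ interior (integrableExpSet Y μ') :=
    interior_maximal (fun t ht => hY t (abs_lt.2 ht)) hI
  have hXa : AnalyticOnNhd ℂ (complexMGF X μ) {z | z.re ∈ I} :=
    analyticOnNhd_complexMGF.mono fun z hz => hXs hz
  have hYa : AnalyticOnNhd ℂ (complexMGF Y μ') {z | z.re ∈ I} :=
    analyticOnNhd_complexMGF.mono fun z hz => hYs hz
  have h0 : (0 : ℝ) ∈ I := ⟨by linarith, hε⟩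
  have heq : Set.EqOn (complexMGF X μ) (complexMGF Y μ') {z | z.re ∈ I} := by
    refine AnalyticOnNhd.eqOn_of_preconnected_of_frequently_eq hXa hYa
      ((convex_Ioo _ _).linear_preimage Complex.reLm).isPreconnected
      (z₀ := ((0 : ℝ) : ℂ)) (by simpa using h0) ?_
    have h_real : ∃ᶠ x : ℝ in nhdsWithin 0 {0}ᶜ, complexMGF X μ x = complexMGF Y μ' x := by
      refine Filter.Eventually.frequently ?_
      filter_upwards [nhdsWithin_le_nhds (hI.mem_nhds h0)] with x hx
      rw [complexMGF_ofReal, complexMGF_ofReal, h x (abs_lt.2 hx)]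
    rw [Filter.frequently_iff_seq_forall] at h_real ⊢
    obtain ⟨xs, hx_tendsto, hx_eq⟩ := h_real
    refine ⟨fun n => xs n, ?_, hx_eq⟩
    rw [tendsto_nhdsWithin_iff] at hx_tendsto ⊢
    exact ⟨Filter.tendsto_ofReal_iff.2 hx_tendsto.1, by simpa using hx_tendsto.2⟩
  refine Measure.ext_of_charFun (funext fun t => ?_)
  rw [← complexMGF_mul_I hXm, ← complexMGF_mul_I hYm]
  exact heq (by simpa using h0)

/-- A finite measure is determined by its images under continuous functionals, so the
one-dimensional statement applies for each `L` separately, with `ε` depending on `L`. Finiteness of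
the transform of `ν` follows from the equality. -/
theorem ext_of_laplace_near_zero {E : Type*} [NormedAddCommGroup E] [NormedSpace ℝ E]
    [CompleteSpace E] [MeasurableSpace E] [BorelSpace E] [SecondCountableTopology E]
    {μ ν : Measure E} [IsFiniteMeasure μ] [IsFiniteMeasure ν]
    (h : ∀ L : StrongDual ℝ E, ∃ ε > 0, ∀ t : ℝ, |t| < ε →
      ∫⁻ x, ENNReal.ofReal (Real.exp (t * L x)) ∂μ ≠ ⊤ ∧
      ∫⁻ x, ENNReal.ofReal (Real.exp (t * L x)) ∂μ =
        ∫⁻ x, ENNReal.ofReal (Real.exp (t * L x)) ∂ν) : μ = ν := by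
  refine Measure.ext_of_charFunDual (funext fun L => ?_)
  obtain ⟨ε, hε, hL⟩ := h L
  have hm : ∀ t : ℝ, Continuous fun x => Real.exp (t * L x) := fun t => by fun_prop
  have hint : ∀ (ρ : Measure E) (t : ℝ),
      ∫⁻ x, ENNReal.ofReal (Real.exp (t * L x)) ∂ρ ≠ ⊤ →
      Integrable (fun x => Real.exp (t * L x)) ρ := fun ρ t ht =>
    (lintegral_ofReal_ne_top_iff_integrable (hm t).aestronglyMeasurable
      (Filter.Eventually.of_forall fun x => (Real.exp_pos _).le)).1 ht
  have key := map_eq_of_mgf_eq_near_zero (μ := μ) (μ' := ν) (X := L) (Y := L)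
    L.continuous.aemeasurable L.continuous.aemeasurable hε
    (fun t ht => hint μ t (hL t ht).1) (fun t ht => hint ν t ((hL t ht).2 ▸ (hL t ht).1))
    (fun t ht => by
      rw [mgf, mgf, integral_eq_lintegral_of_nonneg_ae
        (Filter.Eventually.of_forall fun x => (Real.exp_pos _).le) (hm t).aestronglyMeasurable,
        integral_eq_lintegral_of_nonneg_ae
        (Filter.Eventually.of_forall fun x => (Real.exp_pos _).le) (hm t).aestronglyMeasurable,
        (hL t ht).2])
  rw [charFunDual_eq_charFun_map_one, charFunDual_eq_charFun_map_one, key]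

/-! ### Coordinates on the space of symmetric matrices -/

/-- Coordinates of a symmetric `n × n` matrix: its entries on and above the diagonal. -/
abbrev SymCoord (n : ℕ) : Type := {q : Fin n × Fin n // q.1 ≤ q.2} → ℝ

/-- The symmetric matrix with the given coordinates. -/
def symMat (n : ℕ) : SymCoord n →ₗ[ℝ] Matrix (Fin n) (Fin n) ℝ where
  toFun f := of fun i j => f ⟨(min i j, max i j), min_le_max⟩
  map_add' _ _ := rfl
  map_smul' _ _ := rfl

/-- The coordinates of the symmetric part of a matrix. -/
noncomputable def symPart (n : ℕ) : Matrix (Fin n) (Fin n) ℝ →ₗ[ℝ] SymCoord n where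
  toFun M q := (M q.1.1 q.1.2 + M q.1.2 q.1.1) / 2
  map_add' M N := by ext q; simp; ring
  map_smul' c M := by ext q; simp; ring

variable {n p : ℕ}

theorem symMat_apply (f : SymCoord n) (i j : Fin n) :
    symMat n f i j = f ⟨(min i j, max i j), min_le_max⟩ := rfl

theorem symPart_apply (M : Matrix (Fin n) (Fin n) ℝ) (q) :
    symPart n M q = (M q.1.1 q.1.2 + M q.1.2 q.1.1) / 2 := rfl

theorem transpose_symMat (f : SymCoord n) : (symMat n f)ᵀ = symMat n f := by
  ext i j
  simp only [transpose_apply, symMat_apply, min_comm, max_comm]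

theorem symMat_symPart {M : Matrix (Fin n) (Fin n) ℝ} (hM : Mᵀ = M) :
    symMat n (symPart n M) = M := by
  ext i j
  have : M j i = M i j := by conv_rhs => rw [← hM, transpose_apply]
  rw [symMat_apply, symPart_apply]
  rcases le_total i j with h | h <;> simp [h, this]

theorem symPart_symMat (f : SymCoord n) : symPart n (symMat n f) = f := by
  ext ⟨⟨i, j⟩, h⟩
  simp only at h
  rw [symPart_apply, symMat_apply, symMat_apply]
  simp [h]

theorem continuous_symMat : Continuous (symMat n) :=
  continuous_matrix fun _ _ => continuous_apply _

theorem continuous_symPart : Continuous (symPart n) :=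
  (symPart n).continuous_of_finiteDimensional

/-- The congruence `W ↦ A W Aᵀ` on symmetric matrices, in coordinates. -/
noncomputable def symCongr (A : Matrix (Fin n) (Fin n) ℝ) : SymCoord n →ₗ[ℝ] SymCoord n :=
  symPart n ∘ₗ (LinearMap.mulLeft ℝ A ∘ₗ LinearMap.mulRight ℝ Aᵀ) ∘ₗ symMat n

theorem symMat_symCongr (A : Matrix (Fin n) (Fin n) ℝ) (f : SymCoord n) :
    symMat n (symCongr A f) = A * symMat n f * Aᵀ := by
  simp only [symCongr, LinearMap.comp_apply, LinearMap.mulLeft_apply, LinearMap.mulRight_apply]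
  rw [symMat_symPart, Matrix.mul_assoc]
  simp [transpose_symMat, Matrix.mul_assoc]

theorem symMat_injective : Function.Injective (symMat n) :=
  Function.LeftInverse.injective symPart_symMat

theorem symCongr_mul (A B : Matrix (Fin n) (Fin n) ℝ) :
    symCongr (A * B) = symCongr A ∘ₗ symCongr B := by
  ext1 f
  apply LinearMap.ext
  intro x
  apply symMat_injective
  simp only [LinearMap.comp_apply, symMat_symCongr, transpose_mul, Matrix.mul_assoc]

theorem symCongr_one : symCongr (1 : Matrix (Fin n) (Fin n) ℝ) = LinearMap.id := by
  apply LinearMap.ext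
  intro x
  apply symMat_injective
  simp [symMat_symCongr]

/-- Each index lies in one pair with each of the `n - 1` others and twice in its diagonal pair, so
it occurs `n + 1` times. -/
theorem prod_le_pairs (d : Fin n → ℝ) :
    ∏ q : {q : Fin n × Fin n // q.1 ≤ q.2}, d q.1.1 * d q.1.2 = (∏ i, d i) ^ (n + 1) := by
  have h1 : ∏ q : {q : Fin n × Fin n // q.1 ≤ q.2}, d q.1.1 * d q.1.2 =
      ∏ q : Fin n × Fin n, if q.1 ≤ q.2 then d q.1 * d q.2 else 1 := by
    rw [← Finset.prod_filter]
    exact (Finset.prod_subtype _ (by simp) fun q : Fin n × Fin n => d q.1 * d q.2).symm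
  have h2 : ∏ q : Fin n × Fin n, (if q.1 ≤ q.2 then d q.2 else 1) =
      ∏ q : Fin n × Fin n, (if q.2 ≤ q.1 then d q.1 else 1) :=
    Fintype.prod_equiv (Equiv.prodComm _ _) _ _ fun q => rfl
  have h3 : ∀ q : Fin n × Fin n, (if q.1 ≤ q.2 then d q.1 * d q.2 else 1) =
      (if q.1 ≤ q.2 then d q.1 else 1) * (if q.1 ≤ q.2 then d q.2 else 1) := by
    intro q; split_ifs <;> simp
  have h4 : ∀ q : Fin n × Fin n, (if q.1 ≤ q.2 then d q.1 else 1) *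
      (if q.2 ≤ q.1 then d q.1 else 1) = d q.1 * if q.1 = q.2 then d q.1 else 1 := by
    intro q
    rcases lt_trichotomy q.1 q.2 with h | h | h
    · simp [h.le, h.not_ge, h.ne]
    · simp [h]
    · simp [h.le, h.not_ge, h.ne']
  rw [h1, Finset.prod_congr rfl fun q _ => h3 q, Finset.prod_mul_distrib, h2,
    ← Finset.prod_mul_distrib, Finset.prod_congr rfl fun q _ => h4 q, Finset.prod_mul_distrib,
    Fintype.prod_prod_type, Fintype.prod_prod_type]
  simp [Finset.prod_pow, pow_succ]

/-- The congruence is diagonal in these coordinates: it multiplies the entry `(i, j)` by `dᵢ dⱼ`. -/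
theorem det_symCongr_diagonal (d : Fin n → ℝ) :
    LinearMap.det (symCongr (diagonal d)) = (∏ i, d i) ^ (n + 1) := by
  rw [← prod_le_pairs]
  have : symCongr (diagonal d) = LinearMap.pi fun q =>
      (LinearMap.lsmul ℝ ℝ (d q.1.1 * d q.1.2)).comp (LinearMap.proj q) := by
    apply LinearMap.ext
    intro x
    apply symMat_injective
    rw [symMat_symCongr]
    ext i j
    rw [diagonal_transpose, mul_diagonal, diagonal_mul, symMat_apply, symMat_apply]
    rcases le_total i j with h | h <;> simp [h] <;> ring
  rw [this, LinearMap.det_pi]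
  simp [LinearMap.det_ring]

/-- The congruences by `V` and `Vᵀ` are mutually inverse, so their determinants cancel and only the
diagonal factor counts. -/
theorem det_symCongr {V : Matrix (Fin n) (Fin n) ℝ} (hV : Vᵀ * V = 1) (d : Fin n → ℝ) :
    LinearMap.det (symCongr (V * diagonal d * Vᵀ)) = (∏ i, d i) ^ (n + 1) := by
  have h1 : LinearMap.det (symCongr V) * LinearMap.det (symCongr Vᵀ) = 1 := by
    rw [← LinearMap.det_comp, ← symCongr_mul, mul_eq_one_comm.1 hV, symCongr_one, LinearMap.det_id]
  rw [symCongr_mul, symCongr_mul, LinearMap.det_comp, LinearMap.det_comp, mul_right_comm, h1,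
    one_mul, det_symCongr_diagonal]

/-! ### Data matrices -/

/-- The `p × n` matrix with columns `X₁, …, Xₙ`. -/
def dataMat (X : Fin n → EuclideanSpace ℝ (Fin p)) : Matrix (Fin p) (Fin n) ℝ :=
  of fun k i => X i k

theorem gramSum_eq (X : Fin n → EuclideanSpace ℝ (Fin p)) :
    gramSum X = dataMat X * (dataMat X)ᵀ := by
  ext i j
  simp [gramSum, dataMat, mul_apply, Matrix.sum_apply, vecMulVec_apply]

/-- The matrix `XᵗX` of inner products of the columns. -/
def innerMat (X : Fin n → EuclideanSpace ℝ (Fin p)) : Matrix (Fin n) (Fin n) ℝ :=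
  (dataMat X)ᵀ * dataMat X

theorem transpose_innerMat (X : Fin n → EuclideanSpace ℝ (Fin p)) :
    (innerMat X)ᵀ = innerMat X := by
  simp [innerMat]

/-- Right multiplication of the data matrix by `A`. -/
noncomputable def colMul (A : Matrix (Fin n) (Fin n) ℝ) :
    (Fin n → EuclideanSpace ℝ (Fin p)) →ₗ[ℝ] (Fin n → EuclideanSpace ℝ (Fin p)) :=
  LinearMap.pi fun j => ∑ i, A i j • LinearMap.proj i

theorem dataMat_colMul (A : Matrix (Fin n) (Fin n) ℝ) (X : Fin n → EuclideanSpace ℝ (Fin p)) :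
    dataMat (colMul A X) = dataMat X * A := by
  ext k j
  simp [dataMat, colMul, mul_apply, mul_comm]

theorem dataMat_injective :
    Function.Injective (dataMat : (Fin n → EuclideanSpace ℝ (Fin p)) → _) := by
  intro X Y h
  ext i k
  exact congrFun (congrFun h k) i

theorem innerMat_colMul (A : Matrix (Fin n) (Fin n) ℝ) (X : Fin n → EuclideanSpace ℝ (Fin p)) :
    innerMat (colMul A X) = Aᵀ * innerMat X * A := by
  simp only [innerMat, dataMat_colMul, transpose_mul, Matrix.mul_assoc]

theorem colMul_mul (A B : Matrix (Fin n) (Fin n) ℝ) :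
    colMul (p := p) (A * B) = colMul B ∘ₗ colMul A := by
  apply LinearMap.ext
  intro X
  apply dataMat_injective
  simp only [LinearMap.comp_apply, dataMat_colMul, Matrix.mul_assoc]

theorem colMul_one : colMul (p := p) (1 : Matrix (Fin n) (Fin n) ℝ) = LinearMap.id := by
  apply LinearMap.ext
  intro X
  apply dataMat_injective
  simp [dataMat_colMul]

theorem det_colMul_diagonal (d : Fin n → ℝ) :
    LinearMap.det (colMul (p := p) (diagonal d)) = (∏ i, d i) ^ p := by
  have : colMul (p := p) (diagonal d) = LinearMap.pi fun i =>
      (d i • LinearMap.id (R := ℝ) (M := EuclideanSpace ℝ (Fin p))).comp (LinearMap.proj i) := by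
    apply LinearMap.ext
    intro X
    apply dataMat_injective
    rw [dataMat_colMul]
    ext k j
    simp [mul_diagonal, dataMat, mul_comm]
  rw [this, LinearMap.det_pi]
  simp [LinearMap.det_smul, Finset.prod_pow]

theorem det_colMul {V : Matrix (Fin n) (Fin n) ℝ} (hV : Vᵀ * V = 1) (d : Fin n → ℝ) :
    LinearMap.det (colMul (p := p) (V * diagonal d * Vᵀ)) = (∏ i, d i) ^ p := by
  have h1 : LinearMap.det (colMul (p := p) Vᵀ) * LinearMap.det (colMul (p := p) V) = 1 := by
    rw [← LinearMap.det_comp, ← colMul_mul, mul_eq_one_comm.1 hV, colMul_one, LinearMap.det_id]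
  rw [colMul_mul, colMul_mul, LinearMap.det_comp, LinearMap.det_comp, mul_left_comm, h1,
    mul_one, det_colMul_diagonal]

/-- The root is kept in the form `V * diagonal d * Vᵀ` because `det_colMul` and `det_symCongr` give
Jacobians for matrices of that form. -/
theorem exists_posDef_sqrt {Z : Matrix (Fin n) (Fin n) ℝ} (hZ : Z.PosDef) :
    ∃ (V : Matrix (Fin n) (Fin n) ℝ) (d : Fin n → ℝ), Vᵀ * V = 1 ∧ (∀ i, 0 < d i) ∧
      (V * diagonal d * Vᵀ) * (V * diagonal d * Vᵀ) = Z ∧ (V * diagonal d * Vᵀ)ᵀ =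
        V * diagonal d * Vᵀ ∧ Z.det = (∏ i, d i) ^ 2 := by
  obtain ⟨V, ℓ, hV, hV', -, hW⟩ := exists_antitone_spectral hZ.isHermitian
  have hpos : ∀ i, 0 < ℓ i := by rw [hW] at hZ; exact (posDef_of_spectral hV').1 hZ
  refine ⟨V, fun i => √(ℓ i), hV, fun i => Real.sqrt_pos.2 (hpos i), ?_, ?_, ?_⟩
  · calc _ = V * (diagonal (fun i => √(ℓ i)) * (Vᵀ * V) * diagonal (fun i => √(ℓ i))) * Vᵀ := by
          simp only [Matrix.mul_assoc]
      _ = Z := by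
          rw [hV, Matrix.mul_one, diagonal_mul_diagonal, hW]
          simp only [Real.mul_self_sqrt (hpos _).le]
  · simp [transpose_mul, Matrix.mul_assoc]
  · rw [hW, det_spectral hV, ← Finset.prod_pow]
    simp only [Real.sq_sqrt (hpos _).le]

theorem lintegral_comp_linearMap {E : Type*} [NormedAddCommGroup E] [NormedSpace ℝ E]
    [MeasurableSpace E] [BorelSpace E] [FiniteDimensional ℝ E] (μ : Measure E)
    [μ.IsAddHaarMeasure] {f : E →ₗ[ℝ] E} (hf : LinearMap.det f ≠ 0) {F : E → ENNReal}
    (hF : Measurable F) :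
    ∫⁻ x, F (f x) ∂μ = ENNReal.ofReal |(LinearMap.det f)⁻¹| * ∫⁻ x, F x ∂μ := by
  rw [← lintegral_map hF f.continuous_of_finiteDimensional.measurable,
    Measure.map_linearMap_addHaar_eq_smul_addHaar _ hf, lintegral_smul_measure, smul_eq_mul]

theorem continuous_dataMat :
    Continuous (dataMat : (Fin n → EuclideanSpace ℝ (Fin p)) → Matrix (Fin p) (Fin n) ℝ) :=
  continuous_matrix fun k i => by simp only [dataMat, of_apply]; fun_prop

theorem continuous_innerMat :
    Continuous (innerMat : (Fin n → EuclideanSpace ℝ (Fin p)) → Matrix (Fin n) (Fin n) ℝ) :=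
  continuous_dataMat.matrix_transpose.matrix_mul continuous_dataMat

/-- The Laplace transform of the matrix of inner products under Lebesgue measure. -/
theorem laplace_innerMat {Z : Matrix (Fin n) (Fin n) ℝ} (hZ : Z.PosDef) :
    ∫⁻ X : Fin n → EuclideanSpace ℝ (Fin p),
        ENNReal.ofReal (Real.exp (-(Z * innerMat X).trace / 2)) =
      ENNReal.ofReal (Z.det ^ (-(p : ℝ) / 2)) * ∫⁻ X : Fin n → EuclideanSpace ℝ (Fin p),
        ENNReal.ofReal (Real.exp (-(innerMat X).trace / 2)) := by
  obtain ⟨V, d, hV, hd, hsq, htr, hdet⟩ := exists_posDef_sqrt hZ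
  have hprod : 0 < ∏ i, d i := Finset.prod_pos fun i _ => hd i
  have hdetA := det_colMul (p := p) hV d
  -- Substitute `X ↦ X A` with `A² = Z`: the trace of `XᵗX` becomes that of `Z XᵗX`, and the
  -- Jacobian is `(det A) ^ p = (det Z) ^ (p/2)`.
  have key := lintegral_comp_linearMap (volume : Measure (Fin n → EuclideanSpace ℝ (Fin p)))
    (f := colMul (V * diagonal d * Vᵀ)) (by rw [hdetA]; positivity)
    (F := fun X => ENNReal.ofReal (Real.exp (-(innerMat X).trace / 2)))
    (ENNReal.measurable_ofReal.comp (Real.continuous_exp.comp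
      (continuous_innerMat.matrix_trace.neg.div_const 2)).measurable)
  rw [hdetA] at key
  convert key using 3 with X
  · rw [innerMat_colMul, htr, ← hsq, Matrix.mul_assoc (V * diagonal d * Vᵀ), trace_mul_comm]
  · rw [abs_of_pos (by positivity), hdet, ← Real.rpow_natCast, ← Real.rpow_natCast,
      ← Real.rpow_mul hprod.le, ← Real.rpow_neg hprod.le]
    congr 1; push_cast; ring

/-! ### The Wishart density -/

/-- Positive definiteness is a closed condition, semidefiniteness, together with the open one `det ≠
0`. -/
theorem measurableSet_posDef_symMat : MeasurableSet {W : SymCoord n | (symMat n W).PosDef} := by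
  have h : {W : SymCoord n | (symMat n W).PosDef} =
      (⋂ x : Fin n → ℝ, {W | 0 ≤ x ⬝ᵥ (symMat n W *ᵥ x)}) ∩ {W | (symMat n W).det ≠ 0} := by
    ext W
    have hW : (symMat n W).IsHermitian := by
      rw [IsHermitian, conjTranspose_eq_transpose_of_trivial, transpose_symMat]
    simp only [Set.mem_inter_iff, Set.mem_iInter, Set.mem_ofPred_eq]
    constructor
    · intro h
      exact ⟨fun x => by simpa using h.posSemidef.dotProduct_mulVec_nonneg x, h.det_pos.ne'⟩
    · rintro ⟨h1, h2⟩
      have : (symMat n W).PosSemidef :=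
        PosSemidef.of_dotProduct_mulVec_nonneg hW fun x => by simpa using h1 x
      exact this.posDef_iff_isUnit.2 ((isUnit_iff_isUnit_det _).2 h2.isUnit)
  rw [h]
  refine MeasurableSet.inter (IsClosed.measurableSet (isClosed_iInter fun x => ?_)) ?_
  · exact isClosed_le continuous_const
      (continuous_const.dotProduct (continuous_symMat.matrix_mulVec continuous_const))
  · exact (isOpen_ne_fun continuous_symMat.matrix_det continuous_const).measurableSet

/-- The function `(det W) ^ a` on the cone of positive definite matrices, extended by `0`. -/
noncomputable def wishartDensity (n : ℕ) (a : ℝ) : SymCoord n → ENNReal :=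
  {W : SymCoord n | (symMat n W).PosDef}.indicator
    fun W => ENNReal.ofReal ((symMat n W).det ^ a)

theorem measurable_wishartDensity (a : ℝ) : Measurable (wishartDensity n a) :=
  ((continuous_symMat.matrix_det.measurable.pow_const a).ennreal_ofReal).indicator
    measurableSet_posDef_symMat

theorem wishartDensity_of_posDef (a : ℝ) {W : SymCoord n} (h : (symMat n W).PosDef) :
    wishartDensity n a W = ENNReal.ofReal ((symMat n W).det ^ a) :=
  Set.indicator_of_mem (s := {W : SymCoord n | (symMat n W).PosDef}) h _

theorem wishartDensity_of_not_posDef (a : ℝ) {W : SymCoord n} (h : ¬(symMat n W).PosDef) :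
    wishartDensity n a W = 0 :=
  Set.indicator_of_notMem (s := {W : SymCoord n | (symMat n W).PosDef}) h _

theorem measurable_exp_trace_symMat (Z : Matrix (Fin n) (Fin n) ℝ) :
    Measurable fun W : SymCoord n =>
      ENNReal.ofReal (Real.exp (-(Z * symMat n W).trace / 2)) :=
  ENNReal.measurable_ofReal.comp (Real.continuous_exp.comp
    ((continuous_const.matrix_mul continuous_symMat).matrix_trace.neg.div_const 2)).measurable

theorem measurable_wishartDensity_mul_exp (a : ℝ) (Z : Matrix (Fin n) (Fin n) ℝ) :
    Measurable fun W : SymCoord n => wishartDensity n a W *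
      ENNReal.ofReal (Real.exp (-(Z * symMat n W).trace / 2)) :=
  (measurable_wishartDensity a).mul (measurable_exp_trace_symMat Z)

/-- The Laplace transform of the Wishart density. -/
theorem laplace_wishartDensity (a : ℝ) {Z : Matrix (Fin n) (Fin n) ℝ} (hZ : Z.PosDef) :
    ∫⁻ W : SymCoord n, wishartDensity n a W *
        ENNReal.ofReal (Real.exp (-(Z * symMat n W).trace / 2)) =
      ENNReal.ofReal (Z.det ^ (-(a + ((n : ℝ) + 1) / 2))) *
        ∫⁻ W : SymCoord n, wishartDensity n a W *
          ENNReal.ofReal (Real.exp (-(1 * symMat n W).trace / 2)) := by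
  obtain ⟨V, d, hV, hd, hsq, htr, hdet⟩ := exists_posDef_sqrt hZ
  have hprod : 0 < ∏ i, d i := Finset.prod_pos fun i _ => hd i
  have hdetA := det_symCongr hV d
  have hAu : IsUnit (V * diagonal d * Vᵀ) := by
    rw [isUnit_iff_isUnit_det, det_spectral hV]; exact hprod.ne'.isUnit
  have hAdet : (V * diagonal d * Vᵀ).det = ∏ i, d i := det_spectral hV
  generalize V * diagonal d * Vᵀ = A at *
  -- Substitute `W ↦ A W Aᵗ` with `A² = Z`. This maps the cone onto itself, multiplies `(det W) ^ a`
  -- by `(det Z) ^ a`, and has Jacobian `(det A) ^ (n+1) = (det Z) ^ ((n+1)/2)`.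
  have key := lintegral_comp_linearMap (volume : Measure (SymCoord n))
    (f := symCongr A) (by rw [hdetA]; positivity)
    (measurable_wishartDensity_mul_exp a 1)
  have hpt : ∀ W : SymCoord n, wishartDensity n a (symCongr A W) *
      ENNReal.ofReal (Real.exp (-(1 * symMat n (symCongr A W)).trace / 2)) =
      ENNReal.ofReal (Z.det ^ a) * (wishartDensity n a W *
        ENNReal.ofReal (Real.exp (-(Z * symMat n W).trace / 2))) := by
    intro W
    have hpd : (symMat n (symCongr A W)).PosDef ↔ (symMat n W).PosDef := by
      rw [symMat_symCongr]
      have := hAu.posDef_star_right_conjugate_iff (x := symMat n W)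
      rwa [star_eq_conjTranspose, conjTranspose_eq_transpose_of_trivial] at this
    have htrace : (1 * symMat n (symCongr A W)).trace = (Z * symMat n W).trace := by
      rw [Matrix.one_mul, symMat_symCongr, htr, ← hsq, Matrix.mul_assoc A A, trace_mul_comm A]
    rw [htrace, ← mul_assoc]
    congr 1
    by_cases h : (symMat n W).PosDef
    · rw [wishartDensity_of_posDef a (hpd.2 h), wishartDensity_of_posDef a h, ← ENNReal.ofReal_mul (Real.rpow_nonneg hZ.det_pos.le _),
        ← Real.mul_rpow hZ.det_pos.le h.det_pos.le, symMat_symCongr, ← hsq]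
      simp only [det_mul, det_transpose]
      congr 2; ring
    · rw [wishartDensity_of_not_posDef a fun h' => h (hpd.1 h'),
        wishartDensity_of_not_posDef a h, mul_zero]
  simp only [hpt] at key
  rw [lintegral_const_mul _ (measurable_wishartDensity_mul_exp a Z),
    hdetA] at key
  have hZa : 0 < Z.det ^ a := Real.rpow_pos_of_pos hZ.det_pos _
  have hne : ENNReal.ofReal (Z.det ^ a) ≠ 0 := by simpa using hZa
  rw [← ENNReal.mul_right_inj hne ENNReal.ofReal_ne_top, key, ← mul_assoc,
    ← ENNReal.ofReal_mul hZa.le, ← Real.rpow_add hZ.det_pos]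
  congr 2
  rw [abs_of_pos (by positivity), hdet, ← Real.rpow_natCast, ← Real.rpow_natCast,
    ← Real.rpow_mul hprod.le, ← Real.rpow_neg hprod.le]
  congr 1; push_cast; ring

theorem exists_posDef_add_smul {B : Matrix (Fin n) (Fin n) ℝ} (hB : Bᵀ = B) :
    ∃ K > 0, ∀ α t : ℝ, K * |t| < α → (α • 1 + t • B).PosDef := by
  obtain ⟨V, ℓ, hV, hV', -, hW⟩ := exists_antitone_spectral (W := B)
    (by rw [IsHermitian, conjTranspose_eq_transpose_of_trivial, hB])
  -- The summand `1` keeps `K` positive when `B = 0`, so that it may later serve as a divisor.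
  refine ⟨1 + ∑ i, |ℓ i|, by positivity, fun α t h => ?_⟩
  have : α • 1 + t • B = V * diagonal (fun i => t * ℓ i + α) * Vᵀ := by
    rw [← spectral_add_smul_one hV' α, hW, add_comm]
    congr 1
    have : diagonal (fun i => t * ℓ i) = t • diagonal ℓ := by
      ext i j; by_cases hij : i = j <;> simp [hij]
    rw [this, Matrix.mul_smul, Matrix.smul_mul]
  rw [this, posDef_of_spectral hV']
  intro i
  have h1 : |ℓ i| ≤ ∑ i, |ℓ i| := Finset.single_le_sum (f := fun i => |ℓ i|)
    (fun i _ => abs_nonneg _) (Finset.mem_univ i)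
  have h2 : |t * ℓ i| ≤ (1 + ∑ i, |ℓ i|) * |t| := by
    rw [abs_mul, mul_comm]
    exact mul_le_mul_of_nonneg_right (by linarith) (abs_nonneg t)
  linarith [neg_abs_le (t * ℓ i)]

/-- The integrand is positive on the cone, so a zero integral would make the cone null. But
countably many translates of the cone by multiples of the identity cover the whole space. -/
theorem lintegral_wishartDensity_ne_zero (a : ℝ) :
    ∫⁻ W : SymCoord n, wishartDensity n a W *
      ENNReal.ofReal (Real.exp (-(1 * symMat n W).trace / 2)) ≠ 0 := by
  intro h0
  rw [lintegral_eq_zero_iff (measurable_wishartDensity_mul_exp a 1)]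
    at h0
  have hnull : volume {W : SymCoord n | (symMat n W).PosDef} = 0 := by
    refine measure_mono_null (fun W hW => ?_) h0
    have hW' : (symMat n W).PosDef := hW
    change ¬ (wishartDensity n a W * _ = 0)
    rw [wishartDensity_of_posDef a hW]
    have := Real.rpow_pos_of_pos hW'.det_pos a
    rw [mul_eq_zero, not_or]
    exact ⟨by simpa using this, by simpa using Real.exp_pos _⟩
  have hcover : (Set.univ : Set (SymCoord n)) ⊆
      ⋃ k : ℕ, (fun W => W + symPart n ((k : ℝ) • 1)) ⁻¹' {W | (symMat n W).PosDef} := by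
    intro W _
    obtain ⟨K, -, hK⟩ := exists_posDef_add_smul (transpose_symMat W)
    obtain ⟨k, hk⟩ := exists_nat_gt K
    refine Set.mem_iUnion.2 ⟨k, ?_⟩
    have := hK k 1 (by simpa using hk)
    rw [one_smul] at this
    simp only [Set.mem_preimage, Set.mem_ofPred_eq, map_add]
    rw [symMat_symPart (by simp), add_comm]
    exact this
  have h1 : volume (Set.univ : Set (SymCoord n)) = 0 := by
    refine measure_mono_null hcover (measure_iUnion_null fun k => ?_)
    rw [measure_preimage_add_right, hnull]
  exact (NeZero.ne (volume : Measure (SymCoord n))) (Measure.measure_univ_eq_zero.1 h1)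

/-- The entries of the orthogonal eigenvector matrix are at most one in absolute value. The trace
thus bounds the sup norm of the coordinates. -/
theorem abs_apply_le_trace {W : Matrix (Fin n) (Fin n) ℝ} (hW : W.PosDef) (i j : Fin n) :
    |W i j| ≤ W.trace := by
  obtain ⟨V, ℓ, hV, hV', -, rfl⟩ := exists_antitone_spectral hW.isHermitian
  have hpos := (posDef_of_spectral hV').1 hW
  have hent : ∀ i k, |V i k| ≤ 1 := by
    intro i k
    have := congrFun (congrFun hV' i) i
    simp only [mul_apply, transpose_apply, one_apply_eq] at this
    have h2 : V i k * V i k ≤ ∑ k, V i k * V i k :=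
      Finset.single_le_sum (f := fun k => V i k * V i k) (fun k _ => mul_self_nonneg _)
        (Finset.mem_univ k)
    exact abs_le_one_iff_mul_self_le_one.2 (by linarith)
  rw [trace_spectral hV, mul_apply]
  refine (Finset.abs_sum_le_sum_abs _ _).trans (Finset.sum_le_sum fun k _ => ?_)
  rw [mul_diagonal, transpose_apply, abs_mul, abs_mul, abs_of_pos (hpos k)]
  have h1 := hent i k
  have h2 := hent j k
  have h3 := hpos k
  have h4 : |V i k| * |V j k| ≤ 1 := mul_le_one₀ h1 (abs_nonneg _) h2
  nlinarith

theorem det_le_trace_pow {W : Matrix (Fin n) (Fin n) ℝ} (hW : W.PosDef) :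
    W.det ≤ W.trace ^ n := by
  obtain ⟨V, ℓ, hV, hV', -, rfl⟩ := exists_antitone_spectral hW.isHermitian
  have hpos := (posDef_of_spectral hV').1 hW
  rw [trace_spectral hV, det_spectral hV]
  calc ∏ i, ℓ i ≤ ∏ _i : Fin n, ∑ j, ℓ j :=
        Finset.prod_le_prod (fun i _ => (hpos i).le) fun i _ =>
          Finset.single_le_sum (fun j _ => (hpos j).le) (Finset.mem_univ i)
    _ = _ := by simp

theorem lintegral_wishartDensity_ne_top {a : ℝ} (ha : 0 ≤ a) :
    ∫⁻ W : SymCoord n, wishartDensity n a W *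
      ENNReal.ofReal (Real.exp (-(1 * symMat n W).trace / 2)) ≠ ⊤ := by
  -- An exponent above the dimension makes `(1 + ‖W‖) ^ (-r)` integrable. The exponential absorbs
  -- the power `M`, which covers both the growth of `det ^ a` and this factor.
  set r : ℝ := Module.finrank ℝ (SymCoord n) + 1 with hr
  obtain ⟨M, hM⟩ := exists_nat_ge (n * a + r)
  set K : ℝ := M.factorial * 2 ^ M * Real.exp (1 / 2) with hK
  have hint : Integrable (fun W : SymCoord n => K * (1 + ‖W‖) ^ (-r)) :=
    (integrable_one_add_norm (by rw [hr]; linarith)).const_mul K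
  refine ne_top_of_le_ne_top hint.lintegral_lt_top.ne (lintegral_mono fun W => ?_)
  by_cases h : (symMat n W).PosDef
  swap
  · rw [wishartDensity_of_not_posDef a h, zero_mul]
    exact zero_le
  rw [wishartDensity_of_posDef a h, Matrix.one_mul,
    ← ENNReal.ofReal_mul (Real.rpow_nonneg h.det_pos.le _)]
  refine ENNReal.ofReal_le_ofReal ?_
  set τ := (symMat n W).trace with hτ
  have hτ0 : 0 ≤ τ := h.posSemidef.trace_nonneg
  have hnorm : ‖W‖ ≤ τ := by
    rw [pi_norm_le_iff_of_nonneg hτ0]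
    rintro ⟨⟨i, j⟩, hij⟩
    simp only at hij
    have := abs_apply_le_trace h i j
    rw [symMat_apply] at this
    simpa [hij] using this
  have h1 : (symMat n W).det ^ a ≤ (1 + τ) ^ (n * a) := by
    calc (symMat n W).det ^ a ≤ (τ ^ n) ^ a :=
          Real.rpow_le_rpow h.det_pos.le (det_le_trace_pow h) ha
      _ = τ ^ (n * a) := by rw [← Real.rpow_natCast, ← Real.rpow_mul hτ0]
      _ ≤ _ := Real.rpow_le_rpow hτ0 (by linarith) (by positivity)
  have h2 : (1 + τ) ^ (n * a) ≤ (1 + τ) ^ M * (1 + τ) ^ (-r) := by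
    rw [← Real.rpow_natCast, ← Real.rpow_add (by linarith)]
    exact Real.rpow_le_rpow_of_exponent_le (by linarith) (by linarith)
  have h3 : (1 + τ) ^ M * Real.exp (-τ / 2) ≤ K := by
    have := Real.pow_div_factorial_le_exp ((1 + τ) / 2) (by positivity) M
    rw [div_le_iff₀ (by positivity), div_pow, div_le_iff₀ (by positivity)] at this
    calc (1 + τ) ^ M * Real.exp (-τ / 2)
        ≤ (Real.exp ((1 + τ) / 2) * M.factorial * 2 ^ M) * Real.exp (-τ / 2) :=
          mul_le_mul_of_nonneg_right this (Real.exp_pos _).le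
      _ = M.factorial * 2 ^ M * (Real.exp ((1 + τ) / 2) * Real.exp (-τ / 2)) := by ring
      _ = K := by rw [← Real.exp_add, hK]; congr 2; ring
  have h4 : (1 + τ) ^ (-r) ≤ (1 + ‖W‖) ^ (-r) :=
    Real.rpow_le_rpow_of_nonpos (by positivity) (by linarith) (by rw [hr]; linarith)
  calc (symMat n W).det ^ a * Real.exp (-τ / 2)
      ≤ ((1 + τ) ^ M * (1 + τ) ^ (-r)) * Real.exp (-τ / 2) :=
        mul_le_mul_of_nonneg_right (h1.trans h2) (Real.exp_pos _).le
    _ = ((1 + τ) ^ M * Real.exp (-τ / 2)) * (1 + τ) ^ (-r) := by ring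
    _ ≤ K * (1 + ‖W‖) ^ (-r) :=
        mul_le_mul h3 h4 (Real.rpow_nonneg (by linarith) _) (by positivity)

theorem trace_innerMat (X : Fin n → EuclideanSpace ℝ (Fin p)) :
    (innerMat X).trace = ∑ i, ‖X i‖ ^ 2 := by
  simp only [EuclideanSpace.real_norm_sq_eq]
  simp [innerMat, trace, mul_apply, dataMat, sq]

theorem measurable_exp_trace_innerMat (Z : Matrix (Fin n) (Fin n) ℝ) :
    Measurable fun X : Fin n → EuclideanSpace ℝ (Fin p) =>
      ENNReal.ofReal (Real.exp (-(Z * innerMat X).trace / 2)) :=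
  ENNReal.measurable_ofReal.comp (Real.continuous_exp.comp
    ((continuous_const.matrix_mul continuous_innerMat).matrix_trace.neg.div_const 2)).measurable

theorem integrable_exp_trace_innerMat :
    Integrable fun X : Fin n → EuclideanSpace ℝ (Fin p) =>
      Real.exp (-(innerMat X).trace / 2) := by
  have h1 : Integrable fun x : EuclideanSpace ℝ (Fin p) => Real.exp (-‖x‖ ^ 2 / 2) := by
    have := (GaussianFourier.integrable_cexp_neg_mul_sq_norm_add (V := EuclideanSpace ℝ (Fin p))
      (b := 1 / 2) (by norm_num) 0 0).norm
    refine this.congr (Filter.Eventually.of_forall fun x => ?_)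
    simp only [Complex.norm_exp]
    congr 1
    have : (-(1 / 2) * (‖x‖ : ℂ) ^ 2 + 0 * ((inner ℝ (0 : EuclideanSpace ℝ (Fin p)) x : ℝ) : ℂ)) =
        ((-‖x‖ ^ 2 / 2 : ℝ) : ℂ) := by push_cast; ring
    rw [this, Complex.ofReal_re]
  have h2 := Integrable.fintype_prod (μ := fun _ : Fin n => (volume :
    Measure (EuclideanSpace ℝ (Fin p)))) (f := fun _ x => Real.exp (-‖x‖ ^ 2 / 2)) fun _ => h1
  refine h2.congr (Filter.Eventually.of_forall fun X => ?_)
  simp only [trace_innerMat]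
  rw [← Real.exp_sum, neg_div, Finset.sum_div, ← Finset.sum_neg_distrib]
  simp only [neg_div]

/-- Under Lebesgue measure on the data, the matrix of inner products has a density proportional to
`det ^ ((p - n - 1) / 2)` on the cone of positive definite matrices. -/
theorem exists_lintegral_innerMat (hnp : n < p) :
    ∃ k : ENNReal, ∀ h : SymCoord n → ENNReal, Measurable h →
      ∫⁻ X : Fin n → EuclideanSpace ℝ (Fin p), h (symPart n (innerMat X)) =
        k * ∫⁻ W : SymCoord n, wishartDensity n (((p : ℝ) - n - 1) / 2) W * h W := by
  set a : ℝ := ((p : ℝ) - n - 1) / 2 with ha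
  have ha0 : 0 ≤ a := by
    have : (n : ℝ) + 1 ≤ p := by exact_mod_cast hnp
    rw [ha]; linarith
  set cX := ∫⁻ X : Fin n → EuclideanSpace ℝ (Fin p),
    ENNReal.ofReal (Real.exp (-(innerMat X).trace / 2)) with hcX
  set cW := ∫⁻ W : SymCoord n, wishartDensity n a W *
    ENNReal.ofReal (Real.exp (-(1 * symMat n W).trace / 2)) with hcW
  have hcXt : cX ≠ ⊤ := integrable_exp_trace_innerMat.lintegral_lt_top.ne
  have hcWt : cW ≠ ⊤ := lintegral_wishartDensity_ne_top ha0
  have hcW0 : cW ≠ 0 := lintegral_wishartDensity_ne_zero a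
  have hmX : Measurable fun X : Fin n → EuclideanSpace ℝ (Fin p) => symPart n (innerMat X) :=
    (continuous_symPart.comp continuous_innerMat).measurable
  have hmeX : Measurable fun X : Fin n → EuclideanSpace ℝ (Fin p) =>
      ENNReal.ofReal (Real.exp (-(innerMat X).trace / 2)) := by
    simpa using measurable_exp_trace_innerMat (n := n) (p := p) 1
  have hmeW := measurable_wishartDensity_mul_exp (n := n) a 1
  -- Both laws are tilted by `exp(-tr/2)` to make them finite, and each is multiplied by the total
  -- mass of the other, so no normalising constant has to be computed.
  set μ : Measure (SymCoord n) := cW • Measure.map (fun X => symPart n (innerMat X))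
    ((volume : Measure (Fin n → EuclideanSpace ℝ (Fin p))).withDensity
      fun X => ENNReal.ofReal (Real.exp (-(innerMat X).trace / 2))) with hμ
  set ν : Measure (SymCoord n) := cX • volume.withDensity fun W =>
    wishartDensity n a W * ENNReal.ofReal (Real.exp (-(1 * symMat n W).trace / 2)) with hν
  have hμint : ∀ h : SymCoord n → ENNReal, Measurable h → ∫⁻ W, h W ∂μ =
      cW * ∫⁻ X : Fin n → EuclideanSpace ℝ (Fin p),
        ENNReal.ofReal (Real.exp (-(innerMat X).trace / 2)) * h (symPart n (innerMat X)) := by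
    intro h hh
    rw [hμ, lintegral_smul_measure, lintegral_map hh hmX,
      lintegral_withDensity_eq_lintegral_mul _ hmeX
      (g := fun X => h (symPart n (innerMat X))) (hh.comp hmX), smul_eq_mul]
    rfl
  have hνint : ∀ h : SymCoord n → ENNReal, Measurable h → ∫⁻ W, h W ∂ν =
      cX * ∫⁻ W : SymCoord n, wishartDensity n a W *
        ENNReal.ofReal (Real.exp (-(1 * symMat n W).trace / 2)) * h W := by
    intro h hh
    rw [hν, lintegral_smul_measure, lintegral_withDensity_eq_lintegral_mul _ hmeW hh, smul_eq_mul]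
    rfl
  have hμfin : IsFiniteMeasure μ := ⟨by
    have := hμint 1 measurable_one
    simp only [Pi.one_apply, mul_one, lintegral_one, ← hcX] at this
    rw [this]; exact ENNReal.mul_lt_top hcWt.lt_top hcXt.lt_top⟩
  have hνfin : IsFiniteMeasure ν := ⟨by
    have := hνint 1 measurable_one
    simp only [Pi.one_apply, mul_one, lintegral_one, ← hcW] at this
    rw [this]; exact ENNReal.mul_lt_top hcXt.lt_top hcWt.lt_top⟩
  have hsymm : ∀ X : Fin n → EuclideanSpace ℝ (Fin p),
      symMat n (symPart n (innerMat X)) = innerMat X := fun X =>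
    symMat_symPart (transpose_innerMat X)
  have hμν : μ = ν := by
    refine ext_of_laplace_near_zero fun L => ?_
    -- The symmetric matrix that represents `L` through the trace form.
    set B : Matrix (Fin n) (Fin n) ℝ := of fun i j => L (symPart n (single i j 1)) with hB
    have hBt : Bᵀ = B := by
      ext i j
      simp only [hB, transpose_apply, of_apply]
      congr 1
      ext q
      simp only [symPart_apply, single_apply, and_comm, add_comm]
    have hLB : ∀ W, L W = (B * symMat n W).trace := by
      intro W
      conv_lhs => rw [← symPart_symMat W, matrix_eq_sum_single (symMat n W)]
      rw [← hBt]
      simp only [map_sum, trace, diag_apply, mul_apply, hB, transpose_apply, of_apply]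
      rw [Finset.sum_comm]
      refine Finset.sum_congr rfl fun i _ => Finset.sum_congr rfl fun j _ => ?_
      have : single j i (symMat n W j i) = symMat n W j i • single j i (1 : ℝ) := by
        rw [smul_single, smul_eq_mul, mul_one]
      rw [this, map_smul, map_smul, smul_eq_mul, mul_comm]
    obtain ⟨K, hK0, hK⟩ := exists_posDef_add_smul hBt
    refine ⟨1 / (2 * K), by positivity, fun t ht => ?_⟩
    -- Adding `t L` to the exponent `-tr/2` replaces the identity by `Z = 1 - 2tB`, which stays
    -- positive definite for small `t`; both Laplace transforms are then known at `Z`.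
    have hZ : (1 + (-2 * t) • B).PosDef := by
      have := hK 1 (-2 * t) (by
        rw [lt_div_iff₀ (by positivity)] at ht
        rw [abs_mul, abs_neg, abs_two]; linarith)
      rwa [one_smul] at this
    set Z := 1 + (-2 * t) • B with hZdef
    have hexp : ∀ W, ∀ M, M = symMat n W → -M.trace / 2 + t * L W = -(Z * M).trace / 2 := by
      rintro W M rfl
      rw [hLB, hZdef, Matrix.add_mul, Matrix.one_mul, trace_add, smul_mul, trace_smul, smul_eq_mul]
      ring
    have hmt : Measurable fun x => ENNReal.ofReal (Real.exp (t * L x)) := by fun_prop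
    have e1 : ∫⁻ x, ENNReal.ofReal (Real.exp (t * L x)) ∂μ =
        cW * (ENNReal.ofReal (Z.det ^ (-(p : ℝ) / 2)) * cX) := by
      rw [hμint _ hmt, ← laplace_innerMat hZ]
      congr 1
      refine lintegral_congr fun X => ?_
      rw [← ENNReal.ofReal_mul (Real.exp_pos _).le, ← Real.exp_add, hexp _ _ (hsymm X).symm]
    have e2 : ∫⁻ x, ENNReal.ofReal (Real.exp (t * L x)) ∂ν =
        cX * (ENNReal.ofReal (Z.det ^ (-(p : ℝ) / 2)) * cW) := by
      -- This equality of exponents is what determines `a`.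
      have : -(p : ℝ) / 2 = -(a + ((n : ℝ) + 1) / 2) := by rw [ha]; ring
      rw [hνint _ hmt, this, ← laplace_wishartDensity a hZ]
      congr 1
      refine lintegral_congr fun W => ?_
      rw [mul_assoc, ← ENNReal.ofReal_mul (Real.exp_pos _).le, ← Real.exp_add, Matrix.one_mul,
        hexp _ _ rfl]
    rw [e1, e2]
    exact ⟨ENNReal.mul_ne_top hcWt (ENNReal.mul_ne_top ENNReal.ofReal_ne_top hcXt), by ring⟩
  refine ⟨cW⁻¹ * cX, fun h hh => ?_⟩
  -- Testing against `exp(tr/2) h` removes the tilt.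
  have hmg : Measurable fun W : SymCoord n =>
      ENNReal.ofReal (Real.exp ((symMat n W).trace / 2)) * h W :=
    (ENNReal.measurable_ofReal.comp (Real.continuous_exp.comp
      (continuous_symMat.matrix_trace.div_const 2)).measurable).mul hh
  have hcancel : ∀ x : ℝ, ENNReal.ofReal (Real.exp (-x / 2)) *
      ENNReal.ofReal (Real.exp (x / 2)) = 1 := by
    intro x
    rw [← ENNReal.ofReal_mul (Real.exp_pos _).le, ← Real.exp_add]
    simp [neg_div]
  have e3 := hμint _ hmg
  have e4 := hνint _ hmg
  rw [hμν, e4] at e3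
  simp only [hsymm, ← mul_assoc, hcancel, one_mul] at e3
  have e5 : ∀ W : SymCoord n, wishartDensity n a W *
      ENNReal.ofReal (Real.exp (-(symMat n W).trace / 2)) *
      ENNReal.ofReal (Real.exp ((symMat n W).trace / 2)) = wishartDensity n a W := by
    intro W; rw [mul_assoc, hcancel, mul_one]
  simp only [e5] at e3
  rw [mul_assoc, e3, ← mul_assoc, ENNReal.inv_mul_cancel hcW0 hcWt, one_mul]

/-! ### Simplicity of the spectrum, almost everywhere -/

/-- The Krylov matrix with columns `M ^ j 1`. -/
def krylov {R : Type*} [CommRing R] (M : Matrix (Fin n) (Fin n) R) : Matrix (Fin n) (Fin n) R :=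
  of fun i j => ((M ^ (j : ℕ)) *ᵥ 1) i

theorem krylov_map {R R' : Type*} [CommRing R] [CommRing R'] (f : R →+* R')
    (M : Matrix (Fin n) (Fin n) R) : (krylov M).map f = krylov (M.map f) := by
  ext i j
  have : (M.map f) ^ (j : ℕ) = (M ^ (j : ℕ)).map f := (Matrix.map_pow M f j).symm
  simp [krylov, this, mulVec, dotProduct]

theorem det_krylov_smul (c : ℝ) (M : Matrix (Fin n) (Fin n) ℝ) :
    (krylov (c • M)).det = (krylov M).det * ∏ j : Fin n, c ^ (j : ℕ) := by
  have : krylov (c • M) = krylov M * diagonal fun j : Fin n => c ^ (j : ℕ) := by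
    ext i j
    simp [krylov, smul_pow, smul_mulVec, mul_diagonal, mul_comm]
  rw [this, det_mul, det_diagonal]

theorem krylov_diagonal (v : Fin n → ℝ) : krylov (diagonal v) = vandermonde v := by
  ext i j
  simp [krylov, diagonal_pow, mulVec_diagonal, vandermonde_apply]

/-- The Krylov matrix factors as `V · diag(Vᵀ1) · vandermonde ℓ`, so a repeated eigenvalue makes its
determinant vanish. This gives a test for simple spectrum that is polynomial in the matrix entries.
-/
theorem injective_of_det_krylov_ne_zero {V : Matrix (Fin n) (Fin n) ℝ} {ℓ : Fin n → ℝ}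
    (hV : Vᵀ * V = 1) (h : (krylov (V * diagonal ℓ * Vᵀ)).det ≠ 0) : Function.Injective ℓ := by
  have hpow : ∀ j : ℕ, (V * diagonal ℓ * Vᵀ) ^ j = V * diagonal (ℓ ^ j) * Vᵀ := by
    intro j
    induction j with
    | zero => simp [mul_eq_one_comm.1 hV]
    | succ j ih =>
      rw [pow_succ, ih, pow_succ ℓ, Pi.mul_def, ← diagonal_mul_diagonal]
      calc V * diagonal (ℓ ^ j) * Vᵀ * (V * diagonal ℓ * Vᵀ)
          = V * diagonal (ℓ ^ j) * (Vᵀ * V) * diagonal ℓ * Vᵀ := by simp only [Matrix.mul_assoc]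
        _ = _ := by rw [hV, Matrix.mul_one, Matrix.mul_assoc V]
  have : krylov (V * diagonal ℓ * Vᵀ) = V * (diagonal (Vᵀ *ᵥ 1) * vandermonde ℓ) := by
    ext i j
    simp only [krylov, of_apply, hpow, ← mulVec_mulVec, mul_apply, vandermonde_apply]
    simp [mulVec, dotProduct, diagonal_apply, mul_comm]
  rw [this, det_mul, det_mul] at h
  exact det_vandermonde_ne_zero_iff.1 (right_ne_zero_of_mul (right_ne_zero_of_mul h))

/-- By translation invariance, `μ N` is the average of the measures of the translates of `N` by `t •
v` over `t ∈ [0, 1]`; exchanging the integrals leaves null slices. -/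
theorem measure_eq_zero_of_lines {E : Type*} [NormedAddCommGroup E] [NormedSpace ℝ E]
    [MeasurableSpace E] [BorelSpace E] [FiniteDimensional ℝ E] (μ : Measure E)
    [μ.IsAddHaarMeasure] {N : Set E} (hN : MeasurableSet N) (v : E)
    (h : ∀ x, (volume : Measure ℝ) {t | x + t • v ∈ N} = 0) : μ N = 0 := by
  have hm : Measurable fun q : ℝ × E => N.indicator (1 : E → ENNReal) (q.2 + q.1 • v) :=
    (measurable_one.indicator hN).comp (by fun_prop)
  have h1 : ∫⁻ t in Set.Icc (0 : ℝ) 1, ∫⁻ x, N.indicator (1 : E → ENNReal) (x + t • v) ∂μ = μ N := by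
    have : ∀ t : ℝ, ∫⁻ x, N.indicator (1 : E → ENNReal) (x + t • v) ∂μ = μ N := by
      intro t
      rw [lintegral_add_right_eq_self (μ := μ) (N.indicator (1 : E → ENNReal)),
        lintegral_indicator_one hN]
    simp [this]
  rw [← h1, lintegral_lintegral_swap hm.aemeasurable]
  refine (lintegral_congr fun x => ?_).trans lintegral_zero
  have hs : MeasurableSet {t : ℝ | x + t • v ∈ N} := hN.preimage (by fun_prop)
  change ∫⁻ t in Set.Icc (0 : ℝ) 1, {t : ℝ | x + t • v ∈ N}.indicator 1 t = 0
  rw [lintegral_indicator_one hs]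
  rw [Measure.restrict_apply hs]
  exact measure_mono_null Set.inter_subset_left (h x)

theorem volume_det_krylov_eq_zero :
    volume {W : SymCoord n | (krylov (symMat n W)).det = 0} = 0 := by
  have hcont : Continuous fun W : SymCoord n => (krylov (symMat n W)).det := by
    refine Continuous.matrix_det (continuous_matrix fun i j => ?_)
    have : Continuous fun W : SymCoord n => (symMat n W) ^ (j : ℕ) := continuous_symMat.pow _
    exact (continuous_apply i).comp (this.matrix_mulVec continuous_const)
  let v : Fin n → ℝ := fun i => (i : ℕ)
  have hv : Function.Injective v := fun i j h => Fin.ext (Nat.cast_injective (R := ℝ) h)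
  refine measure_eq_zero_of_lines _ (isClosed_eq hcont continuous_const).measurableSet
    (symPart n (diagonal v)) fun W => ?_
  set M := symMat n W
  -- The direction `diagonal v` has distinct eigenvalues. By homogeneity, for `t ≠ 0` the
  -- determinant at `M + t D` is a nonzero multiple of that at `D + t⁻¹ M`. As a polynomial in `u =
  -- t⁻¹` the latter is a nonzero Vandermonde determinant at `u = 0`, so it has finitely many roots.
  let Q : Polynomial ℝ := (krylov ((diagonal v).map Polynomial.C +
    (Polynomial.X : Polynomial ℝ) • M.map Polynomial.C)).det
  have hQ : ∀ u : ℝ, Q.eval u = (krylov (diagonal v + u • M)).det := by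
    intro u
    have := RingHom.map_det (Polynomial.evalRingHom u) (krylov ((diagonal v).map Polynomial.C +
      (Polynomial.X : Polynomial ℝ) • M.map Polynomial.C))
    rw [Polynomial.coe_evalRingHom] at this
    rw [this, RingHom.mapMatrix_apply, krylov_map]
    congr 2
    ext i j
    simp only [map_apply, Matrix.add_apply, Matrix.smul_apply, smul_eq_mul, Polynomial.coe_evalRingHom,
      Polynomial.eval_add, Polynomial.eval_mul, Polynomial.eval_X, Polynomial.eval_C]
  have hQ0 : Q ≠ 0 := by
    intro h
    have := hQ 0
    rw [h, zero_smul, add_zero, krylov_diagonal, Polynomial.eval_zero] at this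
    exact det_vandermonde_ne_zero_iff.2 hv this.symm
  have hfin : (Q.rootSet ℝ).Finite := Polynomial.rootSet_finite Q ℝ
  refine measure_mono_null (t := {0} ∪ (fun u : ℝ => u⁻¹) '' Q.rootSet ℝ) ?_
    (((Set.finite_singleton 0).union (hfin.image _)).measure_zero volume)
  intro t ht
  rw [Set.mem_ofPred_eq, Set.mem_ofPred_eq, map_add, map_smul, symMat_symPart (by simp)] at ht
  by_cases h0 : t = 0
  · exact Or.inl h0
  right
  refine ⟨t⁻¹, ?_, inv_inv t⟩
  have hsc : M + t • diagonal v = t • (diagonal v + t⁻¹ • M) := by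
    rw [smul_add, smul_smul, mul_inv_cancel₀ h0, one_smul, add_comm]
  rw [hsc, det_krylov_smul, mul_eq_zero, or_iff_left
    (Finset.prod_ne_zero_iff.2 fun j _ => pow_ne_zero _ h0)] at ht
  rw [Polynomial.mem_rootSet]
  exact ⟨hQ0, by rw [Polynomial.coe_aeval_eq_eval, hQ, ht]⟩

/-- The law of `XᵗX` has a density supported on the cone, so exceptional sets that are null in the
cone pull back to null sets of data. -/
theorem ae_innerMat_of_ae {q : Matrix (Fin n) (Fin n) ℝ → Prop} (hnp : n < p)
    (hq : MeasurableSet {W : SymCoord n | q (symMat n W)})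
    (h : ∀ᵐ W : SymCoord n, (symMat n W).PosDef → q (symMat n W)) :
    ∀ᵐ X : Fin n → EuclideanSpace ℝ (Fin p), q (innerMat X) := by
  obtain ⟨k, hk⟩ := exists_lintegral_innerMat hnp
  have h1 := hk ({W : SymCoord n | q (symMat n W)}ᶜ.indicator 1)
    (measurable_one.indicator hq.compl)
  have h2 : ∫⁻ W : SymCoord n, wishartDensity n (((p : ℝ) - n - 1) / 2) W *
      {W : SymCoord n | q (symMat n W)}ᶜ.indicator 1 W = 0 := by
    refine (lintegral_congr_ae (g := fun _ => 0) ?_).trans lintegral_zero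
    filter_upwards [h] with W hW
    by_cases hpd : (symMat n W).PosDef
    · have : W ∉ {W : SymCoord n | q (symMat n W)}ᶜ := fun hc => hc (hW hpd)
      simp [Set.indicator_of_notMem this]
    · simp [wishartDensity_of_not_posDef _ hpd]
  have hm : Measurable fun X : Fin n → EuclideanSpace ℝ (Fin p) => symPart n (innerMat X) :=
    (continuous_symPart.comp continuous_innerMat).measurable
  rw [h2, mul_zero] at h1
  have h3 := (lintegral_eq_zero_iff ((measurable_one.indicator hq.compl).comp hm)).1 h1
  filter_upwards [h3] with X hX
  by_contra hc
  have hmem : symPart n (innerMat X) ∈ {W : SymCoord n | q (symMat n W)}ᶜ := by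
    simpa [symMat_symPart (transpose_innerMat X)] using hc
  simp [Set.indicator_of_mem hmem] at hX

theorem ae_posDef_innerMat (hnp : n < p) :
    ∀ᵐ X : Fin n → EuclideanSpace ℝ (Fin p), (innerMat X).PosDef :=
  ae_innerMat_of_ae hnp measurableSet_posDef_symMat (Filter.Eventually.of_forall fun _ h => h)

theorem ae_det_krylov_innerMat (hnp : n < p) :
    ∀ᵐ X : Fin n → EuclideanSpace ℝ (Fin p), (krylov (innerMat X)).det ≠ 0 := by
  have hcont : Continuous fun W : SymCoord n => (krylov (symMat n W)).det := by
    refine Continuous.matrix_det (continuous_matrix fun i j => ?_)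
    have : Continuous fun W : SymCoord n => (symMat n W) ^ (j : ℕ) := continuous_symMat.pow _
    exact (continuous_apply i).comp (this.matrix_mulVec continuous_const)
  refine ae_innerMat_of_ae (q := fun M => (krylov M).det ≠ 0) hnp
    (isOpen_ne_fun hcont continuous_const).measurableSet ?_
  have := volume_det_krylov_eq_zero (n := n)
  filter_upwards [compl_mem_ae_iff.2 this] with W hW _
  exact hW

/-! ### Averaging over the orthogonal group -/

instance instMeasurableSpaceMatrix {l m : Type*} : MeasurableSpace (Matrix l m ℝ) :=
  inferInstanceAs (MeasurableSpace (l → m → ℝ))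

instance instBorelSpaceMatrix {l m : Type*} [Countable l] [Countable m] :
    BorelSpace (Matrix l m ℝ) :=
  inferInstanceAs (BorelSpace (l → m → ℝ))

instance instSecondCountableTopologyMatrix {l m : Type*} [Countable l] [Countable m] :
    SecondCountableTopology (Matrix l m ℝ) :=
  inferInstanceAs (SecondCountableTopology (l → m → ℝ))

theorem _root_.Measurable.matrixEntry {α l m : Type*} [MeasurableSpace α]
    {f : α → Matrix l m ℝ} (hf : Measurable f) (i : l) (j : m) : Measurable fun x => f x i j :=
  (measurable_pi_apply j).comp ((measurable_pi_apply i).comp hf)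

theorem _root_.Measurable.matrixMul {α l m k : Type*} [MeasurableSpace α] [Fintype m]
    {f : α → Matrix l m ℝ} {g : α → Matrix m k ℝ} (hf : Measurable f) (hg : Measurable g) :
    Measurable fun x => f x * g x := by
  refine measurable_pi_lambda _ fun i => measurable_pi_lambda _ fun j => ?_
  simp only [mul_apply]
  exact Finset.measurable_fun_sum _ fun c _ => (hf.matrixEntry i c).mul (hg.matrixEntry c j)

theorem _root_.Measurable.matrixAddSMul {α l m : Type*} [MeasurableSpace α]
    {f g : α → Matrix l m ℝ} (hf : Measurable f) (hg : Measurable g) {c : α → ℝ}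
    (hc : Measurable c) : Measurable fun x => f x + c x • g x :=
  measurable_pi_lambda _ fun i => measurable_pi_lambda _ fun j =>
    (hf.matrixEntry i j).add (hc.mul (hg.matrixEntry i j))

/-- The group is closed and its entries are bounded by one. Compactness makes its Haar measure
finite, so the total mass can be cancelled later. -/
instance instCompactSpaceUnitaryGroup (p : ℕ) : CompactSpace (unitaryGroup (Fin p) ℝ) := by
  refine isCompact_iff_compactSpace
    (s := ((unitaryGroup (Fin p) ℝ : Submonoid _) : Set (Matrix (Fin p) (Fin p) ℝ))).1 ?_
  have hK : IsCompact {M : Matrix (Fin p) (Fin p) ℝ | ∀ i j, M i j ∈ Set.Icc (-1 : ℝ) 1} := by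
    have := isCompact_univ_pi (X := fun _ : Fin p => Fin p → ℝ) fun _ =>
      isCompact_univ_pi fun _ : Fin p => isCompact_Icc (a := (-1 : ℝ)) (b := 1)
    have hset : {M : Matrix (Fin p) (Fin p) ℝ | ∀ i j, M i j ∈ Set.Icc (-1 : ℝ) 1} =
        Set.univ.pi fun _ => Set.univ.pi fun _ => Set.Icc (-1 : ℝ) 1 := by
      ext M
      exact ⟨fun h i _ j _ => h i j, fun h i j => h i (Set.mem_univ i) j (Set.mem_univ j)⟩
    rw [hset]
    exact this
  refine hK.of_isClosed_subset ?_ fun M hM i j => ?_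
  · have : ((unitaryGroup (Fin p) ℝ : Submonoid _) : Set (Matrix (Fin p) (Fin p) ℝ)) =
        {M | star M * M = 1} := by
      ext M; exact mem_unitaryGroup_iff'
    rw [this]
    exact isClosed_eq (by fun_prop) continuous_const
  · have := entry_norm_bound_of_unitary hM i j
    rwa [Real.norm_eq_abs, abs_le] at this

/-- The average of `Φ` over the orbit of `S` under orthogonal conjugation. -/
noncomputable def orthAvg (Φ : Matrix (Fin p) (Fin p) ℝ → ENNReal)
    (S : Matrix (Fin p) (Fin p) ℝ) : ENNReal :=
  ∫⁻ O : unitaryGroup (Fin p) ℝ, Φ ((O : Matrix (Fin p) (Fin p) ℝ)ᵀ * S * O) ∂Measure.haar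

theorem measurable_conj : Measurable fun q : Matrix (Fin p) (Fin p) ℝ × unitaryGroup (Fin p) ℝ =>
    (q.2 : Matrix (Fin p) (Fin p) ℝ)ᵀ * q.1 * q.2 := by
  have h2 : Continuous fun q : Matrix (Fin p) (Fin p) ℝ × unitaryGroup (Fin p) ℝ =>
      (q.2 : Matrix (Fin p) (Fin p) ℝ) := continuous_subtype_val.comp continuous_snd
  exact ((h2.matrix_transpose.matrix_mul continuous_fst).matrix_mul h2).measurable

theorem measurable_orthAvg {Φ : Matrix (Fin p) (Fin p) ℝ → ENNReal} (hΦ : Measurable Φ) :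
    Measurable (orthAvg Φ) :=
  (hΦ.comp measurable_conj).lintegral_prod_right'

/-- Left invariance of Haar measure. -/
theorem orthAvg_conj (Φ : Matrix (Fin p) (Fin p) ℝ → ENNReal) (Q : unitaryGroup (Fin p) ℝ)
    (S : Matrix (Fin p) (Fin p) ℝ) :
    orthAvg Φ ((Q : Matrix (Fin p) (Fin p) ℝ)ᵀ * S * Q) = orthAvg Φ S := by
  have := lintegral_mul_left_eq_self (μ := (Measure.haar : Measure (unitaryGroup (Fin p) ℝ)))
    (fun O => Φ ((O : Matrix (Fin p) (Fin p) ℝ)ᵀ * S * O)) Q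
  rw [orthAvg, orthAvg, ← this]
  refine lintegral_congr fun O => ?_
  congr 1
  simp only [Submonoid.coe_mul, transpose_mul, Matrix.mul_assoc]

/-- Two orthonormal `n`-frames, completed to bases, differ by an orthogonal matrix `Q`. Hence the
average forgets the eigenvectors and depends only on the `n × n` matrix `M`. -/
theorem orthAvg_eq_of_orthonormal_cols (Φ : Matrix (Fin p) (Fin p) ℝ → ENNReal)
    {H K : Matrix (Fin p) (Fin n) ℝ} (hH : Hᵀ * H = 1) (hK : Kᵀ * K = 1)
    (M : Matrix (Fin n) (Fin n) ℝ) : orthAvg Φ (H * M * Hᵀ) = orthAvg Φ (K * M * Kᵀ) := by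
  obtain ⟨H₀, h1, h2⟩ := exists_orthogonal_completion H hH
  obtain ⟨K₀, k1, k2⟩ := exists_orthogonal_completion K hK
  set Q := fromCols K K₀ * (fromCols H H₀)ᵀ with hQ
  have hQQ : Qᵀ * Q = 1 := by
    calc Qᵀ * Q = fromCols H H₀ * ((fromCols K K₀)ᵀ * fromCols K K₀) * (fromCols H H₀)ᵀ := by
          rw [hQ]; simp only [transpose_mul, transpose_transpose, Matrix.mul_assoc]
      _ = 1 := by rw [k1, Matrix.mul_one, h2]
  have hQmem : Q ∈ unitaryGroup (Fin p) ℝ := by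
    rw [mem_unitaryGroup_iff', star_eq_conjTranspose, conjTranspose_eq_transpose_of_trivial, hQQ]
  have hblock : K₀ᵀ * K = 0 := by
    have := k1
    rw [transpose_fromCols, fromRows_mul_fromCols, ← fromBlocks_one, fromBlocks_inj] at this
    exact this.2.2.1
  have hQK : Qᵀ * K = H := by
    rw [hQ, transpose_mul, transpose_transpose, Matrix.mul_assoc, transpose_fromCols,
      fromRows_mul, hK, hblock, fromCols_mul_fromRows]
    simp
  rw [← orthAvg_conj Φ ⟨Q, hQmem⟩ (K * M * Kᵀ)]
  congr 1
  have hKQ : Kᵀ * Q = Hᵀ := by rw [← hQK]; simp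
  calc H * M * Hᵀ = (Qᵀ * K) * M * (Kᵀ * Q) := by rw [hQK, hKQ]
    _ = _ := by simp only [Matrix.mul_assoc]

/-- Left multiplication of the data matrix by a square matrix. -/
noncomputable def rowMul (M : Matrix (Fin p) (Fin p) ℝ) (X : Fin n → EuclideanSpace ℝ (Fin p)) :
    Fin n → EuclideanSpace ℝ (Fin p) :=
  fun i => toEuclideanLin M (X i)

theorem dataMat_rowMul (M : Matrix (Fin p) (Fin p) ℝ) (X : Fin n → EuclideanSpace ℝ (Fin p)) :
    dataMat (rowMul M X) = M * dataMat X := by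
  ext k i
  simp [dataMat, rowMul, mul_apply, mulVec, dotProduct]

theorem measurePreserving_rowMul {M : Matrix (Fin p) (Fin p) ℝ} (hM : Mᵀ * M = 1) :
    MeasurePreserving (rowMul (n := n) M) := by
  have hnorm : ∀ x : EuclideanSpace ℝ (Fin p), ‖toEuclideanLin M x‖ = ‖x‖ := by
    intro x
    rw [← sq_eq_sq₀ (norm_nonneg _) (norm_nonneg _), ← real_inner_self_eq_norm_sq,
      ← real_inner_self_eq_norm_sq]
    have h1 : ∀ y : EuclideanSpace ℝ (Fin p), inner ℝ y y = y.ofLp ⬝ᵥ y.ofLp := fun y => by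
      rw [PiLp.inner_apply]; simp [dotProduct, sq]
    rw [h1, h1]
    simp only [toLpLin_apply]
    rw [dotProduct_mulVec, vecMul_mulVec, hM, vecMul_one]
  let e : EuclideanSpace ℝ (Fin p) ≃ₗᵢ[ℝ] EuclideanSpace ℝ (Fin p) :=
    LinearIsometry.toLinearIsometryEquiv ⟨toEuclideanLin M, hnorm⟩ rfl
  exact volume_preserving_pi fun _ : Fin n => e.measurePreserving

/-- The orthogonal projection onto the span of the columns. -/
noncomputable def colProj (X : Fin n → EuclideanSpace ℝ (Fin p)) : Matrix (Fin p) (Fin p) ℝ :=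
  dataMat X * (innerMat X)⁻¹ * (dataMat X)ᵀ

theorem innerMat_rowMul {M : Matrix (Fin p) (Fin p) ℝ} (hM : Mᵀ * M = 1)
    (X : Fin n → EuclideanSpace ℝ (Fin p)) : innerMat (rowMul M X) = innerMat X := by
  rw [innerMat, dataMat_rowMul, transpose_mul, Matrix.mul_assoc, ← Matrix.mul_assoc Mᵀ, hM,
    Matrix.one_mul, innerMat]

theorem gramSum_rowMul (M : Matrix (Fin p) (Fin p) ℝ) (X : Fin n → EuclideanSpace ℝ (Fin p)) :
    gramSum (rowMul M X) = M * gramSum X * Mᵀ := by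
  simp only [gramSum_eq, dataMat_rowMul, transpose_mul, Matrix.mul_assoc]

theorem colProj_rowMul {M : Matrix (Fin p) (Fin p) ℝ} (hM : Mᵀ * M = 1)
    (X : Fin n → EuclideanSpace ℝ (Fin p)) : colProj (rowMul M X) = M * colProj X * Mᵀ := by
  simp only [colProj, dataMat_rowMul, innerMat_rowMul hM, transpose_mul, Matrix.mul_assoc]

theorem measurable_matrix_inv {m : ℕ} :
    Measurable fun M : Matrix (Fin m) (Fin m) ℝ => M⁻¹ := by
  have : (fun M : Matrix (Fin m) (Fin m) ℝ => M⁻¹) = fun M => (M.det)⁻¹ • M.adjugate := by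
    ext1 M; rw [inv_def, Ring.inverse_eq_inv']
  rw [this]
  refine measurable_pi_lambda _ fun i => measurable_pi_lambda _ fun j => ?_
  have h1 : Measurable fun M : Matrix (Fin m) (Fin m) ℝ => (M.det)⁻¹ :=
    (continuous_id.matrix_det.measurable).inv
  have h2 : Measurable fun M : Matrix (Fin m) (Fin m) ℝ => M.adjugate i j :=
    (continuous_id.matrix_adjugate.matrix_elem i j).measurable
  exact h1.mul h2

theorem measurable_gramSum :
    Measurable (gramSum : (Fin n → EuclideanSpace ℝ (Fin p)) → Matrix (Fin p) (Fin p) ℝ) := by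
  have : (gramSum : (Fin n → EuclideanSpace ℝ (Fin p)) → Matrix (Fin p) (Fin p) ℝ) =
      fun X => dataMat X * (dataMat X)ᵀ := funext gramSum_eq
  rw [this]
  exact (continuous_dataMat.matrix_mul continuous_dataMat.matrix_transpose).measurable

theorem measurable_colProj :
    Measurable (colProj : (Fin n → EuclideanSpace ℝ (Fin p)) → Matrix (Fin p) (Fin p) ℝ) := by
  exact (continuous_dataMat.measurable.matrixMul
    (measurable_matrix_inv.comp continuous_innerMat.measurable)).matrixMul
    continuous_dataMat.matrix_transpose.measurable

/-- Averaging an equivariant integrand over the orthogonal group. -/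
theorem lintegral_orthAvg {Φ : Matrix (Fin p) (Fin p) ℝ → ENNReal} (hΦ : Measurable Φ)
    {D : (Fin n → EuclideanSpace ℝ (Fin p)) → Matrix (Fin p) (Fin p) ℝ} (hD : Measurable D)
    (hDe : ∀ (M : Matrix (Fin p) (Fin p) ℝ) X, Mᵀ * M = 1 → D (rowMul M X) = M * D X * Mᵀ)
    {w : Matrix (Fin n) (Fin n) ℝ → ENNReal} (hw : Measurable w) :
    ∫⁻ X, orthAvg Φ (D X) * w (innerMat X) =
      (Measure.haar (Set.univ : Set (unitaryGroup (Fin p) ℝ))) *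
        ∫⁻ X, Φ (D X) * w (innerMat X) := by
  have hwm : Measurable fun X : Fin n → EuclideanSpace ℝ (Fin p) => w (innerMat X) :=
    hw.comp continuous_innerMat.measurable
  -- The substitution `X ↦ Oᵗ X` preserves Lebesgue measure and `XᵗX` and conjugates `D X`, so every
  -- `O` contributes the same integral.
  have h1 : ∀ O : unitaryGroup (Fin p) ℝ,
      ∫⁻ X, Φ ((O : Matrix (Fin p) (Fin p) ℝ)ᵀ * D X * O) * w (innerMat X) =
        ∫⁻ X, Φ (D X) * w (innerMat X) := by
    intro O
    have hO : (O : Matrix (Fin p) (Fin p) ℝ) * (O : Matrix (Fin p) (Fin p) ℝ)ᵀ = 1 := by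
      have := mem_unitaryGroup_iff.1 O.2
      rwa [star_eq_conjTranspose, conjTranspose_eq_transpose_of_trivial] at this
    have hO' : ((O : Matrix (Fin p) (Fin p) ℝ)ᵀ)ᵀ * (O : Matrix (Fin p) (Fin p) ℝ)ᵀ = 1 := by
      rwa [transpose_transpose]
    have hm : Measurable fun X => Φ (D X) * w (innerMat X) := (hΦ.comp hD).mul hwm
    rw [← (measurePreserving_rowMul (n := n) hO').lintegral_comp hm]
    refine lintegral_congr fun X => ?_
    rw [innerMat_rowMul hO', hDe _ _ hO', transpose_transpose]
  have hv : Measurable fun q : (Fin n → EuclideanSpace ℝ (Fin p)) × unitaryGroup (Fin p) ℝ =>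
      (q.2 : Matrix (Fin p) (Fin p) ℝ) := continuous_subtype_val.measurable.comp measurable_snd
  have hvt : Measurable fun q : (Fin n → EuclideanSpace ℝ (Fin p)) × unitaryGroup (Fin p) ℝ =>
      (q.2 : Matrix (Fin p) (Fin p) ℝ)ᵀ :=
    continuous_subtype_val.matrix_transpose.measurable.comp measurable_snd
  have hD1 : Measurable fun q : (Fin n → EuclideanSpace ℝ (Fin p)) × unitaryGroup (Fin p) ℝ =>
      D q.1 := hD.comp measurable_fst
  have h2 : Measurable fun q : (Fin n → EuclideanSpace ℝ (Fin p)) × unitaryGroup (Fin p) ℝ =>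
      Φ ((q.2 : Matrix (Fin p) (Fin p) ℝ)ᵀ * D q.1 * q.2) * w (innerMat q.1) :=
    (hΦ.comp ((hvt.matrixMul hD1).matrixMul hv)).mul (hwm.comp measurable_fst)
  have hc : ∀ S : Matrix (Fin p) (Fin p) ℝ, Continuous fun O : unitaryGroup (Fin p) ℝ =>
      (O : Matrix (Fin p) (Fin p) ℝ)ᵀ * S * O := fun S =>
    (continuous_subtype_val.matrix_transpose.matrix_mul continuous_const).matrix_mul
      continuous_subtype_val
  have h3 : ∀ X, orthAvg Φ (D X) * w (innerMat X) = ∫⁻ O : unitaryGroup (Fin p) ℝ,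
      Φ ((O : Matrix (Fin p) (Fin p) ℝ)ᵀ * D X * O) * w (innerMat X) ∂Measure.haar := by
    intro X
    have hm : Measurable fun O : unitaryGroup (Fin p) ℝ =>
        Φ ((O : Matrix (Fin p) (Fin p) ℝ)ᵀ * D X * O) :=
      hΦ.comp (hc (D X)).measurable
    rw [orthAvg, lintegral_mul_const _ hm]
  rw [lintegral_congr h3, lintegral_lintegral_swap h2.aemeasurable, lintegral_congr h1,
    lintegral_const, mul_comm]

/-- Shifting the nonzero eigenvalues by `s`, with the eigenvectors fixed, is a change of variables
with Jacobian `(det (W + s) / det W) ^ ((p - n - 1) / 2)` onto a subset. -/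
theorem lintegral_shift_le (hnp : n < p) {Φ : Matrix (Fin p) (Fin p) ℝ → ENNReal}
    (hΦ : Measurable Φ) {s : ℝ} (hs : 0 ≤ s) :
    ∫⁻ X : Fin n → EuclideanSpace ℝ (Fin p), Φ (gramSum X + s • colProj X) *
        ENNReal.ofReal (((innerMat X + s • 1).det / (innerMat X).det) ^ (((p : ℝ) - n - 1) / 2)) ≤
      ∫⁻ X : Fin n → EuclideanSpace ℝ (Fin p), Φ (gramSum X) := by
  set a := ((p : ℝ) - n - 1) / 2 with ha
  set w : Matrix (Fin n) (Fin n) ℝ → ENNReal := fun W =>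
    ENNReal.ofReal (((W + s • 1).det / W.det) ^ a) with hw
  have hwm : Measurable w := by
    have h1 : Measurable fun W : Matrix (Fin n) (Fin n) ℝ => (W + s • 1).det :=
      (continuous_id.add continuous_const).matrix_det.measurable
    have h2 : Measurable fun W : Matrix (Fin n) (Fin n) ℝ => W.det :=
      continuous_id.matrix_det.measurable
    exact ((h1.div h2).pow_const a).ennreal_ofReal
  -- A fixed reference frame; through it, the averaged integrand becomes a function `g` of `XᵗX`
  -- alone.
  let J : Matrix (Fin p) (Fin n) ℝ := of fun k i => if k = Fin.castLE hnp.le i then 1 else 0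
  have hJ : Jᵀ * J = 1 := by
    ext i j
    simp [J, mul_apply, one_apply, eq_comm]
  let g : Matrix (Fin n) (Fin n) ℝ → ENNReal := fun M => orthAvg Φ (J * M * Jᵀ)
  have hg : Measurable g := (measurable_orthAvg hΦ).comp
    ((continuous_const.matrix_mul continuous_id).matrix_mul continuous_const).measurable
  have hkey : ∀ X : Fin n → EuclideanSpace ℝ (Fin p), (innerMat X).PosDef → ∀ u : ℝ,
      orthAvg Φ (gramSum X + u • colProj X) = g (innerMat X + u • 1) := by
    intro X hX u
    obtain ⟨V, H, ℓ, h⟩ := exists_singularData hX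
    rw [gramSum_eq, colProj, innerMat, h.outer_add_proj, h.gram, spectral_add_smul_one h.V_right]
    have hJV : (J * V)ᵀ * (J * V) = 1 := by
      rw [transpose_mul, Matrix.mul_assoc, ← Matrix.mul_assoc Jᵀ, hJ, Matrix.one_mul, h.V_left]
    rw [orthAvg_eq_of_orthonormal_cols Φ h.H_left hJV]
    simp only [g, transpose_mul, Matrix.mul_assoc]
  have hsc : s • (1 : Matrix (Fin n) (Fin n) ℝ) = symMat n (symPart n (s • 1)) :=
    (symMat_symPart (by simp)).symm
  obtain ⟨k, hk⟩ := exists_lintegral_innerMat hnp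
  set κ := Measure.haar (Set.univ : Set (unitaryGroup (Fin p) ℝ))
  have hκ0 : κ ≠ 0 := by
    simpa [κ] using (NeZero.ne (Measure.haar : Measure (unitaryGroup (Fin p) ℝ)))
  have hκt : κ ≠ ⊤ := measure_ne_top _ _
  have e1 := lintegral_orthAvg (n := n) hΦ (D := fun X => gramSum X + s • colProj X)
    (measurable_gramSum.matrixAddSMul measurable_colProj measurable_const)
    (by
      intro M X hM
      simp only [gramSum_rowMul, colProj_rowMul hM, Matrix.mul_add, Matrix.add_mul,
        Matrix.mul_smul, Matrix.smul_mul]) hwm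
  have e2 := lintegral_orthAvg (n := n) hΦ (D := gramSum) measurable_gramSum
    (fun M X _ => gramSum_rowMul M X) (w := 1) measurable_one
  simp only [Pi.one_apply, mul_one] at e2
  have f1 : ∫⁻ X : Fin n → EuclideanSpace ℝ (Fin p),
      orthAvg Φ (gramSum X + s • colProj X) * w (innerMat X) =
      k * ∫⁻ W : SymCoord n, wishartDensity n a W *
        (g (symMat n W + s • 1) * w (symMat n W)) := by
    have hm : Measurable fun W : SymCoord n => g (symMat n W + s • 1) * w (symMat n W) :=
      (hg.comp (continuous_symMat.add continuous_const).measurable).mul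
        (hwm.comp continuous_symMat.measurable)
    rw [← hk _ hm]
    refine lintegral_congr_ae ?_
    filter_upwards [ae_posDef_innerMat hnp] with X hX
    rw [hkey X hX, symMat_symPart (transpose_innerMat X)]
  have f2 : ∫⁻ X : Fin n → EuclideanSpace ℝ (Fin p), orthAvg Φ (gramSum X) =
      k * ∫⁻ W : SymCoord n, wishartDensity n a W * g (symMat n W) := by
    have hm : Measurable fun W : SymCoord n => g (symMat n W) :=
      hg.comp continuous_symMat.measurable
    rw [← hk _ hm]
    refine lintegral_congr_ae ?_
    filter_upwards [ae_posDef_innerMat hnp] with X hX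
    have := hkey X hX 0
    rw [symMat_symPart (transpose_innerMat X)]
    simpa using this
  -- Translate by `s`: the determinant ratio turns `(det W) ^ a` into `(det (W + s)) ^ a`. Only an
  -- inequality holds, since `W + s` can be positive definite while `W` is not.
  have f3 : ∫⁻ W : SymCoord n, wishartDensity n a W *
      (g (symMat n W + s • 1) * w (symMat n W)) ≤
      ∫⁻ W : SymCoord n, wishartDensity n a W * g (symMat n W) := by
    rw [← lintegral_add_right_eq_self (μ := (volume : Measure (SymCoord n)))
      (fun W => wishartDensity n a W * g (symMat n W)) (symPart n (s • 1))]
    refine lintegral_mono fun W => ?_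
    by_cases hpd : (symMat n W).PosDef
    swap
    · simp [wishartDensity_of_not_posDef a hpd]
    have hpd' : (symMat n (W + symPart n (s • 1))).PosDef := by
      rw [map_add, ← hsc]
      exact hpd.add_posSemidef (PosSemidef.one.smul hs)
    have hdet := hpd.det_pos
    have hdet' := hpd'.det_pos
    simp only [wishartDensity_of_posDef a hpd, wishartDensity_of_posDef a hpd', hw]
    rw [map_add, ← hsc] at hdet' ⊢
    refine le_of_eq ?_
    rw [mul_left_comm, ← ENNReal.ofReal_mul (Real.rpow_nonneg hdet.le _),
      ← Real.mul_rpow hdet.le (div_nonneg hdet'.le hdet.le), mul_div_cancel₀ _ hdet.ne', mul_comm]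
  have : κ * ∫⁻ X : Fin n → EuclideanSpace ℝ (Fin p),
      Φ (gramSum X + s • colProj X) * w (innerMat X) ≤
      κ * ∫⁻ X : Fin n → EuclideanSpace ℝ (Fin p), Φ (gramSum X) := by
    rw [← e1, ← e2, f1, f2]
    exact mul_le_mul_right f3 k
  exact (ENNReal.mul_le_mul_iff_right hκ0 hκt).1 this

open scoped MatrixOrder

/-! ### The density of the sample -/

theorem lintegral_pi_prod {E : Type*} [MeasurableSpace E] (μ : Measure E) [SigmaFinite μ] :
    ∀ {n : ℕ} {f : Fin n → E → ENNReal} (_ : ∀ i, Measurable (f i)),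
      ∫⁻ x, ∏ i, f i (x i) ∂(Measure.pi fun _ : Fin n => μ) = ∏ i, ∫⁻ x, f i x ∂μ
  | 0, f, _ => by simp
  | n + 1, f, hf => by
    have hm : Measurable fun x : Fin n → E => ∏ i : Fin n, f i.succ (x i) :=
      Finset.measurable_fun_prod _ fun i _ => (hf i.succ).comp (measurable_pi_apply i)
    have hm' : Measurable fun x : Fin (n + 1) → E => ∏ i, f i (x i) :=
      Finset.measurable_fun_prod _ fun i _ => (hf i).comp (measurable_pi_apply i)
    rw [← ((measurePreserving_piFinSuccAbove (fun _ : Fin (n + 1) => μ) 0).symm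
      _).lintegral_comp hm', Fin.prod_univ_succ,
      ← lintegral_pi_prod μ fun i : Fin n => hf i.succ,
      ← lintegral_prod_mul (hf 0).aemeasurable hm.aemeasurable]
    refine lintegral_congr fun x => ?_
    rw [Fin.prod_univ_succ]
    rfl

theorem pi_withDensity {E : Type*} [MeasurableSpace E] (μ : Measure E) [SigmaFinite μ]
    {f : E → ENNReal} (hf : Measurable f) [SigmaFinite (μ.withDensity f)] (n : ℕ) :
    Measure.pi (fun _ : Fin n => μ.withDensity f) =
      (Measure.pi fun _ : Fin n => μ).withDensity fun x => ∏ i, f (x i) := by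
  refine Measure.pi_eq fun s hs => ?_
  rw [withDensity_apply _ (MeasurableSet.univ_pi hs), ← lintegral_indicator (.univ_pi hs)]
  have h1 : ∀ i, Measurable ((s i).indicator f) := fun i => hf.indicator (hs i)
  have h2 : ∀ x : Fin n → E, (Set.univ.pi s).indicator (fun x => ∏ i, f (x i)) x =
      ∏ i, (s i).indicator f (x i) := by
    intro x
    by_cases hx : x ∈ Set.univ.pi s
    · rw [Set.indicator_of_mem hx]
      exact Finset.prod_congr rfl fun i _ => (Set.indicator_of_mem (hx i (Set.mem_univ i)) f).symm
    · rw [Set.indicator_of_notMem hx]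
      simp only [Set.mem_univ_pi, not_forall] at hx
      obtain ⟨i, hi⟩ := hx
      exact (Finset.prod_eq_zero (Finset.mem_univ i) (Set.indicator_of_notMem hi f)).symm
  rw [lintegral_congr h2, lintegral_pi_prod μ h1]
  exact Finset.prod_congr rfl fun i _ => by
    rw [lintegral_indicator (hs i), withDensity_apply _ (hs i)]

/-- The normalising constant stays unspecified here and in the next densities: it will multiply both
sides of the comparison of integrals. -/
theorem exists_stdGaussian_eq_withDensity (p : ℕ) :
    ∃ c : ENNReal, stdGaussian (EuclideanSpace ℝ (Fin p)) =
      volume.withDensity fun x => c * ENNReal.ofReal (Real.exp (-‖x‖ ^ 2 / 2)) := by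
  have hg : gaussianReal 0 1 = volume.withDensity (gaussianPDF 0 1) :=
    gaussianReal_of_var_ne_zero 0 one_ne_zero
  have hsf : SigmaFinite ((volume : Measure ℝ).withDensity (gaussianPDF 0 1)) := by
    rw [← hg]; infer_instance
  refine ⟨∏ _i : Fin p, ENNReal.ofReal (√(2 * Real.pi * 1))⁻¹, ?_⟩
  have hm : Measurable fun x : EuclideanSpace ℝ (Fin p) =>
      (∏ _i : Fin p, ENNReal.ofReal (√(2 * Real.pi * 1))⁻¹) *
        ENNReal.ofReal (Real.exp (-‖x‖ ^ 2 / 2)) := by fun_prop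
  rw [← map_pi_eq_stdGaussian, hg, pi_withDensity _ (measurable_gaussianPDF 0 1)]
  ext s hs
  rw [Measure.map_apply (WithLp.measurable_toLp 2 _) hs,
    withDensity_apply _ (WithLp.measurable_toLp 2 _ hs), withDensity_apply _ hs,
    ← (PiLp.volume_preserving_toLp (Fin p)).setLIntegral_comp_preimage hs hm]
  refine lintegral_congr fun x => ?_
  rw [EuclideanSpace.real_norm_sq_eq, ← Finset.sum_neg_distrib, Finset.sum_div, Real.exp_sum,
    ENNReal.ofReal_prod_of_nonneg fun i _ => (Real.exp_pos _).le, ← Finset.prod_mul_distrib]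
  refine Finset.prod_congr rfl fun i _ => ?_
  rw [← ENNReal.ofReal_mul (by positivity), gaussianPDF, gaussianPDFReal]
  simp

theorem exists_multivariateGaussian_eq_withDensity {Sig : Matrix (Fin p) (Fin p) ℝ}
    (hSig : Sig.PosDef) :
    ∃ c : ENNReal, multivariateGaussian 0 Sig =
      volume.withDensity fun x : EuclideanSpace ℝ (Fin p) =>
        c * ENNReal.ofReal (Real.exp (-(x.ofLp ⬝ᵥ (Sig⁻¹ *ᵥ x.ofLp)) / 2)) := by
  obtain ⟨c, hc⟩ := exists_stdGaussian_eq_withDensity p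
  set M := CFC.sqrt Sig with hM
  have hMM : M * M = Sig := CFC.sqrt_mul_sqrt_self _ hSig.posSemidef.nonneg
  have hMt : Mᵀ = M := by
    have : star M = M := (CFC.sqrt_nonneg Sig).isSelfAdjoint
    rwa [star_eq_conjTranspose, conjTranspose_eq_transpose_of_trivial] at this
  have hdet : M.det ≠ 0 := by
    intro h
    have := hSig.det_pos
    rw [← hMM, det_mul, h, zero_mul] at this
    exact this.false
  have hMu : IsUnit M.det := hdet.isUnit
  have hMZM : M * Sig⁻¹ * M = 1 := by
    rw [← hMM, Matrix.mul_inv_rev, ← Matrix.mul_assoc, mul_nonsing_inv _ hMu, Matrix.one_mul,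
      nonsing_inv_mul _ hMu]
  have hld : LinearMap.det (toEuclideanLin M) ≠ 0 := by
    have h1 : toEuclideanLin M ∘ₗ toEuclideanLin M⁻¹ = LinearMap.id := by
      apply LinearMap.ext
      intro x
      simp [toLpLin_apply, mul_nonsing_inv _ hMu]
    have h2 := congrArg LinearMap.det h1
    rw [LinearMap.det_comp, LinearMap.det_id] at h2
    exact left_ne_zero_of_mul (h2 ▸ one_ne_zero)
  set d := ENNReal.ofReal |(LinearMap.det (toEuclideanLin M))⁻¹|
  refine ⟨d * c, ?_⟩
  set G : EuclideanSpace ℝ (Fin p) → ENNReal := fun x =>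
    c * ENNReal.ofReal (Real.exp (-(x.ofLp ⬝ᵥ (Sig⁻¹ *ᵥ x.ofLp)) / 2)) with hG
  have hGm : Measurable G := by
    have : Continuous fun x : EuclideanSpace ℝ (Fin p) => x.ofLp ⬝ᵥ (Sig⁻¹ *ᵥ x.ofLp) :=
      (PiLp.continuous_ofLp 2 _).dotProduct
        (continuous_const.matrix_mulVec (PiLp.continuous_ofLp 2 _))
    exact (ENNReal.measurable_ofReal.comp (Real.continuous_exp.comp
      (this.neg.div_const 2)).measurable).const_mul c
  have hGM : ∀ x, G (toEuclideanLin M x) = c * ENNReal.ofReal (Real.exp (-‖x‖ ^ 2 / 2)) := by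
    intro x
    simp only [hG, toLpLin_apply]
    congr 5
    rw [dotProduct_mulVec, vecMul_mulVec, hMt, dotProduct_mulVec, vecMul_vecMul, hMZM, vecMul_one,
      EuclideanSpace.real_norm_sq_eq]
    simp [dotProduct, sq]
  have hmul : (fun x : EuclideanSpace ℝ (Fin p) =>
      d * c * ENNReal.ofReal (Real.exp (-(x.ofLp ⬝ᵥ (Sig⁻¹ *ᵥ x.ofLp)) / 2))) =
      fun x => d * G x := by ext x; simp only [hG, mul_assoc]
  have hfun : (fun x : EuclideanSpace ℝ (Fin p) =>
      (0 : EuclideanSpace ℝ (Fin p)) + toEuclideanCLM (𝕜 := ℝ) M x) = toEuclideanLin M := by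
    ext1 x; rw [zero_add, ← coe_toEuclideanCLM_eq_toEuclideanLin]; rfl
  rw [hmul, multivariateGaussian, ← hM, hfun, hc]
  have hMc : Measurable (toEuclideanLin M : EuclideanSpace ℝ (Fin p) → _) :=
    (toEuclideanLin M).continuous_of_finiteDimensional.measurable
  ext s hs
  rw [Measure.map_apply hMc hs, withDensity_apply _ (hMc hs), withDensity_apply _ hs,
    lintegral_const_mul _ hGm, ← lintegral_indicator (hMc hs), ← lintegral_indicator hs,
    ← lintegral_comp_linearMap _ hld (hGm.indicator hs)]
  refine lintegral_congr fun x => ?_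
  by_cases hx : toEuclideanLin M x ∈ s
  · rw [Set.indicator_of_mem (show x ∈ toEuclideanLin M ⁻¹' s from hx), Set.indicator_of_mem hx,
      hGM]
  · rw [Set.indicator_of_notMem (show x ∉ toEuclideanLin M ⁻¹' s from hx),
      Set.indicator_of_notMem hx]

theorem measurable_exp_trace_mul (Z : Matrix (Fin p) (Fin p) ℝ) :
    Measurable fun S : Matrix (Fin p) (Fin p) ℝ =>
      ENNReal.ofReal (Real.exp (-(Z * S).trace / 2)) :=
  ENNReal.measurable_ofReal.comp (Real.continuous_exp.comp
    ((continuous_const.matrix_mul continuous_id).matrix_trace.neg.div_const 2)).measurable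

theorem exists_sampleLaw_eq_withDensity (n : ℕ) {Sig : Matrix (Fin p) (Fin p) ℝ}
    (hSig : Sig.PosDef) :
    ∃ c : ENNReal, sampleLaw n Sig = volume.withDensity fun X =>
      c * ENNReal.ofReal (Real.exp (-(Sig⁻¹ * gramSum X).trace / 2)) := by
  obtain ⟨c, hc⟩ := exists_multivariateGaussian_eq_withDensity hSig
  have hm : Measurable fun x : EuclideanSpace ℝ (Fin p) =>
      c * ENNReal.ofReal (Real.exp (-(x.ofLp ⬝ᵥ (Sig⁻¹ *ᵥ x.ofLp)) / 2)) := by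
    have : Continuous fun x : EuclideanSpace ℝ (Fin p) => x.ofLp ⬝ᵥ (Sig⁻¹ *ᵥ x.ofLp) :=
      (PiLp.continuous_ofLp 2 _).dotProduct
        (continuous_const.matrix_mulVec (PiLp.continuous_ofLp 2 _))
    exact (ENNReal.measurable_ofReal.comp (Real.continuous_exp.comp
      (this.neg.div_const 2)).measurable).const_mul c
  have hsf : SigmaFinite ((volume : Measure (EuclideanSpace ℝ (Fin p))).withDensity fun x =>
      c * ENNReal.ofReal (Real.exp (-(x.ofLp ⬝ᵥ (Sig⁻¹ *ᵥ x.ofLp)) / 2))) := by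
    rw [← hc]; infer_instance
  refine ⟨∏ _i : Fin n, c, ?_⟩
  rw [sampleLaw, hc, pi_withDensity _ hm]
  congr 1
  ext X
  rw [Finset.prod_mul_distrib, ← ENNReal.ofReal_prod_of_nonneg fun i _ => (Real.exp_pos _).le,
    ← Real.exp_sum, ← Finset.sum_div, Finset.sum_neg_distrib]
  congr 5
  rw [gramSum, Matrix.mul_sum, trace_sum]
  refine Finset.sum_congr rfl fun i _ => ?_
  rw [mul_vecMulVec, trace_vecMulVec, dotProduct_comm]

instance instIsProbabilityMeasureSampleLaw (n : ℕ) (Sig : Matrix (Fin p) (Fin p) ℝ) :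
    IsProbabilityMeasure (sampleLaw n Sig) := by
  unfold sampleLaw; infer_instance

theorem sampleLaw_absolutelyContinuous (n : ℕ) {Sig : Matrix (Fin p) (Fin p) ℝ}
    (hSig : Sig.PosDef) : sampleLaw n Sig ≪ volume := by
  obtain ⟨c, hc⟩ := exists_sampleLaw_eq_withDensity n hSig
  rw [hc]
  exact withDensity_absolutelyContinuous _ _

/-! ### An integral inequality for weights that increase with the eigenvalues -/

/-- The columns are linearly independent and the nonzero eigenvalues are distinct. -/
def Generic (X : Fin n → EuclideanSpace ℝ (Fin p)) : Prop :=
  (innerMat X).PosDef ∧ (krylov (innerMat X)).det ≠ 0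

theorem ae_generic (hnp : n < p) {Sig : Matrix (Fin p) (Fin p) ℝ} (hSig : Sig.PosDef) :
    ∀ᵐ X ∂(sampleLaw n Sig), Generic X :=
  (sampleLaw_absolutelyContinuous n hSig).ae_le
    ((ae_posDef_innerMat hnp).and (ae_det_krylov_innerMat hnp))

theorem Generic.exists_isSpectralDecomp {X : Fin n → EuclideanSpace ℝ (Fin p)} (hX : Generic X) :
    ∃ V H H₀ ℓ, SingularData (dataMat X) V H ℓ ∧ IsSpectralDecomp (gramSum X) H H₀ ℓ := by
  obtain ⟨V, H, ℓ, h⟩ := exists_singularData hX.1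
  obtain ⟨H₀, h1, h2⟩ := exists_orthogonal_completion H h.H_left
  have hinj : Function.Injective ℓ := injective_of_det_krylov_ne_zero h.V_left (by
    have := hX.2
    rwa [innerMat, h.gram] at this)
  exact ⟨V, H, H₀, ℓ, h, h1, h2, h.anti.strictAnti_of_injective hinj, h.pos,
    by rw [gramSum_eq, h.outer]⟩

theorem IsSpectralDecomp.shift {S : Matrix (Fin p) (Fin p) ℝ} {H : Matrix (Fin p) (Fin n) ℝ}
    {H₀ : Matrix (Fin p) (Fin (p - n)) ℝ} {ℓ : Fin n → ℝ} (h : IsSpectralDecomp S H H₀ ℓ)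
    {s : ℝ} (hs : 0 ≤ s) :
    IsSpectralDecomp (H * diagonal (fun i => ℓ i + s) * Hᵀ) H H₀ fun i => ℓ i + s :=
  ⟨h.1, h.2, fun i j hij => by simpa using h.anti hij, fun i => by linarith [h.pos i], rfl⟩

theorem trace_mul_colProj_nonneg {Z : Matrix (Fin p) (Fin p) ℝ} (hZ : Z.PosSemidef)
    {X : Fin n → EuclideanSpace ℝ (Fin p)} (hX : (innerMat X).PosDef) :
    0 ≤ (Z * colProj X).trace := by
  obtain ⟨V, H, ℓ, h⟩ := exists_singularData hX
  have h1 : colProj X = H * Hᵀ := h.proj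
  rw [h1, ← Matrix.mul_assoc, trace_mul_comm, ← Matrix.mul_assoc]
  have := hZ.conjTranspose_mul_mul_same H
  rw [conjTranspose_eq_transpose_of_trivial] at this
  exact this.trace_nonneg

theorem trace_mul_colProj_le {Z : Matrix (Fin p) (Fin p) ℝ} (hZ : Z.PosSemidef)
    {X : Fin n → EuclideanSpace ℝ (Fin p)} (hX : (innerMat X).PosDef) :
    (Z * colProj X).trace ≤ Z.trace := by
  obtain ⟨V, H, ℓ, h⟩ := exists_singularData hX
  obtain ⟨H₀, h1, h2⟩ := exists_orthogonal_completion H h.H_left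
  have h3 : colProj X = H * Hᵀ := h.proj
  rw [transpose_fromCols, fromCols_mul_fromRows] at h2
  have h4 : 0 ≤ (Z * (H₀ * H₀ᵀ)).trace := by
    rw [← Matrix.mul_assoc, trace_mul_comm, ← Matrix.mul_assoc]
    have := hZ.conjTranspose_mul_mul_same H₀
    rw [conjTranspose_eq_transpose_of_trivial] at this
    exact this.trace_nonneg
  have h5 : Z.trace = (Z * colProj X).trace + (Z * (H₀ * H₀ᵀ)).trace := by
    rw [h3, ← trace_add, ← Matrix.mul_add, h2, Matrix.mul_one]
  linarith

/-- The derivative at `0` of `log det (W + s)`, taken along `s = 2/(k+1)`. The factor `2` offsets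
the halves in the exponent of the density and in the Gaussian exponent. -/
theorem tendsto_sum_log_div {ℓ : Fin n → ℝ} (hℓ : ∀ i, 0 < ℓ i) :
    Filter.Tendsto (fun k : ℕ => ((k : ℝ) + 1) * ∑ i, Real.log ((ℓ i + 2 / ((k : ℝ) + 1)) / ℓ i))
      Filter.atTop (nhds (2 * ∑ i, (ℓ i)⁻¹)) := by
  have hd : HasDerivAt (fun s : ℝ => ∑ i, Real.log ((ℓ i + s) / ℓ i)) (∑ i, (ℓ i)⁻¹) 0 := by
    refine HasDerivAt.fun_sum fun i _ => ?_
    have h1 : HasDerivAt (fun s : ℝ => (ℓ i + s) / ℓ i) (1 / ℓ i) 0 :=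
      ((hasDerivAt_id (0 : ℝ)).const_add (ℓ i)).div_const (ℓ i)
    have h2 := h1.log (by simp [(hℓ i).ne'])
    simpa [(hℓ i).ne'] using h2
  have hseq : Filter.Tendsto (fun k : ℕ => 2 / ((k : ℝ) + 1)) Filter.atTop
      (nhdsWithin 0 {0}ᶜ) := by
    rw [tendsto_nhdsWithin_iff]
    refine ⟨?_, Filter.Eventually.of_forall fun k => ?_⟩
    · have := (tendsto_one_div_add_atTop_nhds_zero_nat (𝕜 := ℝ)).const_mul 2
      simpa [div_eq_mul_inv] using this
    · have : (0 : ℝ) < 2 / ((k : ℝ) + 1) := by positivity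
      exact this.ne'
  have := (hd.tendsto_slope_zero.comp hseq).const_mul 2
  refine this.congr fun k => ?_
  have hk : ((k : ℝ) + 1) ≠ 0 := by positivity
  simp only [Function.comp_apply, zero_add, add_zero, smul_eq_mul]
  have h0 : ∑ i, Real.log (ℓ i / ℓ i) = 0 :=
    Finset.sum_eq_zero fun i _ => by rw [div_self (hℓ i).ne', Real.log_one]
  rw [h0, sub_zero]
  field_simp

theorem log_det_shift {X : Fin n → EuclideanSpace ℝ (Fin p)}
    {V : Matrix (Fin n) (Fin n) ℝ} {H : Matrix (Fin p) (Fin n) ℝ} {ℓ : Fin n → ℝ}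
    (h : SingularData (dataMat X) V H ℓ) {s : ℝ} (hs : 0 ≤ s) :
    Real.log ((innerMat X + s • 1).det / (innerMat X).det) =
      ∑ i, Real.log ((ℓ i + s) / ℓ i) := by
  rw [innerMat, h.det_gram_add, h.det_gram, ← Finset.prod_div_distrib, Real.log_prod]
  intro i _
  have := h.pos i
  positivity

theorem measurable_det_shift (s : ℝ) : Measurable fun X : Fin n → EuclideanSpace ℝ (Fin p) =>
    (innerMat X + s • 1).det / (innerMat X).det :=
  ((continuous_innerMat.add continuous_const).matrix_det.measurable).div
    continuous_innerMat.matrix_det.measurable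

theorem measurable_trace_mul_colProj (Z : Matrix (Fin p) (Fin p) ℝ) :
    Measurable fun X : Fin n → EuclideanSpace ℝ (Fin p) => (Z * colProj X).trace :=
  continuous_id.matrix_trace.measurable.comp (measurable_const.matrixMul measurable_colProj)

theorem measurable_trace_innerMat_inv :
    Measurable fun X : Fin n → EuclideanSpace ℝ (Fin p) => ((innerMat X)⁻¹).trace :=
  continuous_id.matrix_trace.measurable.comp
    (measurable_matrix_inv.comp continuous_innerMat.measurable)

/-- The change of variables `S ↦ S + s P` for a weight that increases along it. -/
theorem lintegral_sampleLaw_shift_le (hnp : n < p) {Sig : Matrix (Fin p) (Fin p) ℝ}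
    (hSig : Sig.PosDef) {φ : Matrix (Fin p) (Fin p) ℝ → ENNReal} (hφ : Measurable φ)
    (hmono : ∀ X : Fin n → EuclideanSpace ℝ (Fin p), Generic X → ∀ s : ℝ, 0 ≤ s →
      φ (gramSum X) ≤ φ (gramSum X + s • colProj X)) {s : ℝ} (hs : 0 ≤ s) :
    ∫⁻ X, φ (gramSum X) * ENNReal.ofReal (Real.exp (-(s * (Sig⁻¹ * colProj X).trace) / 2) *
        ((innerMat X + s • 1).det / (innerMat X).det) ^ (((p : ℝ) - n - 1) / 2))
          ∂(sampleLaw n Sig) ≤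
      ∫⁻ X, φ (gramSum X) ∂(sampleLaw n Sig) := by
  obtain ⟨c, hc⟩ := exists_sampleLaw_eq_withDensity n hSig
  have hD : Measurable fun X : Fin n → EuclideanSpace ℝ (Fin p) =>
      ENNReal.ofReal (Real.exp (-(Sig⁻¹ * gramSum X).trace / 2)) :=
    (measurable_exp_trace_mul Sig⁻¹).comp measurable_gramSum
  have hcD := hD.const_mul c
  have hφX : Measurable fun X : Fin n → EuclideanSpace ℝ (Fin p) => φ (gramSum X) :=
    hφ.comp measurable_gramSum
  have hr : Measurable fun X : Fin n → EuclideanSpace ℝ (Fin p) =>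
      ENNReal.ofReal (Real.exp (-(s * (Sig⁻¹ * colProj X).trace) / 2) *
        ((innerMat X + s • 1).det / (innerMat X).det) ^ (((p : ℝ) - n - 1) / 2)) :=
    ((Real.measurable_exp.comp
      ((((measurable_trace_mul_colProj Sig⁻¹).const_mul s).neg).div_const 2)).mul
        ((measurable_det_shift s).pow_const _)).ennreal_ofReal
  have hφr := hφX.mul hr
  simp only [Pi.mul_def] at hφr
  have hΦm := hφ.mul (measurable_exp_trace_mul Sig⁻¹)
  simp only [Pi.mul_def] at hΦm
  have hΦs : Measurable fun X : Fin n → EuclideanSpace ℝ (Fin p) =>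
      φ (gramSum X + s • colProj X) *
        ENNReal.ofReal (Real.exp (-(Sig⁻¹ * (gramSum X + s • colProj X)).trace / 2)) *
        ENNReal.ofReal
          (((innerMat X + s • 1).det / (innerMat X).det) ^ (((p : ℝ) - n - 1) / 2)) :=
    (hΦm.comp (measurable_gramSum.matrixAddSMul measurable_colProj measurable_const)).mul
      ((measurable_det_shift s).pow_const _).ennreal_ofReal
  rw [hc, lintegral_withDensity_eq_lintegral_mul _ hcD hφr,
    lintegral_withDensity_eq_lintegral_mul _ hcD hφX]
  -- The shift is applied to `φ` times the Gaussian factor. Shifting the latter splits off `exp(-s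
  -- tr(Σ⁻¹P)/2)`, and monotonicity lets `φ` be evaluated at the unshifted `S`.
  have key := lintegral_shift_le (n := n) hnp hΦm hs
  simp only [Pi.mul_apply] at key ⊢
  calc _ ≤ ∫⁻ X : Fin n → EuclideanSpace ℝ (Fin p), c * (φ (gramSum X + s • colProj X) *
        ENNReal.ofReal (Real.exp (-(Sig⁻¹ * (gramSum X + s • colProj X)).trace / 2)) *
        ENNReal.ofReal
          (((innerMat X + s • 1).det / (innerMat X).det) ^ (((p : ℝ) - n - 1) / 2))) := by
        refine lintegral_mono_ae ?_
        filter_upwards [ae_posDef_innerMat hnp, ae_det_krylov_innerMat hnp] with X h1 h2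
        have h3 := hmono X ⟨h1, h2⟩ s hs
        have h4 : ENNReal.ofReal (Real.exp (-(Sig⁻¹ * (gramSum X + s • colProj X)).trace / 2)) =
            ENNReal.ofReal (Real.exp (-(Sig⁻¹ * gramSum X).trace / 2)) *
            ENNReal.ofReal (Real.exp (-(s * (Sig⁻¹ * colProj X).trace) / 2)) := by
          rw [← ENNReal.ofReal_mul (Real.exp_pos _).le, ← Real.exp_add, Matrix.mul_add,
            Matrix.mul_smul, trace_add, trace_smul, smul_eq_mul]
          congr 2; ring
        rw [h4, ENNReal.ofReal_mul (Real.exp_pos _).le]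
        calc _ = c * (φ (gramSum X) * (ENNReal.ofReal (Real.exp (-(Sig⁻¹ * gramSum X).trace / 2)) *
            ENNReal.ofReal (Real.exp (-(s * (Sig⁻¹ * colProj X).trace) / 2))) *
            ENNReal.ofReal
              (((innerMat X + s • 1).det / (innerMat X).det) ^ (((p : ℝ) - n - 1) / 2))) := by ring
          _ ≤ _ := by gcongr
    _ ≤ c * ∫⁻ X : Fin n → EuclideanSpace ℝ (Fin p), φ (gramSum X) *
        ENNReal.ofReal (Real.exp (-(Sig⁻¹ * gramSum X).trace / 2)) := by
        rw [lintegral_const_mul _ hΦs]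
        exact mul_le_mul_right key c
    _ = _ := by
        have hφD := hφX.mul hD
        simp only [Pi.mul_def] at hφD
        rw [← lintegral_const_mul _ hφD]
        exact lintegral_congr fun X => by ring

/-- The integrated form of the divergence inequality for the field `X (XᵗX)⁻¹` and a weight that
increases along it. -/
theorem lintegral_trace_inv_le (hnp : n < p) {Sig : Matrix (Fin p) (Fin p) ℝ}
    (hSig : Sig.PosDef) {φ : Matrix (Fin p) (Fin p) ℝ → ENNReal} (hφ : Measurable φ)
    (hmono : ∀ X : Fin n → EuclideanSpace ℝ (Fin p), Generic X → ∀ s : ℝ, 0 ≤ s →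
      φ (gramSum X) ≤ φ (gramSum X + s • colProj X))
    (hfin : ∫⁻ X, φ (gramSum X) ∂(sampleLaw n Sig) ≠ ⊤) :
    ∫⁻ X, φ (gramSum X) * ENNReal.ofReal (((p : ℝ) - n - 1) * ((innerMat X)⁻¹).trace)
        ∂(sampleLaw n Sig) ≤
      ∫⁻ X, φ (gramSum X) * ENNReal.ofReal (Sig⁻¹ * colProj X).trace ∂(sampleLaw n Sig) := by
  set μ := sampleLaw n Sig
  set a := ((p : ℝ) - n - 1) / 2 with ha
  have ha0 : 0 ≤ a := by
    have : (n : ℝ) + 1 ≤ p := by exact_mod_cast hnp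
    rw [ha]; linarith
  have hφX : Measurable fun X : Fin n → EuclideanSpace ℝ (Fin p) => φ (gramSum X) :=
    hφ.comp measurable_gramSum
  have ht := measurable_trace_mul_colProj (n := n) Sig⁻¹
  have hqm : ∀ s : ℝ, Measurable fun X : Fin n → EuclideanSpace ℝ (Fin p) =>
      ENNReal.ofReal (a * Real.log ((innerMat X + s • 1).det / (innerMat X).det)) := fun s =>
    (((measurable_det_shift s).log).const_mul a).ennreal_ofReal
  have step : ∀ s : ℝ, 0 ≤ s →
      ∫⁻ X, φ (gramSum X) *
        ENNReal.ofReal (a * Real.log ((innerMat X + s • 1).det / (innerMat X).det)) ∂μ ≤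
      ENNReal.ofReal (s / 2) * ∫⁻ X, φ (gramSum X) *
        ENNReal.ofReal (Sig⁻¹ * colProj X).trace ∂μ := by
    intro s hs
    have h1 := lintegral_sampleLaw_shift_le hnp hSig hφ hmono hs
    rw [← ha] at h1
    have hft : Measurable fun X : Fin n → EuclideanSpace ℝ (Fin p) =>
        φ (gramSum X) * ENNReal.ofReal (Sig⁻¹ * colProj X).trace := hφX.mul ht.ennreal_ofReal
    have hfq : Measurable fun X : Fin n → EuclideanSpace ℝ (Fin p) => φ (gramSum X) *
        ENNReal.ofReal (a * Real.log ((innerMat X + s • 1).det / (innerMat X).det)) :=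
      hφX.mul (hqm s)
    -- The finite integral of `φ` is added to both sides, to avoid subtraction in the extended
    -- nonnegative reals.
    rw [← ENNReal.add_le_add_iff_left hfin, ← lintegral_const_mul _ hft,
      ← lintegral_add_left hφX]
    refine le_trans ?_ (add_le_add_left h1 _)
    rw [← lintegral_add_right _ (hft.const_mul _)]
    refine lintegral_mono_ae ?_
    filter_upwards [ae_generic hnp hSig] with X hX
    obtain ⟨V, H, H₀, ℓ, h, -⟩ := hX.exists_isSpectralDecomp
    have hW := hX.1.det_pos
    have hWs : 0 < (innerMat X + s • 1).det :=
      (hX.1.add_posSemidef (PosSemidef.one.smul hs)).det_pos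
    have htn : 0 ≤ (Sig⁻¹ * colProj X).trace :=
      trace_mul_colProj_nonneg hSig.inv.posSemidef hX.1
    have hr := div_pos hWs hW
    have hlog : 0 ≤ Real.log ((innerMat X + s • 1).det / (innerMat X).det) := by
      rw [log_det_shift h hs]
      refine Finset.sum_nonneg fun i _ => Real.log_nonneg ?_
      rw [one_le_div (h.pos i)]; linarith
    generalize (innerMat X + s • 1).det / (innerMat X).det = ρ at *
    generalize (Sig⁻¹ * colProj X).trace = t at *
    -- This is `1 + y ≤ exp y` at `y = a log ρ - s t / 2`, which linearises the weight before any
    -- limit is taken.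
    have key : 1 + a * Real.log ρ ≤ Real.exp (-(s * t) / 2) * ρ ^ a + s / 2 * t := by
      rw [Real.rpow_def_of_pos hr, ← Real.exp_add]
      have := Real.add_one_le_exp (-(s * t) / 2 + Real.log ρ * a)
      linarith
    calc φ (gramSum X) + φ (gramSum X) * ENNReal.ofReal (a * Real.log ρ)
        = φ (gramSum X) * ENNReal.ofReal (1 + a * Real.log ρ) := by
          rw [ENNReal.ofReal_add zero_le_one (by positivity), ENNReal.ofReal_one, mul_add, mul_one]
      _ ≤ φ (gramSum X) * ENNReal.ofReal (Real.exp (-(s * t) / 2) * ρ ^ a + s / 2 * t) := by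
          gcongr
      _ = _ := by
          rw [ENNReal.ofReal_add (by positivity) (by positivity),
            ENNReal.ofReal_mul (p := s / 2) (by positivity)]
          ring
  set B := ∫⁻ X, φ (gramSum X) * ENNReal.ofReal (Sig⁻¹ * colProj X).trace ∂μ with hB
  have hbound : ∀ k : ℕ, ∫⁻ X, φ (gramSum X) * ENNReal.ofReal (a * (((k : ℝ) + 1) *
      Real.log ((innerMat X + (2 / ((k : ℝ) + 1)) • 1).det / (innerMat X).det))) ∂μ ≤ B := by
    intro k
    have hk : (0 : ℝ) < (k : ℝ) + 1 := by positivity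
    have h2 := step (2 / ((k : ℝ) + 1)) (by positivity)
    have hfq : Measurable fun X : Fin n → EuclideanSpace ℝ (Fin p) => φ (gramSum X) *
        ENNReal.ofReal (a * Real.log ((innerMat X + (2 / ((k : ℝ) + 1)) • 1).det /
          (innerMat X).det)) := hφX.mul (hqm _)
    calc _ = ENNReal.ofReal ((k : ℝ) + 1) * ∫⁻ X, φ (gramSum X) * ENNReal.ofReal (a *
          Real.log ((innerMat X + (2 / ((k : ℝ) + 1)) • 1).det / (innerMat X).det)) ∂μ := by
          rw [← lintegral_const_mul _ hfq]
          refine lintegral_congr fun X => ?_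
          rw [mul_left_comm a, ENNReal.ofReal_mul hk.le]
          ring
      _ ≤ ENNReal.ofReal ((k : ℝ) + 1) * (ENNReal.ofReal (2 / ((k : ℝ) + 1) / 2) * B) :=
          mul_le_mul_right h2 _
      _ = B := by
          rw [← mul_assoc, ← ENNReal.ofReal_mul hk.le]
          have : ((k : ℝ) + 1) * (2 / ((k : ℝ) + 1) / 2) = 1 := by field_simp
          rw [this, ENNReal.ofReal_one, one_mul]
  have hmeas : ∀ k : ℕ, Measurable fun X : Fin n → EuclideanSpace ℝ (Fin p) =>
      φ (gramSum X) * ENNReal.ofReal (a * (((k : ℝ) + 1) *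
      Real.log ((innerMat X + (2 / ((k : ℝ) + 1)) • 1).det / (innerMat X).det))) := fun k =>
    hφX.mul ((((measurable_det_shift _).log).const_mul _).const_mul a).ennreal_ofReal
  -- Fatou's lemma, for `s = 2/(k+1) → 0`; the bound `B` does not depend on `k`.
  refine le_trans ?_ ((lintegral_liminf_le (u := Filter.atTop) hmeas).trans
    ((Filter.liminf_le_liminf (Filter.Eventually.of_forall hbound)).trans
      (Filter.liminf_const B).le))
  refine lintegral_mono_ae ?_
  filter_upwards [ae_generic hnp hSig, ae_lt_top hφX hfin] with X hX hφtop
  obtain ⟨V, H, H₀, ℓ, h, -⟩ := hX.exists_isSpectralDecomp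
  have hlim : Filter.Tendsto (fun k : ℕ => φ (gramSum X) * ENNReal.ofReal (a * (((k : ℝ) + 1) *
      Real.log ((innerMat X + (2 / ((k : ℝ) + 1)) • 1).det / (innerMat X).det)))) Filter.atTop
      (nhds (φ (gramSum X) *
        ENNReal.ofReal (((p : ℝ) - n - 1) * ((innerMat X)⁻¹).trace))) := by
    refine ENNReal.Tendsto.const_mul (ENNReal.tendsto_ofReal ?_) (Or.inr hφtop.ne)
    have h1 := (tendsto_sum_log_div h.pos).const_mul a
    have h2 : ((p : ℝ) - n - 1) * ((innerMat X)⁻¹).trace = a * (2 * ∑ i, (ℓ i)⁻¹) := by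
      rw [innerMat, h.trace_gram_inv, ha]; ring
    rw [h2]
    refine h1.congr fun k => ?_
    rw [log_det_shift h (by positivity)]
  rw [hlim.liminf_eq]

/-! ### Moments -/

theorem integrable_trace_innerMat (n : ℕ) (Sig : Matrix (Fin p) (Fin p) ℝ) :
    Integrable (fun X : Fin n → EuclideanSpace ℝ (Fin p) => (innerMat X).trace)
      (sampleLaw n Sig) := by
  simp only [trace_innerMat]
  refine integrable_finsetSum _ fun i _ => ?_
  have h1 : Integrable (fun x : EuclideanSpace ℝ (Fin p) => ‖x‖ ^ 2)
      (multivariateGaussian 0 Sig) :=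
    (IsGaussian.memLp_two_id (μ := multivariateGaussian (0 : EuclideanSpace ℝ (Fin p))
      Sig)).integrable_norm_pow two_ne_zero
  exact (measurePreserving_eval (fun _ : Fin n => multivariateGaussian
    (0 : EuclideanSpace ℝ (Fin p)) Sig) i).integrable_comp_of_integrable h1

/-- The divergence inequality with constant weight and `tr(Σ⁻¹P) ≤ tr Σ⁻¹` bound `(p-n-1) E[tr
W⁻¹]`; the coefficient is positive because `n + 1 < p`. -/
theorem integrable_trace_innerMat_inv (hnp : n + 1 < p) {Sig : Matrix (Fin p) (Fin p) ℝ}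
    (hSig : Sig.PosDef) :
    Integrable (fun X : Fin n → EuclideanSpace ℝ (Fin p) => ((innerMat X)⁻¹).trace)
      (sampleLaw n Sig) := by
  have hnp' : n < p := by omega
  have hpos : (0 : ℝ) < (p : ℝ) - n - 1 := by
    have : (n : ℝ) + 1 < p := by exact_mod_cast hnp
    linarith
  have key := lintegral_trace_inv_le hnp' hSig (φ := fun _ => 1) measurable_const
    (fun _ _ _ _ => le_rfl) (by simp)
  simp only [one_mul] at key
  have hle : ∫⁻ X, ENNReal.ofReal (Sig⁻¹ * colProj X).trace ∂(sampleLaw n Sig) ≤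
      ENNReal.ofReal Sig⁻¹.trace := by
    calc _ ≤ ∫⁻ _X, ENNReal.ofReal Sig⁻¹.trace ∂(sampleLaw n Sig) := by
          refine lintegral_mono_ae ?_
          filter_upwards [ae_generic hnp' hSig] with X hX
          exact ENNReal.ofReal_le_ofReal (trace_mul_colProj_le hSig.inv.posSemidef hX.1)
      _ = _ := by simp
  have hint : Integrable (fun X : Fin n → EuclideanSpace ℝ (Fin p) =>
      ((p : ℝ) - n - 1) * ((innerMat X)⁻¹).trace) (sampleLaw n Sig) := by
    refine (lintegral_ofReal_ne_top_iff_integrable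
      (measurable_trace_innerMat_inv.const_mul _).aestronglyMeasurable ?_).1
      (ne_top_of_le_ne_top ENNReal.ofReal_ne_top (key.trans hle))
    filter_upwards [ae_generic hnp' hSig] with X hX
    exact mul_nonneg hpos.le hX.1.inv.posSemidef.trace_nonneg
  exact (integrable_const_mul_iff hpos.ne'.isUnit _).1 hint

/-! ### The scalar inequality -/

/-- The right side is the `[2/1]` Padé approximant of `log(1+x)`. The difference vanishes at `0` and
has derivative `4x³ / ((6+4x)²(1+x))`. -/
theorem log_one_add_lt {x : ℝ} (hx : 0 < x) : Real.log (1 + x) < x * (6 + x) / (6 + 4 * x) := by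
  let f : ℝ → ℝ := fun x => x * (6 + x) / (6 + 4 * x) - Real.log (1 + x)
  have hder : ∀ y : ℝ, 0 ≤ y → HasDerivAt f
      (4 * y ^ 3 / ((6 + 4 * y) ^ 2 * (1 + y))) y := by
    intro y hy
    have h1 : HasDerivAt (fun x : ℝ => x * (6 + x)) (1 * (6 + y) + y * 1) y :=
      (hasDerivAt_id y).mul ((hasDerivAt_id y).const_add 6)
    have h2 : HasDerivAt (fun x : ℝ => 6 + 4 * x) (4 * 1) y :=
      ((hasDerivAt_id y).const_mul 4).const_add 6
    have h3 : HasDerivAt (fun x : ℝ => Real.log (1 + x)) (1 / (1 + y)) y :=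
      ((hasDerivAt_id y).const_add 1).log (by simp; positivity)
    have h4 := (h1.div h2 (by positivity)).sub h3
    refine h4.congr_deriv ?_
    have : 6 + 4 * y ≠ 0 := by positivity
    have : 1 + y ≠ 0 := by positivity
    field_simp
    ring
  have hmono : StrictMonoOn f (Set.Ici 0) := by
    refine strictMonoOn_of_deriv_pos (convex_Ici 0)
      (fun y hy => (hder y hy).continuousAt.continuousWithinAt) fun y hy => ?_
    rw [interior_Ici] at hy
    have hy' : 0 < y := hy
    rw [(hder y hy'.le).deriv]
    positivity
  have := hmono (Set.self_mem_Ici) (Set.mem_Ici.2 hx.le) hx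
  simp only [f] at this
  norm_num at this
  linarith

/-- The pointwise inequality behind the domination. -/
theorem sum_log_lt {c m q : ℝ} (hn : 0 < n) (hq : 0 ≤ q) (hc : 0 < c)
    (hcm : q * (c * (6 + c) / (6 + 4 * c)) ≤ m * c) {x : Fin n → ℝ}
    (hx : ∀ i, 0 ≤ x i) (hsum : c * n / (1 + c) ≤ ∑ i, x i / (1 + x i)) (hq0 : 0 < q) :
    q * ∑ i, Real.log (1 + x i) < m * ∑ i, x i := by
  have h1c : 0 < 1 + c := by linarith
  have hlogc := log_one_add_lt hc
  have hJ : n * c ≤ ∑ i, x i := by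
    -- The tangent line of the convex function `u ↦ u/(1-u)` at `u = c/(1+c)`, evaluated at `u =
    -- xᵢ/(1+xᵢ)`.
    have h1 : ∀ i ∈ Finset.univ, c + (1 + c) ^ 2 * (x i / (1 + x i) - c / (1 + c)) ≤ x i := by
      intro i _
      have hi := hx i
      have : 0 < 1 + x i := by linarith
      have h2 : x i - (c + (1 + c) ^ 2 * (x i / (1 + x i) - c / (1 + c))) =
          (x i - c) ^ 2 / (1 + x i) := by
        field_simp
        ring
      have h3 : 0 ≤ (x i - c) ^ 2 / (1 + x i) := by positivity
      linarith
    have h2 := Finset.sum_le_sum h1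
    rw [Finset.sum_add_distrib, ← Finset.mul_sum, Finset.sum_sub_distrib] at h2
    simp only [Finset.sum_const, Finset.card_univ, Fintype.card_fin, nsmul_eq_mul] at h2
    have h3 : 0 ≤ (1 + c) ^ 2 * (∑ i, x i / (1 + x i) - n * (c / (1 + c))) := by
      refine mul_nonneg (by positivity) ?_
      rw [mul_div_assoc'] ; rw [mul_comm] at hsum; linarith
    linarith
  have hlog : ∑ i, Real.log (1 + x i) ≤
      n * Real.log (1 + c) + (∑ i, x i - n * c) / (1 + c) := by
    -- The tangent line of the concave function `x ↦ log(1+x)` at `c`.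
    have h1 : ∀ i ∈ Finset.univ,
        Real.log (1 + x i) ≤ Real.log (1 + c) + (x i - c) / (1 + c) := by
      intro i _
      have hi := hx i
      have h2 : 0 < 1 + x i := by linarith
      have h3 := Real.log_le_sub_one_of_pos (div_pos h2 h1c)
      rw [Real.log_div h2.ne' h1c.ne'] at h3
      have h4 : (1 + x i) / (1 + c) - 1 = (x i - c) / (1 + c) := by field_simp; ring
      linarith
    have h2 := Finset.sum_le_sum h1
    rw [Finset.sum_add_distrib, ← Finset.sum_div, Finset.sum_sub_distrib] at h2
    simpa using h2
  have hg : q * Real.log (1 + c) < m * c :=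
    (mul_lt_mul_of_pos_left hlogc hq0).trans_le hcm
  -- Beyond `∑ xᵢ = n c` the tangent bound must not outgrow `m ∑ xᵢ`; the slope condition follows
  -- from the inequality at `c`, since `c/(1+c) ≤ log(1+c)`.
  have hslope : q / (1 + c) ≤ m := by
    have h1 : c / (1 + c) ≤ Real.log (1 + c) := by
      have := Real.one_sub_inv_le_log_of_pos h1c
      have h2 : c / (1 + c) = 1 - (1 + c)⁻¹ := by field_simp; ring
      linarith
    have h2 : q / (1 + c) * c ≤ m * c := by
      calc q / (1 + c) * c = q * (c / (1 + c)) := by ring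
        _ ≤ q * Real.log (1 + c) := mul_le_mul_of_nonneg_left h1 hq
        _ ≤ m * c := hg.le
    exact le_of_mul_le_mul_right h2 hc
  have hnR : (0 : ℝ) < n := by exact_mod_cast hn
  calc q * ∑ i, Real.log (1 + x i)
      ≤ q * (n * Real.log (1 + c) + (∑ i, x i - n * c) / (1 + c)) :=
        mul_le_mul_of_nonneg_left hlog hq
    _ = n * (q * Real.log (1 + c)) + q / (1 + c) * (∑ i, x i - n * c) := by ring
    _ < n * (m * c) + m * (∑ i, x i - n * c) := by
        refine add_lt_add_of_lt_of_le (mul_lt_mul_of_pos_left hg hnR) ?_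
        exact mul_le_mul_of_nonneg_right hslope (by linarith)
    _ = _ := by ring

/-! ### The root as a function of the sample covariance -/

theorem sum_div_add_lt {ℓ : Fin n → ℝ} (hℓ : ∀ i, 0 < ℓ i) (hn : 0 < n) {a c : ℝ} (ha : 0 ≤ a)
    (hac : a < c) : ∑ j, a / (ℓ j + a) < ∑ j, c / (ℓ j + c) := by
  have : Nonempty (Fin n) := ⟨⟨0, hn⟩⟩
  refine Finset.sum_lt_sum_of_nonempty Finset.univ_nonempty fun j _ => ?_
  have hj := hℓ j
  rw [div_lt_div_iff₀ (by positivity) (by linarith)]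
  nlinarith [mul_pos hj (sub_pos.2 hac)]

theorem lamHat_le_iff {ℓ : Fin n → ℝ} (hℓ : ∀ i, 0 < ℓ i) {β : ℝ} (h0 : 0 ≤ β) (hβ : β < n)
    {q : ℝ} (hq : 0 ≤ q) : lamHat ℓ β ≤ q ↔ β ≤ ∑ j, q / (ℓ j + q) := by
  have hn : 0 < n := by exact_mod_cast h0.trans_lt hβ
  obtain ⟨h1, h2⟩ := lamHat_spec hℓ h0 hβ
  constructor
  · intro h
    rcases h.eq_or_lt with h | h
    · rw [← h, h2]
    · exact h2.symm.le.trans (sum_div_add_lt hℓ hn h1 h).le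
  · intro h
    by_contra! h3
    have := sum_div_add_lt hℓ hn hq h3
    linarith

theorem lamHat_pos {ℓ : Fin n → ℝ} (hℓ : ∀ i, 0 < ℓ i) {β : ℝ} (h0 : 0 < β) (hβ : β < n) :
    0 < lamHat ℓ β := by
  obtain ⟨h1, h2⟩ := lamHat_spec hℓ h0.le hβ
  refine h1.lt_of_ne fun h => ?_
  rw [← h] at h2
  simp at h2
  linarith

/-- Replacing every `ℓⱼ` by the sum of all of them lowers the defining sum and leaves an inequality
that can be solved for the root. Here `C < n` is essential. -/
theorem lamHat_le {ℓ : Fin n → ℝ} (hℓ : ∀ i, 0 < ℓ i) {β C : ℝ} (h0 : 0 < β) (hβ : β ≤ C)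
    (hC : C < n) : lamHat ℓ β ≤ C / (n - C) * ∑ i, ℓ i := by
  have hp := lamHat_pos hℓ h0 (hβ.trans_lt hC)
  have h2 := (lamHat_spec hℓ h0.le (hβ.trans_lt hC)).2
  set r := lamHat ℓ β
  have hle : ∀ j, ℓ j ≤ ∑ i, ℓ i := fun j =>
    Finset.single_le_sum (fun i _ => (hℓ i).le) (Finset.mem_univ j)
  have hs : 0 ≤ ∑ i, ℓ i := Finset.sum_nonneg fun i _ => (hℓ i).le
  have h3 : n * (r / (∑ i, ℓ i + r)) ≤ C := by
    calc n * (r / (∑ i, ℓ i + r)) = ∑ _j : Fin n, r / (∑ i, ℓ i + r) := by simp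
      _ ≤ ∑ j, r / (ℓ j + r) := by
        refine Finset.sum_le_sum fun j _ => ?_
        have := hℓ j
        have := hle j
        gcongr
      _ ≤ C := h2.le.trans hβ
  rw [mul_div_assoc', div_le_iff₀ (by positivity)] at h3
  rw [div_mul_eq_mul_div, le_div_iff₀ (by linarith)]
  linarith

/-- From `r/(ℓ+r) ≤ r/ℓ` summed over the eigenvalues; the factor `n ≥ 1` is slack. -/
theorem inv_lamHat_le {ℓ : Fin n → ℝ} (hℓ : ∀ i, 0 < ℓ i) {β β₀ : ℝ} (h0 : 0 < β₀)
    (hβ : β₀ ≤ β) (hn : β < n) : (lamHat ℓ β)⁻¹ ≤ n / β₀ * ∑ i, (ℓ i)⁻¹ := by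
  have hp := lamHat_pos hℓ (h0.trans_le hβ) hn
  have h2 := (lamHat_spec hℓ (h0.trans_le hβ).le hn).2
  set r := lamHat ℓ β
  have hnR : (1 : ℝ) ≤ n := by
    have : (0 : ℝ) < n := (h0.trans_le hβ).trans hn
    exact_mod_cast (by exact_mod_cast this : 0 < n)
  have hs : 0 ≤ ∑ i, (ℓ i)⁻¹ := Finset.sum_nonneg fun i _ => (inv_pos.2 (hℓ i)).le
  have h3 : β₀ ≤ r * ∑ i, (ℓ i)⁻¹ := by
    calc β₀ ≤ ∑ j, r / (ℓ j + r) := hβ.trans h2.symm.le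
      _ ≤ ∑ j, r * (ℓ j)⁻¹ := by
        refine Finset.sum_le_sum fun j _ => ?_
        rw [← div_eq_mul_inv]
        have := hℓ j
        gcongr
        linarith
      _ = _ := by rw [Finset.mul_sum]
  have h4 : r⁻¹ ≤ (∑ i, (ℓ i)⁻¹) / β₀ := by
    rw [le_div_iff₀ h0, inv_mul_le_iff₀ hp]
    exact h3
  refine h4.trans ?_
  rw [div_mul_eq_mul_div]
  gcongr
  exact le_mul_of_one_le_left hs hnR

/-- The vector `f` followed by the constant `g` on the remaining `p - n` positions. -/
def extendConst (p : ℕ) (f : Fin n → ℝ) (g : ℝ) : Fin n ⊕ Fin (p - n) → ℝ :=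
  Sum.elim f fun _ => g

theorem fromCols_mul_diagonal_mul_transpose (H : Matrix (Fin p) (Fin n) ℝ)
    (H₀ : Matrix (Fin p) (Fin (p - n)) ℝ) (f : Fin n → ℝ) (g : ℝ) :
    fromCols H H₀ * diagonal (extendConst p f g) * (fromCols H H₀)ᵀ =
      H * diagonal f * Hᵀ + g • (H₀ * H₀ᵀ) := by
  rw [extendConst, ← fromBlocks_diagonal, fromCols_mul_fromBlocks, transpose_fromCols,
    fromCols_mul_fromRows]
  simp only [Matrix.mul_zero, add_zero, zero_add]
  congr 1
  rw [← smul_one_eq_diagonal]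
  simp

/-! ### Determinants and resolvent of the full-rank modifications of `S` -/

namespace IsSpectralDecomp

variable {S : Matrix (Fin p) (Fin p) ℝ} {H : Matrix (Fin p) (Fin n) ℝ}
  {H₀ : Matrix (Fin p) (Fin (p - n)) ℝ} {ℓ : Fin n → ℝ}

theorem add_smul_one (h : IsSpectralDecomp S H H₀ ℓ) (s : ℝ) :
    S + s • (1 : Matrix (Fin p) (Fin p) ℝ) =
      fromCols H H₀ * diagonal (extendConst p (fun i => ℓ i + s) s) * (fromCols H H₀)ᵀ := by
  have h1 : diagonal (fun i => ℓ i + s) = diagonal ℓ + s • (1 : Matrix (Fin n) (Fin n) ℝ) := by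
    rw [smul_one_eq_diagonal, diagonal_add]
  rw [fromCols_mul_diagonal_mul_transpose, ← h.sum_proj, h1, h.eq, Matrix.mul_add,
    Matrix.add_mul, smul_add]
  simp [add_assoc]

theorem add_smul_kernel_proj (h : IsSpectralDecomp S H H₀ ℓ) (s : ℝ) :
    S + s • (H₀ * H₀ᵀ) =
      fromCols H H₀ * diagonal (extendConst p ℓ s) * (fromCols H H₀)ᵀ := by
  rw [fromCols_mul_diagonal_mul_transpose, ← h.eq]

theorem det_add_smul_one (h : IsSpectralDecomp S H H₀ ℓ) (s : ℝ) :
    (S + s • (1 : Matrix (Fin p) (Fin p) ℝ)).det = (∏ i, (ℓ i + s)) * s ^ (p - n) := by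
  rw [h.add_smul_one, det_conj_of_mul_eq_one h.mul_transpose h.transpose_mul, det_diagonal]
  simp [extendConst]

theorem det_add_smul_kernel_proj (h : IsSpectralDecomp S H H₀ ℓ) (s : ℝ) :
    (S + s • (H₀ * H₀ᵀ)).det = (∏ i, ℓ i) * s ^ (p - n) := by
  rw [h.add_smul_kernel_proj, det_conj_of_mul_eq_one h.mul_transpose h.transpose_mul,
    det_diagonal]
  simp [extendConst]

/-- Each kernel direction contributes `q · q⁻¹ = 1`. The defining sum of the root is thus a function
of `S` that needs no choice of eigenvalues, which is what makes the root measurable. -/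
theorem mul_trace_resolvent (h : IsSpectralDecomp S H H₀ ℓ) {q : ℝ} (hq : 0 < q) :
    q * ((S + q • (1 : Matrix (Fin p) (Fin p) ℝ))⁻¹).trace =
      ∑ i, q / (ℓ i + q) + ((p : ℝ) - n) := by
  set U := fromCols H H₀ with hU
  have h1 : (S + q • (1 : Matrix (Fin p) (Fin p) ℝ))⁻¹ =
      U * diagonal (extendConst p (fun i => (ℓ i + q)⁻¹) q⁻¹) * Uᵀ := by
    refine inv_eq_right_inv ?_
    rw [h.add_smul_one, ← hU]
    calc _ = U * (diagonal (extendConst p (fun i => ℓ i + q) q) * (Uᵀ * U) *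
          diagonal (extendConst p (fun i => (ℓ i + q)⁻¹) q⁻¹)) * Uᵀ := by
          simp only [Matrix.mul_assoc]
      _ = 1 := by
          rw [h.transpose_mul, Matrix.mul_one, diagonal_mul_diagonal, ← h.mul_transpose]
          have : (fun i : Fin n ⊕ Fin (p - n) => extendConst p (fun i => ℓ i + q) q i *
              extendConst p (fun i => (ℓ i + q)⁻¹) q⁻¹ i) = fun _ => 1 := by
            funext i
            rcases i with i | i
            · have := h.pos i
              simp only [extendConst, Sum.elim_inl]
              field_simp
            · simp [extendConst, hq.ne']
          rw [this, diagonal_one, Matrix.mul_one]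
  rw [h1, trace_mul_comm, ← Matrix.mul_assoc, h.transpose_mul, Matrix.one_mul, trace_diagonal,
    Fintype.sum_sum_type, mul_add, Finset.mul_sum]
  have := h.le
  simp [extendConst, div_eq_mul_inv, Nat.cast_sub this]
  field_simp

end IsSpectralDecomp

/-- A measurable function of `S` that equals `lamHat ℓ (b S)` when `S` has a spectral decomposition
with eigenvalues `ℓ`. -/
noncomputable def rootWeight (n : ℕ) (b : Matrix (Fin p) (Fin p) ℝ → ℝ)
    (S : Matrix (Fin p) (Fin p) ℝ) : ENNReal :=
  ⨅ q : {q : ℚ // 0 < q}, if b S + ((p : ℝ) - n) ≤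
    (q : ℝ) * ((S + (q : ℝ) • (1 : Matrix (Fin p) (Fin p) ℝ))⁻¹).trace
    then ENNReal.ofReal q else ⊤

theorem measurable_trace {m : ℕ} : Measurable (trace : Matrix (Fin m) (Fin m) ℝ → ℝ) :=
  Continuous.measurable (continuous_id.matrix_trace)

theorem measurable_rootWeight {b : Matrix (Fin p) (Fin p) ℝ → ℝ} (hb : Measurable b) :
    Measurable (rootWeight n b) := by
  refine Measurable.iInf fun q => Measurable.ite ?_ measurable_const measurable_const
  refine measurableSet_le (hb.add_const _) (Measurable.const_mul ?_ _)
  exact measurable_trace.comp (measurable_matrix_inv.comp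
    ((continuous_id.add continuous_const).measurable))

/-- The condition inside the infimum says that the root is at most `q`, because the defining sum
increases with `q`; positive rationals approximate the root from above. -/
theorem rootWeight_eq {b : Matrix (Fin p) (Fin p) ℝ → ℝ} {S : Matrix (Fin p) (Fin p) ℝ}
    {H : Matrix (Fin p) (Fin n) ℝ} {H₀ : Matrix (Fin p) (Fin (p - n)) ℝ} {ℓ : Fin n → ℝ}
    (h : IsSpectralDecomp S H H₀ ℓ) (h0 : 0 ≤ b S) (hn : b S < n) :
    rootWeight n b S = ENNReal.ofReal (lamHat ℓ (b S)) := by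
  have key : ∀ q : {q : ℚ // 0 < q}, (b S + ((p : ℝ) - n) ≤
      (q : ℝ) * ((S + (q : ℝ) • (1 : Matrix (Fin p) (Fin p) ℝ))⁻¹).trace) ↔
      lamHat ℓ (b S) ≤ (q : ℝ) := by
    intro q
    have hq : (0 : ℝ) < (q : ℝ) := by exact_mod_cast q.2
    rw [h.mul_trace_resolvent hq, lamHat_le_iff h.pos h0 hn hq.le, add_le_add_iff_right]
  simp only [rootWeight, key]
  refine le_antisymm (ENNReal.le_of_forall_pos_le_add fun ε hε _ => ?_)
    (le_iInf fun q => ?_)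
  · have h1 := (lamHat_spec h.pos h0 hn).1
    obtain ⟨q, hq1, hq2⟩ := exists_rat_btwn
      (show lamHat ℓ (b S) < lamHat ℓ (b S) + ε by simpa using hε)
    have hq0 : 0 < q := by exact_mod_cast h1.trans_lt hq1
    refine (iInf_le _ (⟨q, hq0⟩ : {q : ℚ // 0 < q})).trans ?_
    rw [if_pos hq1.le, ← ENNReal.ofReal_coe_nnreal, ← ENNReal.ofReal_add h1 ε.coe_nonneg]
    exact ENNReal.ofReal_le_ofReal hq2.le
  · split_ifs with hq
    · exact ENNReal.ofReal_le_ofReal hq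
    · exact le_top

/-- The assumptions on `b`, with general bounds. -/
structure Admissible (n : ℕ) (b : Matrix (Fin p) (Fin p) ℝ → ℝ) (β₀ C : ℝ) : Prop where
  measurable : Measurable b
  pos : 0 < β₀
  lt : C < n
  lower : ∀ S H H₀ ℓ, IsSpectralDecomp (n := n) S H H₀ ℓ → β₀ ≤ b S
  upper : ∀ S H H₀ ℓ, IsSpectralDecomp (n := n) S H H₀ ℓ → b S ≤ C
  diff : ∀ S H H₀ ℓ, IsSpectralDecomp (n := n) S H H₀ ℓ → DifferentiableAt ℝ (eigFun b H) ℓ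
  sum : ∀ S H H₀ ℓ, IsSpectralDecomp (n := n) S H H₀ ℓ → 0 ≤ ∑ i, eigPartial b H ℓ i

/-- The chain rule along the direction `(1, …, 1)`. -/
theorem hasDerivAt_eigFun_shift {b : Matrix (Fin p) (Fin p) ℝ → ℝ}
    {H : Matrix (Fin p) (Fin n) ℝ} {ℓ : Fin n → ℝ} {s : ℝ}
    (hd : DifferentiableAt ℝ (eigFun b H) fun i => ℓ i + s) :
    HasDerivAt (fun s : ℝ => eigFun b H fun i => ℓ i + s)
      (∑ i, eigPartial b H (fun i => ℓ i + s) i) s := by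
  have h1 : HasDerivAt (fun s : ℝ => fun i => ℓ i + s) (fun _ => 1) s :=
    hasDerivAt_pi.2 fun i => (hasDerivAt_id s).const_add (ℓ i)
  refine (hd.hasFDerivAt.comp_hasDerivAt s h1).congr_deriv ?_
  have h2 : (fun _ : Fin n => (1 : ℝ)) = ∑ i, Pi.single i 1 := by
    rw [Finset.univ_sum_single]
  rw [h2, map_sum]
  refine Finset.sum_congr rfl fun i _ => ?_
  rw [eigPartial]
  have h3 : HasDerivAt (Function.update (fun i => ℓ i + s) i) (Pi.single i (1 : ℝ)) (ℓ i + s) :=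
    hasDerivAt_update _ i _
  have h4 : HasFDerivAt (eigFun b H) (fderiv ℝ (eigFun b H) fun i => ℓ i + s)
      (Function.update (fun i => ℓ i + s) i (ℓ i + s)) := by
    rw [Function.update_eq_self i (fun i => ℓ i + s)]
    exact hd.hasFDerivAt
  exact (h4.comp_hasDerivAt (ℓ i + s) h3).deriv.symm

namespace Admissible

variable {b : Matrix (Fin p) (Fin p) ℝ → ℝ} {β₀ C : ℝ} {S : Matrix (Fin p) (Fin p) ℝ}
  {H : Matrix (Fin p) (Fin n) ℝ} {H₀ : Matrix (Fin p) (Fin (p - n)) ℝ} {ℓ : Fin n → ℝ}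

/-- The derivative along the shift is the sum of the partial derivatives, and the assumption applies
at every shifted point because it again has a spectral decomposition with the same frame. -/
theorem le_shift (hb : Admissible n b β₀ C) (h : IsSpectralDecomp S H H₀ ℓ) {s : ℝ}
    (hs : 0 ≤ s) : b S ≤ b (H * diagonal (fun i => ℓ i + s) * Hᵀ) := by
  have hder : ∀ t : ℝ, 0 ≤ t → HasDerivAt (fun s : ℝ => eigFun b H fun i => ℓ i + s)
      (∑ i, eigPartial b H (fun i => ℓ i + t) i) t := fun t ht =>
    hasDerivAt_eigFun_shift (hb.diff _ _ _ _ (h.shift ht))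
  have hmono : MonotoneOn (fun s : ℝ => eigFun b H fun i => ℓ i + s) (Set.Ici 0) := by
    refine monotoneOn_of_deriv_nonneg (convex_Ici 0)
      (fun t ht => (hder t ht).continuousAt.continuousWithinAt)
      (fun t ht => ?_) fun t ht => ?_
    · rw [interior_Ici] at ht
      exact (hder t (Set.mem_Ioi.1 ht).le).differentiableAt.differentiableWithinAt
    · rw [interior_Ici] at ht
      have ht' := (Set.mem_Ioi.1 ht).le
      rw [(hder t ht').deriv]
      exact hb.sum _ _ _ _ (h.shift ht')
  have := hmono Set.self_mem_Ici (Set.mem_Ici.2 hs) hs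
  simpa [eigFun, ← h.eq] using this

/-- Two effects push the root up: the target `b` grows, and for a fixed root each term of the sum
shrinks as its eigenvalue grows. -/
theorem root_le_shift (hb : Admissible n b β₀ C) (h : IsSpectralDecomp S H H₀ ℓ) {s : ℝ}
    (hs : 0 ≤ s) : rootWeight n b S ≤
      rootWeight n b (H * diagonal (fun i => ℓ i + s) * Hᵀ) := by
  have k := h.shift hs
  have h0 : ∀ {S H H₀ ℓ}, IsSpectralDecomp (n := n) S H H₀ ℓ → 0 ≤ b S := fun h =>
    hb.pos.le.trans (hb.lower _ _ _ _ h)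
  have h1 : ∀ {S H H₀ ℓ}, IsSpectralDecomp (n := n) S H H₀ ℓ → b S < n := fun h =>
    (hb.upper _ _ _ _ h).trans_lt hb.lt
  rw [rootWeight_eq h (h0 h) (h1 h), rootWeight_eq k (h0 k) (h1 k)]
  refine ENNReal.ofReal_le_ofReal ?_
  obtain ⟨h2, h3⟩ := lamHat_spec k.pos (h0 k) (h1 k)
  rw [lamHat_le_iff h.pos (h0 h) (h1 h) h2]
  refine (hb.le_shift h hs).trans (h3.symm.le.trans (Finset.sum_le_sum fun j _ => ?_))
  have := h.pos j
  rcases h2.eq_or_lt with h4 | h4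
  · rw [← h4]; simp
  · gcongr
    linarith

end Admissible

/-! ### The losses -/

/-- The root as a real-valued measurable function of the sample. -/
noncomputable def rootOf (b : Matrix (Fin p) (Fin p) ℝ → ℝ)
    (X : Fin n → EuclideanSpace ℝ (Fin p)) : ℝ :=
  (rootWeight n b (gramSum X)).toReal

/-- The almost sure value of the Stein loss of `deltaEB`. -/
noncomputable def lossEB (b : Matrix (Fin p) (Fin p) ℝ → ℝ) (Z : Matrix (Fin p) (Fin p) ℝ)
    (X : Fin n → EuclideanSpace ℝ (Fin p)) : ℝ :=
  (p : ℝ)⁻¹ * ((Z * gramSum X).trace + rootOf b X * Z.trace) -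
    (Real.log Z.det + p * Real.log (p : ℝ)⁻¹ +
      (Real.log (innerMat X + rootOf b X • 1).det +
        ((p - n : ℕ) : ℝ) * Real.log (rootOf b X))) - p

/-- The almost sure value of the Stein loss of `deltaSH`. -/
noncomputable def lossSH (b : Matrix (Fin p) (Fin p) ℝ → ℝ) (Z : Matrix (Fin p) (Fin p) ℝ)
    (X : Fin n → EuclideanSpace ℝ (Fin p)) : ℝ :=
  (p : ℝ)⁻¹ * ((Z * gramSum X).trace +
      (rootOf b X * Z.trace - rootOf b X * (Z * colProj X).trace)) -
    (Real.log Z.det + p * Real.log (p : ℝ)⁻¹ +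
      (Real.log (innerMat X).det + ((p - n : ℕ) : ℝ) * Real.log (rootOf b X))) - p

/-- The eigenvalues `ℓ` of a sample and the root `r` belonging to them. -/
structure SampleSpectrum (b : Matrix (Fin p) (Fin p) ℝ → ℝ) (β₀ C : ℝ)
    (X : Fin n → EuclideanSpace ℝ (Fin p)) (ℓ : Fin n → ℝ) : Prop where
  pos : ∀ i, 0 < ℓ i
  root_pos : 0 < rootOf b X
  root_le : rootOf b X ≤ C / (n - C) * ∑ i, ℓ i
  inv_root_le : (rootOf b X)⁻¹ ≤ n / β₀ * ∑ i, (ℓ i)⁻¹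
  sum_ge : β₀ ≤ ∑ i, rootOf b X / (ℓ i + rootOf b X)
  weight : rootWeight n b (gramSum X) = ENNReal.ofReal (rootOf b X)
  det_add : ∀ s, (innerMat X + s • (1 : Matrix (Fin n) (Fin n) ℝ)).det = ∏ i, (ℓ i + s)
  det : (innerMat X).det = ∏ i, ℓ i
  trace : (innerMat X).trace = ∑ i, ℓ i
  trace_inv : ((innerMat X)⁻¹).trace = ∑ i, (ℓ i)⁻¹

theorem log_det_smul_mul {Z M : Matrix (Fin p) (Fin p) ℝ} {c : ℝ} (hc : 0 < c) (hZ : 0 < Z.det)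
    (hM : 0 < M.det) : Real.log (Z * (c • M)).det =
      Real.log Z.det + p * Real.log c + Real.log M.det := by
  rw [det_mul, det_smul, Fintype.card_fin, Real.log_mul hZ.ne' (by positivity),
    Real.log_mul (by positivity) hM.ne', Real.log_pow]
  ring

theorem Admissible.exists_sampleSpectrum {b : Matrix (Fin p) (Fin p) ℝ → ℝ} {β₀ C : ℝ}
    (hb : Admissible n b β₀ C) (hp : 0 < p) {X : Fin n → EuclideanSpace ℝ (Fin p)}
    (hX : Generic X) {Sig : Matrix (Fin p) (Fin p) ℝ} (hSig : Sig.PosDef) :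
    (∃ ℓ, SampleSpectrum b β₀ C X ℓ) ∧
      steinLoss (deltaEB n b (gramSum X)) Sig = lossEB b Sig⁻¹ X ∧
      steinLoss (deltaSH n b (gramSum X)) Sig = lossSH b Sig⁻¹ X := by
  obtain ⟨V, H, H₀, ℓ, h, k⟩ := hX.exists_isSpectralDecomp
  have h1 := hb.lower _ _ _ _ k
  have h2 := hb.upper _ _ _ _ k
  have h0 := hb.pos.trans_le h1
  have hn := h2.trans_lt hb.lt
  have hpos := lamHat_pos k.pos h0 hn
  have hw := rootWeight_eq k h0.le hn
  have hr : rootOf b X = lamHat ℓ (b (gramSum X)) := by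
    rw [rootOf, hw, ENNReal.toReal_ofReal hpos.le]
  have hp' : (0 : ℝ) < (p : ℝ)⁻¹ := by positivity
  have hZ := hSig.inv.det_pos
  have hprod : 0 < ∏ i, ℓ i := Finset.prod_pos fun i _ => h.pos i
  have hprod' : 0 < ∏ i, (ℓ i + rootOf b X) := Finset.prod_pos fun i _ => by
    rw [hr]; linarith [h.pos i]
  -- This replaces the chosen kernel frame by a measurable function of the sample.
  have hproj : H₀ * H₀ᵀ = 1 - colProj X := by
    have h3 : colProj X = H * Hᵀ := h.proj
    rw [h3, ← k.sum_proj]; abel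
  have hdet : (innerMat X).det = ∏ i, ℓ i := h.det_gram
  have hdet' : ∀ s, (innerMat X + s • (1 : Matrix (Fin n) (Fin n) ℝ)).det = ∏ i, (ℓ i + s) :=
    h.det_gram_add
  have hrp : 0 < rootOf b X := by rw [hr]; exact hpos
  refine ⟨⟨ℓ, h.pos, hrp, ?_, ?_, ?_, ?_, hdet', hdet, h.trace_gram, h.trace_gram_inv⟩, ?_, ?_⟩
  · rw [hr]; exact lamHat_le k.pos h0 h2 hb.lt
  · rw [hr]; exact inv_lamHat_le k.pos hb.pos h1 hn
  · rw [hr, (lamHat_spec k.pos h0.le hn).2]; exact h1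
  · rw [hw, hr]
  · rw [k.deltaEB_eq, ← hr, steinLoss, log_det_smul_mul hp' hZ, k.det_add_smul_one, lossEB,
      hdet', Real.log_mul hprod'.ne' (by positivity), Real.log_pow]
    · simp [trace_add, trace_smul, mul_add]
    · rw [k.det_add_smul_one]; positivity
  · rw [k.deltaSH_eq, ← hr, steinLoss, log_det_smul_mul hp' hZ, k.det_add_smul_kernel_proj,
      lossSH, hdet, Real.log_mul hprod.ne' (by positivity), Real.log_pow, hproj]
    · simp [trace_add, trace_sub, trace_smul, mul_sub, mul_add]
    · rw [k.det_add_smul_kernel_proj]; positivity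

/-- Reduces the integrability of the logarithms in the losses to the moments of `tr W` and `tr W⁻¹`.
-/
theorem abs_log_le {x : ℝ} (hx : 0 < x) : |Real.log x| ≤ x + x⁻¹ := by
  have h1 := Real.log_le_sub_one_of_pos hx
  have h2 := Real.one_sub_inv_le_log_of_pos hx
  have h3 : 0 < x⁻¹ := by positivity
  rw [abs_le]
  constructor <;> linarith

theorem abs_log_prod_le {ℓ : Fin n → ℝ} (hℓ : ∀ i, 0 < ℓ i) {s : ℝ} (hs : 0 ≤ s) :
    |Real.log (∏ i, (ℓ i + s))| ≤ ∑ i, ℓ i + n * s + ∑ i, (ℓ i)⁻¹ := by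
  have hpos : ∀ i, 0 < ℓ i + s := fun i => by linarith [hℓ i]
  rw [Real.log_prod fun i _ => (hpos i).ne']
  calc |∑ i, Real.log (ℓ i + s)| ≤ ∑ i, |Real.log (ℓ i + s)| := Finset.abs_sum_le_sum_abs _ _
    _ ≤ ∑ i, (ℓ i + s + (ℓ i)⁻¹) := by
        refine Finset.sum_le_sum fun i _ => (abs_log_le (hpos i)).trans ?_
        have := hℓ i
        gcongr
        linarith
    _ = _ := by simp [Finset.sum_add_distrib]

/-! ### Integrability -/

theorem measurable_trace_mul_gramSum (Z : Matrix (Fin p) (Fin p) ℝ) :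
    Measurable fun X : Fin n → EuclideanSpace ℝ (Fin p) => (Z * gramSum X).trace :=
  measurable_trace.comp (Measurable.matrixMul measurable_const measurable_gramSum)

theorem integrable_trace_mul_gramSum (n : ℕ) (Z Sig : Matrix (Fin p) (Fin p) ℝ) :
    Integrable (fun X : Fin n → EuclideanSpace ℝ (Fin p) => (Z * gramSum X).trace)
      (sampleLaw n Sig) := by
  refine ((integrable_trace_innerMat n Sig).const_mul (∑ i, ∑ j, |Z i j|)).mono'
    (measurable_trace_mul_gramSum Z).aestronglyMeasurable (Filter.Eventually.of_forall fun X => ?_)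
  have hS : ∀ i j, |gramSum X i j| ≤ (innerMat X).trace := by
    intro i j
    rw [trace_innerMat, gramSum, Matrix.sum_apply]
    refine (Finset.abs_sum_le_sum_abs _ _).trans (Finset.sum_le_sum fun k _ => ?_)
    rw [vecMulVec_apply, abs_mul, sq]
    exact mul_le_mul (PiLp.norm_apply_le (X k) i) (PiLp.norm_apply_le (X k) j) (abs_nonneg _)
      (norm_nonneg _)
  rw [Real.norm_eq_abs, Matrix.trace, Finset.sum_mul]
  refine (Finset.abs_sum_le_sum_abs _ _).trans (Finset.sum_le_sum fun i _ => ?_)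
  rw [diag_apply, mul_apply, Finset.sum_mul]
  refine (Finset.abs_sum_le_sum_abs _ _).trans (Finset.sum_le_sum fun j _ => ?_)
  rw [abs_mul]
  exact mul_le_mul_of_nonneg_left (hS j i) (abs_nonneg _)

section Integrability

variable {b : Matrix (Fin p) (Fin p) ℝ → ℝ} {β₀ C : ℝ} {Sig : Matrix (Fin p) (Fin p) ℝ}

theorem measurable_rootOf (hb : Measurable b) :
    Measurable fun X : Fin n → EuclideanSpace ℝ (Fin p) => rootOf b X :=
  ((measurable_rootWeight hb).comp measurable_gramSum).ennreal_toReal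

theorem Admissible.ae_sampleSpectrum (hb : Admissible n b β₀ C) (hnp : n < p)
    (hSig : Sig.PosDef) : ∀ᵐ X ∂(sampleLaw n Sig), ∃ ℓ, SampleSpectrum b β₀ C X ℓ := by
  filter_upwards [ae_generic hnp hSig] with X hX
  exact (hb.exists_sampleSpectrum (by omega) hX hSig).1

theorem Admissible.integrable_root (hb : Admissible n b β₀ C) (hnp : n < p)
    (hSig : Sig.PosDef) :
    Integrable (fun X : Fin n → EuclideanSpace ℝ (Fin p) => rootOf b X) (sampleLaw n Sig) := by
  refine ((integrable_trace_innerMat n Sig).const_mul (C / (n - C))).mono'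
    (measurable_rootOf hb.measurable).aestronglyMeasurable ?_
  filter_upwards [hb.ae_sampleSpectrum hnp hSig] with X ⟨ℓ, h⟩
  rw [Real.norm_eq_abs, abs_of_pos h.root_pos, h.trace]
  exact h.root_le

theorem Admissible.integrable_root_mul (hb : Admissible n b β₀ C) (hnp : n < p)
    (hSig : Sig.PosDef) :
    Integrable (fun X : Fin n → EuclideanSpace ℝ (Fin p) =>
      rootOf b X * (Sig⁻¹ * colProj X).trace) (sampleLaw n Sig) := by
  refine ((hb.integrable_root hnp hSig).mul_const Sig⁻¹.trace).mono'
    ((measurable_rootOf hb.measurable).mul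
      (measurable_trace_mul_colProj _)).aestronglyMeasurable ?_
  filter_upwards [hb.ae_sampleSpectrum hnp hSig, ae_generic hnp hSig] with X ⟨ℓ, h⟩ hX
  have h1 := trace_mul_colProj_nonneg hSig.inv.posSemidef hX.1
  rw [Real.norm_eq_abs, abs_of_nonneg (mul_nonneg h.root_pos.le h1)]
  exact mul_le_mul_of_nonneg_left (trace_mul_colProj_le hSig.inv.posSemidef hX.1) h.root_pos.le

theorem Admissible.integrable_log_root (hb : Admissible n b β₀ C) (hnp : n + 1 < p)
    (hSig : Sig.PosDef) :
    Integrable (fun X : Fin n → EuclideanSpace ℝ (Fin p) => Real.log (rootOf b X))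
      (sampleLaw n Sig) := by
  refine ((hb.integrable_root (by omega) hSig).add
    ((integrable_trace_innerMat_inv hnp hSig).const_mul (n / β₀))).mono'
    (measurable_rootOf hb.measurable).log.aestronglyMeasurable ?_
  filter_upwards [hb.ae_sampleSpectrum (by omega) hSig] with X ⟨ℓ, h⟩
  have := h.inv_root_le
  rw [← h.trace_inv] at this
  exact (abs_log_le h.root_pos).trans (add_le_add_right this _)

theorem measurable_det_innerMat_add {f : (Fin n → EuclideanSpace ℝ (Fin p)) → ℝ}
    (hf : Measurable f) :
    Measurable fun X : Fin n → EuclideanSpace ℝ (Fin p) => (innerMat X + f X • 1).det :=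
  (Continuous.measurable (continuous_id.matrix_det)).comp
    (Measurable.matrixAddSMul continuous_innerMat.measurable measurable_const hf)

theorem Admissible.integrable_log_det_add (hb : Admissible n b β₀ C) (hnp : n + 1 < p)
    (hSig : Sig.PosDef) :
    Integrable (fun X : Fin n → EuclideanSpace ℝ (Fin p) =>
      Real.log (innerMat X + rootOf b X • 1).det) (sampleLaw n Sig) := by
  refine (((integrable_trace_innerMat n Sig).add
    ((hb.integrable_root (by omega) hSig).const_mul n)).add
    (integrable_trace_innerMat_inv hnp hSig)).mono'
    (measurable_det_innerMat_add (measurable_rootOf hb.measurable)).log.aestronglyMeasurable ?_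
  filter_upwards [hb.ae_sampleSpectrum (by omega) hSig] with X ⟨ℓ, h⟩
  rw [Real.norm_eq_abs, h.det_add]
  simp only [Pi.add_apply, h.trace, h.trace_inv]
  exact abs_log_prod_le h.pos h.root_pos.le

theorem Admissible.integrable_log_det (hb : Admissible n b β₀ C) (hnp : n + 1 < p)
    (hSig : Sig.PosDef) :
    Integrable (fun X : Fin n → EuclideanSpace ℝ (Fin p) => Real.log (innerMat X).det)
      (sampleLaw n Sig) := by
  refine ((integrable_trace_innerMat n Sig).add (integrable_trace_innerMat_inv hnp hSig)).mono'
    ((Continuous.measurable (continuous_id.matrix_det)).comp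
      continuous_innerMat.measurable).log.aestronglyMeasurable ?_
  filter_upwards [hb.ae_sampleSpectrum (by omega) hSig] with X ⟨ℓ, h⟩
  rw [Real.norm_eq_abs, h.det]
  simp only [Pi.add_apply, h.trace, h.trace_inv]
  simpa using abs_log_prod_le h.pos le_rfl

theorem Admissible.integrable_lossEB (hb : Admissible n b β₀ C) (hnp : n + 1 < p)
    (hSig : Sig.PosDef) : Integrable (lossEB (n := n) b Sig⁻¹) (sampleLaw n Sig) := by
  have hnp' : n < p := by omega
  exact ((((integrable_trace_mul_gramSum n Sig⁻¹ Sig).add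
    ((hb.integrable_root hnp' hSig).mul_const _)).const_mul _).sub
    ((integrable_const _).add ((hb.integrable_log_det_add hnp hSig).add
      ((hb.integrable_log_root hnp hSig).const_mul _)))).sub (integrable_const _)

theorem Admissible.integrable_lossSH (hb : Admissible n b β₀ C) (hnp : n + 1 < p)
    (hSig : Sig.PosDef) : Integrable (lossSH (n := n) b Sig⁻¹) (sampleLaw n Sig) := by
  have hnp' : n < p := by omega
  exact ((((integrable_trace_mul_gramSum n Sig⁻¹ Sig).add
    (((hb.integrable_root hnp' hSig).mul_const _).sub
      (hb.integrable_root_mul hnp' hSig))).const_mul _).sub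
    ((integrable_const _).add ((hb.integrable_log_det hnp hSig).add
      ((hb.integrable_log_root hnp hSig).const_mul _)))).sub (integrable_const _)

/-- The divergence inequality for the root, with its integrability. -/
theorem Admissible.integral_root_mul_trace_inv_le (hb : Admissible n b β₀ C) (hnp : n < p)
    (hSig : Sig.PosDef) :
    Integrable (fun X : Fin n → EuclideanSpace ℝ (Fin p) =>
      rootOf b X * (((p : ℝ) - n - 1) * ((innerMat X)⁻¹).trace)) (sampleLaw n Sig) ∧
    ∫ X : Fin n → EuclideanSpace ℝ (Fin p),
      rootOf b X * (((p : ℝ) - n - 1) * ((innerMat X)⁻¹).trace) ∂(sampleLaw n Sig) ≤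
    ∫ X : Fin n → EuclideanSpace ℝ (Fin p),
      rootOf b X * (Sig⁻¹ * colProj X).trace ∂(sampleLaw n Sig) := by
  have hd : (0 : ℝ) ≤ (p : ℝ) - n - 1 := by
    have : (n : ℝ) + 1 ≤ p := by exact_mod_cast hnp
    linarith
  have hae := hb.ae_sampleSpectrum hnp hSig
  have hroot : ∫⁻ X, rootWeight n b (gramSum X) ∂(sampleLaw n Sig) ≠ ⊤ := by
    rw [lintegral_congr_ae (g := fun X => ENNReal.ofReal (rootOf b X))
      (hae.mono fun X ⟨ℓ, h⟩ => h.weight)]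
    exact (hb.integrable_root hnp hSig).lintegral_lt_top.ne
  have key := lintegral_trace_inv_le hnp hSig (measurable_rootWeight (n := n) hb.measurable)
    (fun X hX s hs => by
      obtain ⟨V, H, H₀, ℓ, h, k⟩ := hX.exists_isSpectralDecomp
      have h1 : gramSum X + s • colProj X = H * diagonal (fun i => ℓ i + s) * Hᵀ := by
        rw [gramSum_eq]; exact h.outer_add_proj s
      rw [h1]
      exact hb.root_le_shift k hs) hroot
  have hl : ∫⁻ X, rootWeight n b (gramSum X) *
      ENNReal.ofReal (((p : ℝ) - n - 1) * ((innerMat X)⁻¹).trace) ∂(sampleLaw n Sig) =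
      ∫⁻ X, ENNReal.ofReal (rootOf b X *
        (((p : ℝ) - n - 1) * ((innerMat X)⁻¹).trace)) ∂(sampleLaw n Sig) :=
    lintegral_congr_ae (hae.mono fun X ⟨ℓ, h⟩ => by
      simp only [h.weight, ENNReal.ofReal_mul h.root_pos.le])
  have hr : ∫⁻ X, rootWeight n b (gramSum X) *
      ENNReal.ofReal (Sig⁻¹ * colProj X).trace ∂(sampleLaw n Sig) =
      ∫⁻ X, ENNReal.ofReal (rootOf b X * (Sig⁻¹ * colProj X).trace) ∂(sampleLaw n Sig) :=
    lintegral_congr_ae (hae.mono fun X ⟨ℓ, h⟩ => by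
      simp only [h.weight, ENNReal.ofReal_mul h.root_pos.le])
  rw [hl, hr] at key
  have hIr := hb.integrable_root_mul hnp hSig
  have hm : AEStronglyMeasurable (fun X : Fin n → EuclideanSpace ℝ (Fin p) =>
      rootOf b X * (((p : ℝ) - n - 1) * ((innerMat X)⁻¹).trace)) (sampleLaw n Sig) :=
    ((measurable_rootOf hb.measurable).mul
      (measurable_trace_innerMat_inv.const_mul _)).aestronglyMeasurable
  have hnl : 0 ≤ᵐ[sampleLaw n Sig] fun X : Fin n → EuclideanSpace ℝ (Fin p) =>
      rootOf b X * (((p : ℝ) - n - 1) * ((innerMat X)⁻¹).trace) := by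
    filter_upwards [hae] with X ⟨ℓ, h⟩
    refine mul_nonneg h.root_pos.le (mul_nonneg hd ?_)
    rw [h.trace_inv]
    exact Finset.sum_nonneg fun i _ => (inv_pos.2 (h.pos i)).le
  have hnr : 0 ≤ᵐ[sampleLaw n Sig] fun X : Fin n → EuclideanSpace ℝ (Fin p) =>
      rootOf b X * (Sig⁻¹ * colProj X).trace := by
    filter_upwards [hae, ae_generic hnp hSig] with X ⟨ℓ, h⟩ hX
    exact mul_nonneg h.root_pos.le (trace_mul_colProj_nonneg hSig.inv.posSemidef hX.1)
  refine ⟨(lintegral_ofReal_ne_top_iff_integrable hm hnl).1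
    (key.trans_lt hIr.lintegral_lt_top).ne, ?_⟩
  rw [integral_eq_lintegral_of_nonneg_ae hnl hm,
    integral_eq_lintegral_of_nonneg_ae hnr hIr.aestronglyMeasurable]
  exact ENNReal.toReal_mono hIr.lintegral_lt_top.ne key

/-! ### Domination -/

theorem integral_lt_integral_of_ae_lt {Ω : Type*} [MeasurableSpace Ω] {μ : Measure Ω}
    [NeZero μ] {f g : Ω → ℝ} (hf : Integrable f μ) (hg : Integrable g μ)
    (h : ∀ᵐ x ∂μ, f x < g x) : ∫ x, f x ∂μ < ∫ x, g x ∂μ := by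
  refine (integral_mono_ae hf hg (h.mono fun x hx => hx.le)).lt_of_ne fun heq => ?_
  have h1 : ∫ x, (g x - f x) ∂μ = 0 := by rw [integral_sub hg hf, heq, sub_self]
  rw [integral_eq_zero_iff_of_nonneg_ae (h.mono fun x hx => (sub_pos.2 hx).le)
    (hg.sub hf)] at h1
  obtain ⟨x, hx1, hx2⟩ := (h.and h1).exists
  have : g x - f x = 0 := hx2
  linarith

/-- The pointwise inequality is strict almost surely, so the risk inequality is strict at every
`Sig`. The hypothesis `hcm` says that the Padé bound at `c` suffices. -/
theorem Admissible.risk_lt {c : ℝ} (hc : 0 < c) (hb : Admissible n b (c * n / (1 + c)) C)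
    (hnp : n + 1 < p) (hcm : p * (c * (6 + c) / (6 + 4 * c)) ≤ ((p : ℝ) - n - 1) * c)
    (hSig : Sig.PosDef) :
    HasFiniteRisk n (deltaSH n b) Sig ∧ HasFiniteRisk n (deltaEB n b) Sig ∧
      risk n (deltaSH n b) Sig < risk n (deltaEB n b) Sig := by
  have hnp' : n < p := by omega
  have hp : 0 < p := by omega
  -- For `n = 0` the lower bound `c n / (1 + c)` would be `0`, whereas admissibility makes it
  -- positive.
  have hn : 0 < n := Nat.pos_of_ne_zero fun h => by
    have := hb.pos
    simp [h] at this
  have hE : (fun X => steinLoss (deltaEB n b (gramSum X)) Sig) =ᵐ[sampleLaw n Sig]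
      lossEB b Sig⁻¹ := by
    filter_upwards [ae_generic hnp' hSig] with X hX
    exact (hb.exists_sampleSpectrum hp hX hSig).2.1
  have hS : (fun X => steinLoss (deltaSH n b (gramSum X)) Sig) =ᵐ[sampleLaw n Sig]
      lossSH b Sig⁻¹ := by
    filter_upwards [ae_generic hnp' hSig] with X hX
    exact (hb.exists_sampleSpectrum hp hX hSig).2.2
  have hIE := hb.integrable_lossEB hnp hSig
  have hIS := hb.integrable_lossSH hnp hSig
  refine ⟨hIS.congr hS.symm, hIE.congr hE.symm, ?_⟩
  rw [risk, risk, integral_congr_ae hE, integral_congr_ae hS, ← sub_pos, ← integral_sub hIE hIS]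
  obtain ⟨hIW, hW⟩ := hb.integral_root_mul_trace_inv_le hnp' hSig
  have hIr := hb.integrable_root_mul hnp' hSig
  have hIl : Integrable (fun X : Fin n → EuclideanSpace ℝ (Fin p) =>
      Real.log (innerMat X + rootOf b X • 1).det - Real.log (innerMat X).det)
      (sampleLaw n Sig) := (hb.integrable_log_det_add hnp hSig).sub (hb.integrable_log_det hnp hSig)
  have hdiff : ∀ X : Fin n → EuclideanSpace ℝ (Fin p), lossEB b Sig⁻¹ X - lossSH b Sig⁻¹ X =
      (p : ℝ)⁻¹ * (rootOf b X * (Sig⁻¹ * colProj X).trace) -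
      (Real.log (innerMat X + rootOf b X • 1).det - Real.log (innerMat X).det) := by
    intro X
    rw [lossEB, lossSH]
    ring
  have hlt : ∫ X, p * (Real.log (innerMat X + rootOf b X • 1).det - Real.log (innerMat X).det)
      ∂(sampleLaw n Sig) < ∫ X : Fin n → EuclideanSpace ℝ (Fin p),
        rootOf b X * (((p : ℝ) - n - 1) * ((innerMat X)⁻¹).trace) ∂(sampleLaw n Sig) := by
    refine integral_lt_integral_of_ae_lt (hIl.const_mul _) hIW ?_
    filter_upwards [hb.ae_sampleSpectrum hnp' hSig] with X ⟨ℓ, h⟩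
    have hr := h.root_pos
    -- With `xᵢ = λ/ℓᵢ` the terms `λ/(ℓᵢ+λ)` become `xᵢ/(1+xᵢ)`, and `∑ xᵢ = λ tr W⁻¹`.
    have h1 := sum_log_lt (x := fun i => rootOf b X / ℓ i) hn (Nat.cast_nonneg p) hc hcm
      (fun i => (div_pos hr (h.pos i)).le) (h.sum_ge.trans (Finset.sum_le_sum fun i _ => by
        have := h.pos i
        refine le_of_eq ?_
        field_simp)) (by exact_mod_cast hp)
    have h2 : Real.log (innerMat X + rootOf b X • 1).det - Real.log (innerMat X).det =
        ∑ i, Real.log (1 + rootOf b X / ℓ i) := by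
      rw [h.det_add, h.det, Real.log_prod fun i _ => (add_pos (h.pos i) hr).ne',
        Real.log_prod fun i _ => (h.pos i).ne', ← Finset.sum_sub_distrib]
      refine Finset.sum_congr rfl fun i _ => ?_
      have := h.pos i
      rw [← Real.log_div (by positivity) this.ne', add_div, div_self this.ne']
    rw [h2, h.trace_inv]
    refine h1.trans_eq ?_
    simp only [div_eq_mul_inv, ← Finset.mul_sum]
    ring
  simp only [hdiff]
  rw [integral_sub (hIr.const_mul _) hIl, integral_const_mul]
  rw [integral_const_mul] at hlt
  have hp' : (0 : ℝ) < p := by exact_mod_cast hp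
  rw [sub_pos, inv_mul_eq_div, lt_div_iff₀ hp', mul_comm]
  exact hlt.trans_le hW

end Integrability

end SteinCov

open SteinCov in
theorem mainTheorem1 (p n : ℕ) (hnp : n < p) (hpn : 0 < 3 * (p : ℝ) - 4 * n - 4)
    (c₀ : ℝ) (hc₀ : c₀ = 6 * ((n : ℝ) + 1) / (3 * p - 4 * n - 4))
    (b : Matrix (Fin p) (Fin p) ℝ → ℝ)
    (hb : Measurable fun S : Fin p → Fin p → ℝ => b (Matrix.of S))
    (C : ℝ) (hC : 0 < C) (hCn : C < n)
    (hupper : ∀ S H H₀ ℓ, IsSpectralDecomp (n := n) S H H₀ ℓ → b S ≤ C)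
    (hlower : ∀ S H H₀ ℓ, IsSpectralDecomp (n := n) S H H₀ ℓ → c₀ * n / (1 + c₀) ≤ b S)
    (hdiff : ∀ S H H₀ ℓ, IsSpectralDecomp (n := n) S H H₀ ℓ →
      DifferentiableAt ℝ (eigFun b H) ℓ)
    (hsum : ∀ S H H₀ ℓ, IsSpectralDecomp (n := n) S H H₀ ℓ →
      0 ≤ ∑ i, eigPartial b H ℓ i) :
    Dominates n (deltaSH n b) (deltaEB n b) := by
  have hn : (0 : ℝ) < n := hC.trans hCn
  have hc : 0 < c₀ := by rw [hc₀]; positivity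
  -- The hypothesis `3p > 4(n+1)` is more than the existence of `E[tr W⁻¹]` requires.
  have hp1 : n + 1 < p := by
    have h1 : 4 * n + 4 < 3 * p := by
      have : (4 : ℝ) * n + 4 < 3 * p := by linarith
      exact_mod_cast this
    omega
  have hadm : Admissible n b (c₀ * n / (1 + c₀)) C :=
    ⟨hb, by positivity, hCn, hlower, hupper, hdiff, hsum⟩
  -- Equality holds: `c₀` is the solution of `p (6 + c) = (p-n-1)(6 + 4c)`.
  have hcm : p * (c₀ * (6 + c₀) / (6 + 4 * c₀)) ≤ ((p : ℝ) - n - 1) * c₀ := by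
    have h1 : c₀ * (3 * p - 4 * n - 4) = 6 * ((n : ℝ) + 1) := by
      rw [hc₀, div_mul_cancel₀ _ hpn.ne']
    rw [← mul_div_assoc, div_le_iff₀ (by positivity)]
    refine le_of_eq ?_
    linear_combination (-c₀) * h1
  have key := fun (Sig : Matrix (Fin p) (Fin p) ℝ) (hSig : Sig.PosDef) =>
    hadm.risk_lt hc hp1 hcm hSig
  exact ⟨fun Sig hSig => ⟨(key Sig hSig).1, (key Sig hSig).2.1, (key Sig hSig).2.2.le⟩,
    1, Matrix.PosDef.one, (key 1 Matrix.PosDef.one).2.2⟩
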